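/- **Setting.** A principal and an agent interact for $T\ge 2$ rounds; there are $K\ge 1$ arms. For each arm $a$ the principal's and the agent's rewards have laws $\mathcal D^P_a,\mathcal D^A_a$ supported in $[0,1]$ with means $\theta_a,\mu_a$. In round $t=1,\dots,T$ the principal proposes $\pi(t)\in\mathbb R_{\ge 0}^K$, the agent plays an arm $A_t$, the principal observes $A_t$ and her reward $X_{A_t}(t)\sim\mathcal D^P_{A_t}$, and the agent observes $R_{A_t}(t)\sim\mathcal D^A_{A_t}$. The rewards of round $t$ are independent of the history $\mathcal H_t=(A_s,X_{A_s}(s),R_{A_s}(s))_{s<t}$ and of $A_t$. Let $N_a(t)$ be the number of plays of $a$ before round $t$, $\hat\mu_a(t)=\sum_{s<t}R_a(s)\mathbf 1\{A_s=a\}/\max\{1,N_a(t)\}$ and $\hat\theta_a(t)=\sum_{s<t}X_a(s)\mathbf 1\{A_s=a\}/\max\{1,N_a(t)\}$. **Exploratory learning agent with constant $c_0>0$.** Let $\tau$ be the least integer $\tau\ge 2$ with $c_0\sqrt{\log(2\tau)}<\sqrt{\tau}$. For all $t\in[\tau,T]$, almost surely, $$\mathbb P\big(A_t\notin\arg\max_a\{\hat\mu_a(t)+\pi_a(t)\}\,\big|\,\mathcal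 H_t\big)\le c_0\sqrt{\log(2t)/t}.$$ Tie-breaking and exploration are otherwise arbitrary. **Search for arm $a$.** Write $\pi^0(a;c)$ for the incentive $c$ on arm $a$ and $0$ elsewhere, and $n=\lceil\log_2T\rceil$. Start with Check = False, $y^{up}=1$, $[\underline y,\overline y]=[0,1]$, $C_1=C_2=0$. In each round $t$: - If Check = False: let $y=(\underline y+\overline y)/2$, increase $C_1$ by one, propose $\pi^0(a;y)$. If $A_t=a$: return $y+\frac1T$ if $C_1\ge n$, else set $y^{up}=\overline y=y$. If $A_t\ne a$: set $\underline y=y$ and Check = True. - If Check = True: propose $\pi^0(a;y^{up})$. If $A_t=a$: increase $C_2$ by one, return $y^{up}+\frac2T$ if $C_2=n$, else set Check = False. If $A_t\neq a$: return $y^{up}+\frac1T+\frac1{\max\{1,N_a(t)\}}+\frac2{\max\{1,\min_iN_i(t)\}}$. **The algorithm** with horizon $T$ and confidence $\delta\in(0,1)$. Let $\iota=16KT^2\log_2(T)\log(4\log_2(T)/\delta)/\delta$, $T_0=1$, $T_m=32c_0^3\,2^{2m}K\log(16TK/\delta)\log^2(\iota)$ for $m\ge1$, and $r=\lceil2\log(4\log_2(T)/\delta)\rceil$.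 Start with $\mathcal A_1=[K]$, $\mathcal B_1=\emptyset$. In phases $m=1,2,\dots$, until round $T$ is over, put $\rho_m=\frac{\max\{1,|\mathcal B_m|\}}{T_{m-1}|\mathcal A_m|}$ and $\epsilon_m=(\log(16KT/\delta)\rho_m)^{1/3}+\sqrt{\log(16KT/\delta)/T_{m-1}}$ and do the following. 1. For each $a\in\mathcal B_m$ propose $\pi^0(a;1+\frac1T)$ for $\big\lceil2\log^{1/3}(16KT/\delta)\big(\tfrac{|\mathcal A_m|}{\max\{1,|\mathcal B_m|\}}T_{m-1}\big)^{2/3}\big\rceil$ rounds. 2. For each $a\in\mathcal A_m$ run the search $r$ times, sort the outputs $b^{(1)}_{m,a}\le\dots\le b^{(r)}_{m,a}$ and put $\overline b^{(i)}_{m,a}=\min\{1+\frac1T,\;b^{(i)}_{m,a}+\rho_m^{2/3}+\frac1{T_{m-1}}+4\epsilon_m\}$. 3. For each $a\in\mathcal A_m$ and $i=1,\dots,r$: propose $\pi^0(a;\overline b^{(i)}_{m,a})$ round after round, where $Y^{(i)}$ counts these rounds and $c^{(i)}$ those with $A_t\ne a$, until $c^{(i)}>2c_0\sqrt{Y^{(i)}\log(2T)}+\sqrt{8\log(\iota)/Y^{(i)}}$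 or $Y^{(i)}\ge2T_m$; leave the loop over $i$ as soon as $\sum_{j\le i}(Y^{(j)}-c^{(j)})\ge T_m$. 4. For each $a\in\mathcal A_m$, starting in the current round $t_0$, in all rounds $t$ with $t_0\le t\le t_0+8\log(8K\log_2(T)/\delta)$ propose the incentive with $\pi_a=1+\hat\theta_a(t_0)+5\sqrt{\log(16KT/\delta)/(2T_m)}$, $\pi_b=1+\hat\theta_b(t_0)$ for $b\in\mathcal A_m\setminus\{a\}$ and $\pi_b=0$ for $b\in\mathcal B_m$. Record $1$ if $A_t=a$ and $0$ otherwise, and move $a$ from the active to the bad arms of phase $m+1$ if the median of these records is $0$. Arms are processed in increasing order; if no arm is active at the start of a phase, all further incentives are $0$. **Theorem.** For all $c_0>0$ and $\kappa>0$ there is a constant $C=C(c_0,\kappa)$ such that for all $K\ge1$ and $T\ge2$ with $T\ge\kappa K$, all reward laws and every exploratory learning agent with constant $c_0$, the algorithm with $\delta=1/T$ satisfies $$\mathbb E[\overline R_T]\le C\Big(\log^{5/3}(KT)\,K^{1/3}T^{2/3}+\log^2(KT)\sqrt{KT}+K^2\log^3(KT)\Big),$$ where $$\overline R_T=\sum_{t=1}^T\Big(\max_{b}\{\theta_b+\mu_b\}-\max_z\mu_z-\Big(\theta_{A_t}-\sum_a\pi_a(t)\Big)\Big)$$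 is integrable. -/

import Mathlib

open MeasureTheory ProbabilityTheory

/-! ### Adaptive procedures of the principal -/

/-- A procedure that repeatedly proposes an incentive vector and then observes the arm played by
the agent and the principal's reward of that arm, until it is done and returns a value. -/
inductive Protocol (K : ℕ) (α : Type) : Type
  | done (a : α) : Protocol K α
  | offer (incentive : Fin K → ℝ) (next : Fin K → ℝ → Protocol K α) : Protocol K α

namespace Protocol

variable {K : ℕ} {α β : Type}

/-- Sequential composition of procedures. -/
def bind : Protocol K α → (α → Protocol K β) → Protocol K β
  | done a, f => f a
  | offer p next, f => offer p (fun i x => (next i x).bind f)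

instance : Monad (Protocol K) where
  pure := Protocol.done
  bind := Protocol.bind

/-- The incentive vector proposed in the `n`-th step (counted from `0`) when `obs s` is what the
principal observes in step `s`, i.e. the played arm with its reward. It depends on `obs s` for
`s < n` only. It is zero once the procedure has ended. -/
def incentiveAt : Protocol K α → (ℕ → Fin K × ℝ) → ℕ → Fin K → ℝ
  | done _, _, _ => 0
  | offer p _, _, 0 => p
  | offer _ next, obs, n + 1 =>
      (next (obs 0).1 (obs 0).2).incentiveAt (fun s => obs (s + 1)) n

end Protocol

/-- What the principal tracks: for each arm, the number of plays so far and the sum of the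
principal's rewards of these plays. -/
structure Tally (K : ℕ) where
  count : Fin K → ℕ
  total : Fin K → ℝ

namespace Tally

variable {K : ℕ}

/-- Nothing has been played. -/
def empty (K : ℕ) : Tally K := ⟨fun _ => 0, fun _ => 0⟩

/-- Update after arm `i` was played and gave the principal the reward `x`. -/
noncomputable def update (S : Tally K) (i : Fin K) (x : ℝ) : Tally K :=
  ⟨fun b => if b = i then S.count b + 1 else S.count b,
   fun b => if b = i then S.total b + x else S.total b⟩

/-- The principal's empirical mean of arm `a`. -/
noncomputable def mean (S : Tally K) (a : Fin K) : ℝ :=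
  S.total a / (max 1 (S.count a) : ℕ)

end Tally

/-- Procedures of a principal who keeps a tally of all plays. -/
abbrev Principal (K : ℕ) := StateT (Tally K) (Protocol K)

namespace Principal

variable {K : ℕ} {α : Type}

/-- Propose `p` for one round, update the tally, and return the arm that was played. -/
noncomputable def propose (p : Fin K → ℝ) : Principal K (Fin K) :=
  fun S => Protocol.offer p (fun i x => Protocol.done (i, S.update i x))

/-- Run a procedure `n` times in a row and collect the results. -/
def times : ℕ → Principal K α → Principal K (List α)
  | 0, _ => pure []
  | n + 1, q => do
      let x ← q
      let xs ← times n q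
      pure (x :: xs)

/-- Run a procedure for every entry of a list, in order, and collect the results. -/
def forEach {β : Type} (q : β → Principal K α) : List β → Principal K (List α)
  | [] => pure []
  | b :: bs => do
      let x ← q b
      let xs ← forEach q bs
      pure (x :: xs)

end Principal

namespace Exploratory

open Principal

/-! ### Noisy binary search with asymmetric check -/

section Search

variable {K : ℕ}

/-- The one-hot incentive: `c` on arm `a` and zero on all other arms. -/
noncomputable def oneHot (a : Fin K) (c : ℝ) : Fin K → ℝ := fun i => if i = a then c else 0

/-- The main loop of the search for arm `a`. Here `check` is the flag, `up` the latest incentive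
that enticed the agent, `[lo, hi]` the search range, and `C1`, `C2` are the two counters. The
tally is read before the round, so it holds the numbers of plays before this round. A number of
plays equal to zero is replaced by one, which makes the returned value at least `1 + 1 / T`. -/
noncomputable def searchLoop (T : ℕ) (a : Fin K) (check : Bool) (up lo hi : ℝ) (C1 C2 : ℕ) :
    Principal K ℝ := do
  let S ← get
  if check = false then
    let mid : ℝ := (hi + lo) / 2
    let i ← propose (oneHot a mid)
    if i = a then
      if _h : C1 + 1 ≥ ⌈Real.logb 2 T⌉₊ then
        pure (mid + 1 / T)
      else
        searchLoop T a false mid lo mid (C1 + 1) C2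
    else
      searchLoop T a true up mid hi (C1 + 1) C2
  else
    let i ← propose (oneHot a up)
    if i = a then
      if _h : C2 + 1 ≥ ⌈Real.logb 2 T⌉₊ then
        pure (up + 2 / T)
      else
        searchLoop T a false up lo hi C1 (C2 + 1)
    else
      pure (up + 1 / T + 1 / (max 1 (S.count a) : ℕ) + 2 / (max 1 (⨅ i, S.count i) : ℕ))
termination_by
  2 * (⌈Real.logb 2 T⌉₊ - C2) + (⌈Real.logb 2 T⌉₊ - C1) + (if check = false then 1 else 0)
decreasing_by all_goals grind

/-- The search for a near-optimal incentive for arm `a`. -/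
noncomputable def search (T : ℕ) (a : Fin K) : Principal K ℝ :=
  searchLoop T a false 1 0 1 0 0

end Search

/-! ### The elimination algorithm for the exploratory learning agent -/

section Algorithm

variable (K T : ℕ) (c₀ δ : ℝ)

/-- The number `ι`. -/
noncomputable def iota : ℝ :=
  16 * K * T ^ 2 * Real.logb 2 T * Real.log (4 * Real.logb 2 T / δ) / δ

/-- The number `T_m`, with `T_0 = 1`. -/
noncomputable def phaseLength (m : ℕ) : ℝ :=
  if m = 0 then 1
  else 32 * c₀ ^ 3 * 2 ^ (2 * m) * K * Real.log (16 * T * K / δ) * Real.log (iota K T δ) ^ 2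

/-- The ratio `max {1, |B_m|} / (T_{m-1} |A_m|)`, where `act` is `A_m`. -/
noncomputable def ratio (m : ℕ) (act : Finset (Fin K)) : ℝ :=
  (max 1 (actᶜ.card) : ℕ) / (phaseLength K T c₀ δ (m - 1) * act.card)

/-- The number `Z_m` of rounds in which each bad arm is targeted. -/
noncomputable def stabilizeRounds (m : ℕ) (act : Finset (Fin K)) : ℕ :=
  ⌈2 * Real.log (16 * K * T / δ) ^ (1 / 3 : ℝ) *
    ((act.card : ℝ) / (max 1 (actᶜ.card) : ℕ) * phaseLength K T c₀ δ (m - 1)) ^ (2 / 3 : ℝ)⌉₊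

/-- The number of searches for each active arm in each phase. -/
noncomputable def searchCalls : ℕ := ⌈2 * Real.log (4 * Real.logb 2 T / δ)⌉₊

/-- The number `ε_m`. -/
noncomputable def eps (m : ℕ) (act : Finset (Fin K)) : ℝ :=
  (Real.log (16 * K * T / δ) * ratio K T c₀ δ m act) ^ (1 / 3 : ℝ) +
    √(Real.log (16 * K * T / δ) / phaseLength K T c₀ δ (m - 1))

/-- The enlargement of an incentive `b` found by a search in phase `m`. -/
noncomputable def enlarge (m : ℕ) (act : Finset (Fin K)) (b : ℝ) : ℝ :=
  min (1 + 1 / T)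
    (b + ratio K T c₀ δ m act ^ (2 / 3 : ℝ) + 1 / phaseLength K T c₀ δ (m - 1) +
      4 * eps K T c₀ δ m act)

/-- The bound that the number of plays of non-target arms must not exceed in `Y` rounds. -/
noncomputable def threshold (Y : ℕ) : ℝ :=
  2 * c₀ * √(Y * Real.log (2 * T)) + √(8 * Real.log (iota K T δ) / Y)

variable {K}

/-- Test the incentive `b` for arm `a` in phase `m`, when `Y` rounds of this test are over and `c`
of them were plays of other arms. Returns the final values of `Y` and `c`. -/
noncomputable def testLoop (m : ℕ) (a : Fin K) (b : ℝ) (Y c : ℕ) : Principal K (ℕ × ℕ) := do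
  let i ← propose (oneHot a b)
  let c' : ℕ := if i = a then c else c + 1
  if _h : (c' : ℝ) > threshold K T c₀ δ (Y + 1) ∨ (Y + 1 : ℕ) ≥ 2 * phaseLength K T c₀ δ m then
    pure (Y + 1, c')
  else
    testLoop m a b (Y + 1) c'
termination_by ⌈2 * phaseLength K T c₀ δ m⌉₊ - Y
decreasing_by
  simp only [not_or, not_le, ge_iff_le] at _h
  have := Nat.lt_ceil.2 _h.2
  omega

/-- Incentive testing of arm `a` with a list of incentives; `g` is the number of plays of `a` in
the tests so far, i.e. the sum of the differences `Y - c`. -/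
noncomputable def testAll (m : ℕ) (a : Fin K) : List ℝ → ℝ → Principal K Unit
  | [], _ => pure ()
  | b :: bs, g => do
      let Yc ← testLoop T c₀ δ m a b 0 0
      let g' : ℝ := g + ((Yc.1 : ℝ) - (Yc.2 : ℝ))
      if g' ≥ phaseLength K T c₀ δ m then pure () else testAll m a bs g'

/-- The incentive for the comparison of arm `a` with the other active arms, built from the
principal's empirical means in the tally `S`. -/
noncomputable def compareIncentive (m : ℕ) (act : Finset (Fin K)) (S : Tally K) (a : Fin K) :
    Fin K → ℝ := fun b =>
  if b = a then
    1 + S.mean a + 5 * √(Real.log (16 * K * T / δ) / (2 * phaseLength K T c₀ δ m))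
  else if b ∈ act then 1 + S.mean b
  else 0

/-- The median of a list of numbers (the mean of the two middle entries if the length is even). -/
def median (L : List ℚ) : ℚ :=
  let s := L.insertionSort (· ≤ ·)
  (s.getD ((s.length - 1) / 2) 0 + s.getD (s.length / 2) 0) / 2

/-- Trustworthy online elimination of arm `a`: returns whether arm `a` stays active. The incentive
is frozen at the start and is proposed in all rounds `t` with
`t₀ ≤ t ≤ t₀ + 8 log (8 K log₂ T / δ)`. -/
noncomputable def keepArm (m : ℕ) (act : Finset (Fin K)) (a : Fin K) : Principal K Bool := do
  let S ← get
  let L ← times (⌊8 * Real.log (8 * K * Real.logb 2 T / δ)⌋₊ + 1) (do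
    let i ← propose (compareIncentive T c₀ δ m act S a)
    pure (if i = a then (1 : ℚ) else 0))
  pure (decide (median L ≠ 0))

/-- Phase `m` with set of active arms `act`. Returns the next set of active arms. -/
noncomputable def phase (m : ℕ) (act : Finset (Fin K)) : Principal K (Finset (Fin K)) := do
  -- stabilize the estimators of the bad arms
  let _ ← forEach
    (fun a => times (stabilizeRounds K T c₀ δ m act) (propose (oneHot a (1 + 1 / T))))
    (actᶜ.sort (· ≤ ·))
  -- search incentives repeatedly, sort them and enlarge them
  let found ← forEach (fun a => do
      let bs ← times (searchCalls T δ) (search T a)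
      pure (a, (bs.insertionSort (· ≤ ·)).map (enlarge K T c₀ δ m act)))
    (act.sort (· ≤ ·))
  -- incentive testing
  let _ ← forEach (fun ab : Fin K × List ℝ => testAll T c₀ δ m ab.1 ab.2 0) found
  -- trustworthy online elimination
  let kept ← forEach (fun a => do
      let k ← keepArm T c₀ δ m act a
      pure (a, k))
    (act.sort (· ≤ ·))
  pure (act.filter (fun a => (a, true) ∈ kept))

/-- The phases `m, m + 1, …, m + n - 1`. -/
noncomputable def phases : ℕ → ℕ → Finset (Fin K) → Principal K Unit
  | 0, _, _ => pure ()
  | n + 1, m, act => do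
      let act' ← phase T c₀ δ m act
      phases n (m + 1) act'

variable (K)

/-- The whole algorithm. A phase with an active arm has at least one round, so `T` phases
suffice for `T` rounds. -/
noncomputable def algorithm : Protocol K (Unit × Tally K) :=
  (phases T c₀ δ T 1 Finset.univ).run (Tally.empty K)

end Algorithm

/-! ### The repeated game with an exploratory learning agent -/

/-- The reward distributions of the arms, all supported in `[0, 1]`. -/
structure Arms (K : ℕ) where
  principalLaw : Fin K → Measure ℝ
  agentLaw : Fin K → Measure ℝ
  principal_prob : ∀ a, IsProbabilityMeasure (principalLaw a)
  agent_prob : ∀ a, IsProbabilityMeasure (agentLaw a)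
  principal_supp : ∀ a, ∀ᵐ x ∂(principalLaw a), x ∈ Set.Icc (0 : ℝ) 1
  agent_supp : ∀ a, ∀ᵐ x ∂(agentLaw a), x ∈ Set.Icc (0 : ℝ) 1

namespace Arms

variable {K : ℕ} (D : Arms K)

/-- The principal's mean reward `θ_a`. -/
noncomputable def θ (a : Fin K) : ℝ := ∫ x, x ∂(D.principalLaw a)

/-- The agent's mean reward `μ_a`. -/
noncomputable def μ (a : Fin K) : ℝ := ∫ x, x ∂(D.agentLaw a)

end Arms

section Game

variable {K : ℕ} {Ω : Type*}
  (X R : ℕ → Fin K → Ω → ℝ) (A : ℕ → Ω → Fin K) (alg : Protocol K (Unit × Tally K))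

/-- The incentive proposed in round `t = 1, 2, …` when the principal runs `alg`, the arm `A s` is
played in round `s` and the principal's reward of arm `a` in round `s` is `X s a`. -/
noncomputable def incentive (t : ℕ) (ω : Ω) : Fin K → ℝ :=
  alg.incentiveAt (fun s => (A (s + 1) ω, X (s + 1) (A (s + 1) ω) ω)) (t - 1)

/-- `N_a(t)`: the number of plays of arm `a` before round `t`. -/
def plays (a : Fin K) (t : ℕ) (ω : Ω) : ℕ :=
  ((Finset.Ico 1 t).filter (fun s => A s ω = a)).card

/-- The agent's empirical mean of arm `a` at round `t`; it is zero before the first play. -/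
noncomputable def agentMean (a : Fin K) (t : ℕ) (ω : Ω) : ℝ :=
  (∑ s ∈ Finset.Ico 1 t, if A s ω = a then R s a ω else 0) / (max 1 (plays A a t ω) : ℕ)

/-- The event that the agent explores in round `t`: the arm that she plays is no maximizer of
empirical mean plus incentive. -/
def explores (t : ℕ) : Set Ω :=
  {ω | ∃ b, agentMean R A (A t ω) t ω + incentive X A alg t ω (A t ω) <
    agentMean R A b t ω + incentive X A alg t ω b}

/-- The history before round `t`: all arms played in the rounds `1, …, t - 1`, with the rewards
of both players. -/
@[reducible] def history (t : ℕ) : MeasurableSpace Ω :=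
  ⨆ s ∈ Finset.Ico 1 t,
    MeasurableSpace.comap (fun ω => (A s ω, X s (A s ω) ω, R s (A s ω) ω)) inferInstance

/-- The first time `τ ≥ 2` with `c₀ √(log (2 τ)) < √τ`. -/
noncomputable def explorationTime (c₀ : ℝ) : ℕ :=
  sInf {n : ℕ | 2 ≤ n ∧ c₀ * √(Real.log (2 * n)) < √n}

/-- `T` rounds of the game in which the principal runs `alg` against an exploratory learning agent:
`X t a` and `R t a` are the rewards of arm `a` in round `t` for the principal and for the agent,
`A t` is the arm played in round `t`. The rewards have the given laws and those of round `t` are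
independent of the history and of the arm played in this round. Given the history, the agent
explores in round `t` with probability at most `c₀ √(log (2 t) / t)`; otherwise she plays a
maximizer of empirical mean plus incentive. Neither the ties nor the exploration are restricted. -/
structure IsExploratoryGame [MeasurableSpace Ω] (P : Measure Ω) (T : ℕ) (c₀ : ℝ) (D : Arms K) :
    Prop where
  measurable_X : ∀ t ∈ Finset.Icc 1 T, ∀ a, Measurable (X t a)
  measurable_R : ∀ t ∈ Finset.Icc 1 T, ∀ a, Measurable (R t a)
  measurable_A : ∀ t ∈ Finset.Icc 1 T, Measurable (A t)
  law_X : ∀ t ∈ Finset.Icc 1 T, ∀ a, P.map (X t a) = D.principalLaw a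
  law_R : ∀ t ∈ Finset.Icc 1 T, ∀ a, P.map (R t a) = D.agentLaw a
  indep_X : ∀ t ∈ Finset.Icc 1 T, ∀ a,
    Indep (MeasurableSpace.comap (X t a) inferInstance)
      (history X R A t ⊔ MeasurableSpace.comap (A t) inferInstance) P
  indep_R : ∀ t ∈ Finset.Icc 1 T, ∀ a,
    Indep (MeasurableSpace.comap (R t a) inferInstance)
      (history X R A t ⊔ MeasurableSpace.comap (A t) inferInstance) P
  explore_le : ∀ t ∈ Finset.Icc (explorationTime c₀) T,
    P⟦explores X R A alg t | history X R A t⟧ ≤ᵐ[P] fun _ => c₀ * √(Real.log (2 * t) / t)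

/-- The regret `R̄_T` with respect to the oracle benchmark, in which the principal is charged with
the sum of all proposed incentives. -/
noncomputable def regretBar (D : Arms K) (T : ℕ) (ω : Ω) : ℝ :=
  ∑ t ∈ Finset.Icc 1 T,
    ((⨆ b, (D.θ b + D.μ b)) - (⨆ z, D.μ z) -
      (D.θ (A t ω) - ∑ a, incentive X A alg t ω a))

end Game

end Exploratory

/-! The argument separates probability from bookkeeping. An outcome determines a path: the arms
played and the principal's rewards. Along a fixed path the algorithm is deterministic, and
`GoodPath` collects what the analysis needs: outside exploration rounds the agent plays a maximizer
of empirical mean plus incentive, the empirical means of both players are within their confidence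
radii, and exploration is rare in all relevant windows. `regret_le_of_goodPath` bounds the regret of
every such path, and `exists_measure_bad_le` bounds the probability of all others by `10 / T`. The
incentives are bounded in terms of `c₀`, so the regret never exceeds a multiple of `K T`
(`ae_abs_regretBar_le`), and the bad event costs only `O(K)`, which `K² log³(K T)` absorbs. The
inequalities between the parameters hold for large `T`, uniformly in `K ≤ T / κ`; smaller horizons
are left to the trivial bound.

Write `M = max μ` and `L = log(16 K T / δ)`. Making the agent play `a` takes an incentive of about
`M - μ a`, and at this price a play of `a` has as regret exactly the gap of `θ a + μ a` to the best
such sum. A round therefore costs gap plus overpayment, and each phase has to keep both small.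

The agent also compares the target with bad arms, so their means must be stable too. Stabilization
gives each bad arm about `L^{1/3} ρ^{-2/3}` plays, where `ρ` is `ratio`, and all means of the agent
become accurate to `eps` (`accurate_of_counts`). The cost of these rounds and the cost of the
remaining inaccuracy are balanced, both at most of order `L^{1/3} K^{1/3} T^{2/3}`; this is the
leading term. A search without exploration brackets `M - μ a` (`Wp_searchLoop`). A window of `r`
searches holds fewer than `r` explorations, so some search is clean, and the enlargement makes its
output enticing (`Wp_searches`). The tests climb the sorted list. An enticing incentive is missed
only through exploration, hence passes its test, so no larger incentive is needed and `T_m` plays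
are collected (`Wp_testAll`). In the comparisons the agent herself ranks the sums of empirical
means. The bonus outweighs four confidence radii, so the best arm survives and arms with a gap above
twice the bonus are removed, while the median ignores the explorations (`Wp_keepAll`). Thus
`Wp_phase` hands `PhaseInv` to the next phase.

Every active arm enters phase `m` with `T_{m-1}` plays, so `|A_m| T_{m-1} ≤ T` if the phase starts
in time (`card_mul_le`). This turns the square root errors into `√(K T)`, and since `T_m` grows by
the factor four there are `O(log T)` phases.

On the probabilistic side, an exponential supermartingale and a union over the number of plays
handle adaptive sampling (`FreshRewards.measure_deviation_le`), and a conditional Chernoff bound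
handles exploration (`IsExploratoryGame.measure_exploreCount_ge_le`). The delicate case is that of
the tests, where the expected number of explorations may come close to the threshold
(`RareScales.rareExploration`). -/

/-! ### Weakest preconditions along a fixed path of observations -/

namespace Tally

variable {K : ℕ}

/-- The tally of the first `t` observations of a path. -/
noncomputable def ofPath (obs : ℕ → Fin K × ℝ) : ℕ → Tally K
  | 0 => Tally.empty K
  | t + 1 => (ofPath obs t).update (obs t).1 (obs t).2

theorem ofPath_count_succ (obs : ℕ → Fin K × ℝ) (t : ℕ) (b : Fin K) :
    (ofPath obs (t + 1)).count b =
      (ofPath obs t).count b + if (obs t).1 = b then 1 else 0 := by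
  simp only [ofPath, update]
  by_cases h : (obs t).1 = b
  · simp [h]
  · simp [h, Ne.symm h]

theorem ofPath_total_succ (obs : ℕ → Fin K × ℝ) (t : ℕ) (b : Fin K) :
    (ofPath obs (t + 1)).total b =
      (ofPath obs t).total b + if (obs t).1 = b then (obs t).2 else 0 := by
  simp only [ofPath, update]
  by_cases h : (obs t).1 = b
  · simp [h]
  · simp [h, Ne.symm h]

theorem ofPath_count_eq (obs : ℕ → Fin K × ℝ) (t : ℕ) (b : Fin K) :
    (ofPath obs t).count b = ((Finset.range t).filter (fun k => (obs k).1 = b)).card := by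
  induction t with
  | zero => simp [ofPath, empty]
  | succ t ih =>
    rw [ofPath_count_succ, ih, Finset.range_add_one, Finset.filter_insert]
    split_ifs with h
    · rw [Finset.card_insert_of_notMem (by simp)]
    · simp

theorem ofPath_count_mono (obs : ℕ → Fin K × ℝ) (b : Fin K) :
    Monotone (fun t => (ofPath obs t).count b) := by
  refine monotone_nat_of_le_succ fun t => ?_
  simp only [ofPath_count_succ]
  omega

theorem sum_ofPath_count (obs : ℕ → Fin K × ℝ) (t : ℕ) :
    ∑ b, (ofPath obs t).count b = t := by
  induction t with
  | zero => simp [ofPath, empty]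
  | succ t ih => simp [ofPath_count_succ, Finset.sum_add_distrib, ih]

end Tally

namespace Protocol

variable {K : ℕ} {α β : Type}

/-- If the proposed incentives `π` follow the procedure from step `t` on, while `obs` is
observed, then the procedure ends with a result and an end time that satisfy `Q`. -/
def wp (obs : ℕ → Fin K × ℝ) (π : ℕ → Fin K → ℝ) :
    Protocol K α → ℕ → (α → ℕ → Prop) → Prop
  | done a, t, Q => Q a t
  -- The equation is a premise, so a procedure can be analysed without knowing where `π` comes from.
  -- It is discharged once, in `exists_of_wp`.
  | offer p next, t, Q => π t = p → wp obs π (next (obs t).1 (obs t).2) (t + 1) Q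

variable {obs : ℕ → Fin K × ℝ} {π : ℕ → Fin K → ℝ}

theorem wp_mono {p : Protocol K α} {t : ℕ} {Q Q' : α → ℕ → Prop} (h : wp obs π p t Q)
    (hQ : ∀ a t', t ≤ t' → Q a t' → Q' a t') : wp obs π p t Q' := by
  induction p generalizing t with
  | done a => exact hQ a t le_rfl h
  | offer p next ih =>
    exact fun hp => ih _ _ (h hp) fun a t' ht' => hQ a t' (by omega)

theorem wp_bind {p : Protocol K α} {f : α → Protocol K β} {t : ℕ} {Q : β → ℕ → Prop}
    (h : wp obs π p t (fun a t' => wp obs π (f a) t' Q)) : wp obs π (p.bind f) t Q := by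
  induction p generalizing t with
  | done a => exact h
  | offer p next ih => exact fun hp => ih _ _ (h hp)

/-- The incentives of an actual run follow the procedure, so all premises in `wp` hold and the
postcondition becomes a fact about the run. -/
theorem exists_of_wp {p : Protocol K α} {t : ℕ} {Q : α → ℕ → Prop} (h : wp obs π p t Q)
    (hπ : ∀ s, π (t + s) = p.incentiveAt (fun j => obs (t + j)) s) :
    ∃ a t', Q a t' ∧ ∀ k, t' ≤ k → π k = 0 := by
  induction p generalizing t with
  | done a =>
    refine ⟨a, t, h, fun k hk => ?_⟩
    have := hπ (k - t)
    rwa [Nat.add_sub_cancel' hk] at this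
  | offer p next ih =>
    refine ih _ _ (h (by simpa [incentiveAt] using hπ 0)) fun s => ?_
    have := hπ (s + 1)
    simp only [incentiveAt] at this
    rw [show t + 1 + s = t + (s + 1) by ring, this]
    congr 1
    ext j : 1
    rw [show t + 1 + j = t + (j + 1) by ring]

end Protocol

/-! ### Weakest preconditions of procedures that carry a tally. -/

namespace Principal

variable {K : ℕ} {α β : Type}

/-- The weakest precondition of a procedure that starts with the tally of the past. -/
def Wp (obs : ℕ → Fin K × ℝ) (π : ℕ → Fin K → ℝ) (q : Principal K α) (t : ℕ)
    (Q : α → ℕ → Prop) : Prop :=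
  (q (Tally.ofPath obs t)).wp obs π t
    (fun aS t' => aS.2 = Tally.ofPath obs t' ∧ t ≤ t' ∧ Q aS.1 t')

variable {obs : ℕ → Fin K × ℝ} {π : ℕ → Fin K → ℝ}

theorem Wp.mono {q : Principal K α} {t : ℕ} {Q Q' : α → ℕ → Prop} (h : Wp obs π q t Q)
    (hQ : ∀ a t', t ≤ t' → Q a t' → Q' a t') : Wp obs π q t Q' :=
  Protocol.wp_mono h fun _ _ ht' ⟨h1, h2, h3⟩ => ⟨h1, h2, hQ _ _ ht' h3⟩

theorem Wp_bind {q : Principal K α} {f : α → Principal K β} {t : ℕ} {Q : β → ℕ → Prop}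
    (h : Wp obs π q t (fun a t' => Wp obs π (f a) t' Q)) : Wp obs π (q >>= f) t Q := by
  refine Protocol.wp_bind (p := q (Tally.ofPath obs t)) (f := fun aS => f aS.1 aS.2)
    (Protocol.wp_mono h fun a t' ht' ⟨h1, h2, h3⟩ => ?_)
  rw [h1]
  exact Protocol.wp_mono h3 fun b t'' _ ⟨h4, h5, h6⟩ => ⟨h4, by omega, h6⟩

theorem Wp_pure {a : α} {t : ℕ} {Q : α → ℕ → Prop} (h : Q a t) :
    Wp obs π (pure a) t Q := ⟨rfl, le_rfl, h⟩

theorem Wp_get {t : ℕ} {Q : Tally K → ℕ → Prop} (h : Q (Tally.ofPath obs t) t) :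
    Wp obs π get t Q := ⟨rfl, le_rfl, h⟩

theorem Wp_propose {p : Fin K → ℝ} {t : ℕ} {Q : Fin K → ℕ → Prop}
    (h : π t = p → Q (obs t).1 (t + 1)) : Wp obs π (propose p) t Q :=
  fun hp => ⟨rfl, Nat.le_succ t, h hp⟩

/-- The invariant sees the list of results so far; this allows it to compare the number of failed
repetitions with the number of explorations. -/
theorem Wp_times {q : Principal K α} {I : List α → ℕ → Prop} (n : ℕ) {t : ℕ} (h0 : I [] t)
    (hstep : ∀ done t, done.length < n → I done t →
      Wp obs π q t (fun x t' => I (done ++ [x]) t')) :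
    Wp obs π (times n q) t (fun xs t' => xs.length = n ∧ I xs t') := by
  suffices H : ∀ m done t, done.length + m = n → I done t →
      Wp obs π (times m q) t (fun xs t' => xs.length = m ∧ I (done ++ xs) t') by
    simpa using H n [] t (by simp) h0
  intro m
  induction m with
  | zero => exact fun done t _ h => Wp_pure ⟨rfl, by simpa using h⟩
  | succ m ih =>
    intro done t hlen hI
    refine Wp_bind ((hstep done t (by omega) hI).mono fun x t' _ hx => ?_)
    refine Wp_bind ((ih (done ++ [x]) t' (by simp; omega) hx).mono fun xs t'' _ hxs => ?_)
    exact Wp_pure ⟨by simp [hxs.1], by simpa using hxs.2⟩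

theorem Wp_forEach {q : β → Principal K α} {I : List (β × α) → ℕ → Prop} (bs : List β) {t : ℕ}
    (h0 : I [] t)
    (hstep : ∀ b ∈ bs, ∀ done t, I done t →
      Wp obs π (q b) t (fun x t' => I (done ++ [(b, x)]) t')) :
    Wp obs π (forEach q bs) t (fun xs t' => xs.length = bs.length ∧ I (bs.zip xs) t') := by
  suffices H : ∀ (bs' : List β) done t, (∀ b ∈ bs', b ∈ bs) → I done t →
      Wp obs π (forEach q bs') t
        (fun xs t' => xs.length = bs'.length ∧ I (done ++ bs'.zip xs) t') by
    simpa using H bs [] t (fun _ h => h) h0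
  intro bs'
  induction bs' with
  | nil => exact fun done t _ h => Wp_pure ⟨rfl, by simpa using h⟩
  | cons b bs' ih =>
    intro done t hmem hI
    refine Wp_bind ((hstep b (hmem b (by simp)) done t hI).mono fun x t' _ hx => ?_)
    refine Wp_bind ((ih (done ++ [(b, x)]) t' (fun c hc => hmem c (by simp [hc])) hx).mono
      fun xs t'' _ hxs => ?_)
    exact Wp_pure ⟨by simp [hxs.1], by simpa using hxs.2⟩

end Principal

/-! ### Measurability of the proposed incentives -/

namespace Protocol

variable {K : ℕ} {α β : Type}

/-- A family of procedures, indexed by reward sequences `z`, that ends after the same number of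
steps for all `z` if the arms `arm` and the rewards `z` are observed, proposes incentives that
depend measurably on `z`, and has results that satisfy `Q`. -/
inductive UniformRun (arm : ℕ → Fin K) (Q : ((ℕ → ℝ) → α) → ℕ → Prop) :
    ((ℕ → ℝ) → Protocol K α) → ℕ → Prop
  | done (f : (ℕ → ℝ) → α) (t : ℕ) (h : Q f t) : UniformRun arm Q (fun z => done (f z)) t
  | offer (p : (ℕ → ℝ) → Fin K → ℝ) (next : (ℕ → ℝ) → Fin K → ℝ → Protocol K α) (t : ℕ) (hp : Measurable p)
      (h : UniformRun arm Q (fun z => next z (arm t) (z t)) (t + 1)) :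
      UniformRun arm Q (fun z => offer (p z) (next z)) t

variable {arm : ℕ → Fin K}

theorem UniformRun.bind {Q : ((ℕ → ℝ) → α) → ℕ → Prop} {Q' : ((ℕ → ℝ) → β) → ℕ → Prop}
    {p : (ℕ → ℝ) → Protocol K α} {t : ℕ} (h : UniformRun arm Q p t)
    {g : (ℕ → ℝ) → α → Protocol K β}
    (hg : ∀ f t', Q f t' → UniformRun arm Q' (fun z => g z (f z)) t') :
    UniformRun arm Q' (fun z => (p z).bind (g z)) t := by
  induction h with
  | done f t h => exact hg f t h
  | offer p next t hp h ih => exact .offer p (fun z i y => (next z i y).bind (g z)) t hp ih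

theorem UniformRun.measurable_incentiveAt {Q : ((ℕ → ℝ) → α) → ℕ → Prop} {p : (ℕ → ℝ) → Protocol K α} {t : ℕ}
    (h : UniformRun arm Q p t) (n : ℕ) :
    Measurable (fun z => (p z).incentiveAt (fun s => (arm (t + s), z (t + s))) n) := by
  induction h generalizing n with
  | done f t h => exact measurable_const
  | offer p next t hp h ih =>
    cases n with
    | zero => exact hp
    | succ n =>
      have := ih n
      simp only [incentiveAt]
      convert this using 6 <;> ring

theorem incentiveAt_congr (p : Protocol K α) {obs obs' : ℕ → Fin K × ℝ} {n : ℕ}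
    (h : ∀ s < n, obs s = obs' s) : p.incentiveAt obs n = p.incentiveAt obs' n := by
  induction p generalizing obs obs' n with
  | done a => rfl
  | offer p next ih =>
    cases n with
    | zero => rfl
    | succ n =>
      simp only [incentiveAt]
      rw [h 0 (by omega)]
      exact ih _ _ fun s hs => h (s + 1) (by omega)

end Protocol

/-! ### Procedures whose control flow depends on the played arms only. -/

namespace Principal

variable {K : ℕ} {α β : Type}

/-- A family of tallies with constant numbers of plays and measurable sums of rewards. -/
def UniformTally (S : (ℕ → ℝ) → Tally K) : Prop :=
  (∃ c, ∀ z, (S z).count = c) ∧ ∀ a, Measurable (fun z => (S z).total a)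

/-- For fixed arms, a family of procedures runs uniformly and its result is constant. -/
def UniformFrom (arm : ℕ → Fin K) (p : (ℕ → ℝ) → Protocol K (α × Tally K)) (t : ℕ) : Prop :=
  Protocol.UniformRun arm
    (fun f _ => ∃ a : α, ∃ S', UniformTally S' ∧ f = fun z => (a, S' z)) p t

/-- The control flow of a procedure depends on the played arms only. -/
def Uniform (q : Principal K α) : Prop :=
  ∀ (arm : ℕ → Fin K) (S : (ℕ → ℝ) → Tally K) (t : ℕ), UniformTally S →
    UniformFrom arm (fun z => q (S z)) t

theorem UniformFrom.bind {arm : ℕ → Fin K} {p : (ℕ → ℝ) → Protocol K (α × Tally K)} {t : ℕ}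
    (h : UniformFrom arm p t) {f : α → Principal K β} (hf : ∀ a, Uniform (f a)) :
    UniformFrom arm (fun z => (p z).bind (fun aS => f aS.1 aS.2)) t := by
  refine Protocol.UniformRun.bind h ?_
  rintro _ t' ⟨a, S', hS', rfl⟩
  exact hf a arm S' t' hS'

theorem Uniform.bind {q : Principal K α} (h : Uniform q) {f : α → Principal K β}
    (hf : ∀ a, Uniform (f a)) : Uniform (q >>= f) :=
  fun arm S t hS => (h arm S t hS).bind hf

theorem Uniform.pure (a : α) : Uniform (pure a : Principal K α) :=
  fun _ S t hS => .done (fun z => (a, S z)) t ⟨a, S, hS, rfl⟩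

theorem UniformTally.update {S : (ℕ → ℝ) → Tally K} (hS : UniformTally S) (i : Fin K) (t : ℕ) :
    UniformTally (fun z => (S z).update i (z t)) := by
  obtain ⟨⟨c, hc⟩, hm⟩ := hS
  refine ⟨⟨fun b => if b = i then c b + 1 else c b, fun z => ?_⟩, fun a => ?_⟩
  · ext b; simp [Tally.update, hc z]
  · simp only [Tally.update]
    split_ifs
    · exact (hm a).add (measurable_pi_apply t)
    · exact hm a

theorem UniformTally.propose {S : (ℕ → ℝ) → Tally K} (hS : UniformTally S) (arm : ℕ → Fin K)
    (t : ℕ) {p : (ℕ → ℝ) → Fin K → ℝ} (hp : Measurable p) :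
    UniformFrom arm (fun z => Principal.propose (p z) (S z)) t := by
  refine .offer p (fun z i x => Protocol.done (i, (S z).update i x)) t hp ?_
  exact .done (fun z => (arm t, (S z).update (arm t) (z t))) (t + 1)
    ⟨arm t, fun z => (S z).update (arm t) (z t), hS.update _ _, rfl⟩

theorem Uniform.propose (p : Fin K → ℝ) : Uniform (propose p) :=
  fun arm _ t hS => hS.propose arm t measurable_const

/-- Reading the numbers of plays. -/
theorem Uniform.get_bind {f : Tally K → Principal K α}
    (hf : ∀ S S' : Tally K, S.count = S'.count → f S = f S') (h : ∀ S, Uniform (f S)) :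
    Uniform (get >>= f) := by
  intro arm S t hS
  obtain ⟨c, hc⟩ := hS.1
  have : (fun z => (get >>= f : Principal K α) (S z)) = fun z => f (S 0) (S z) := by
    ext1 z
    change f (S z) (S z) = _
    rw [hf (S z) (S 0) (by rw [hc, hc])]
  rw [this]
  exact h _ arm S t hS

theorem Uniform.times {q : Principal K α} (h : Uniform q) (n : ℕ) : Uniform (times n q) := by
  induction n with
  | zero => exact .pure _
  | succ n ih => exact h.bind fun x => ih.bind fun xs => .pure _

theorem Uniform.forEach {q : β → Principal K α} (h : ∀ b, Uniform (q b)) (bs : List β) :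
    Uniform (forEach q bs) := by
  induction bs with
  | nil => exact .pure _
  | cons b bs ih => exact (h b).bind fun x => ih.bind fun xs => .pure _

end Principal

/-! ### Uniformity of the stages of the algorithm. -/

namespace Exploratory

open Principal

variable {K : ℕ}

/-- The search reads the tally, but only its numbers of plays, which are constants once the arms are
fixed. -/
theorem uniform_searchLoop (T : ℕ) (a : Fin K) (check : Bool) (up lo hi : ℝ) (C1 C2 : ℕ) :
    Uniform (searchLoop T a check up lo hi C1 C2) := by
  fun_induction searchLoop T a check up lo hi C1 C2 with
  | case1 check up lo hi C1 C2 ih1 ih2 ih3 =>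
    refine Uniform.get_bind (fun S S' hS => by simp only [hS]) fun S => ?_
    by_cases hc : check = false
    · rw [if_pos hc]
      refine (Uniform.propose _).bind fun i => ?_
      by_cases hi : i = a
      · rw [if_pos hi]
        split
        · exact .pure _
        · next hn => exact ih1 hc hn
      · rw [if_neg hi]
        exact ih2 hc
    · rw [if_neg hc]
      refine (Uniform.propose _).bind fun i => ?_
      by_cases hi : i = a
      · rw [if_pos hi]
        split
        · exact .pure _
        · next hn => exact ih3 hc hn
      · rw [if_neg hi]
        exact .pure _

theorem uniform_testLoop (T : ℕ) (c₀ δ : ℝ) (m : ℕ) (a : Fin K) (b : ℝ) (Y c : ℕ) :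
    Uniform (testLoop T c₀ δ m a b Y c) := by
  fun_induction testLoop T c₀ δ m a b Y c with
  | case1 Y c ih =>
    refine (Uniform.propose _).bind fun i => ?_
    extract_lets c'
    split
    · exact .pure _
    · next h => exact ih i h

theorem uniform_testAll (T : ℕ) (c₀ δ : ℝ) (m : ℕ) (a : Fin K) (bs : List ℝ) (g : ℝ) :
    Uniform (testAll T c₀ δ m a bs g) := by
  induction bs generalizing g with
  | nil => exact .pure _
  | cons b bs ih =>
    refine Uniform.bind (uniform_testLoop T c₀ δ m a b 0 0) fun Yc => ?_
    extract_lets g'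
    split_ifs
    · exact .pure _
    · exact ih _

/-- Here the reward sums are read, so `Uniform.get_bind` does not apply. They enter the proposed
incentive but never the control flow. -/
theorem uniform_keepArm (T : ℕ) (c₀ δ : ℝ) (m : ℕ) (act : Finset (Fin K)) (a : Fin K) :
    Uniform (keepArm T c₀ δ m act a) := by
  intro arm S t hS
  have hp : Measurable (fun z => compareIncentive T c₀ δ m act (S z) a) := by
    obtain ⟨⟨c, hc⟩, hm⟩ := hS
    have hmean : ∀ b, Measurable (fun z => (S z).mean b) := fun b => by
      simp only [Tally.mean, hc]
      exact (hm b).div_const _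
    refine measurable_pi_lambda _ fun b => ?_
    unfold compareIncentive
    split_ifs
    · exact ((hmean a).const_add 1).add_const _
    · exact (hmean b).const_add 1
    · exact measurable_const
  -- The frozen tally `S` that defines the incentive and the running tally `S'` are separate
  -- families.
  have key : ∀ (n : ℕ) (S' : (ℕ → ℝ) → Tally K) (t : ℕ), UniformTally S' →
      UniformFrom arm (fun z => times n (do
        let i ← propose (compareIncentive T c₀ δ m act (S z) a)
        pure (if i = a then (1 : ℚ) else 0)) (S' z)) t := by
    intro n
    induction n with
    | zero => exact fun S' t hS' => Uniform.pure _ arm S' t hS'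
    | succ n ih =>
      intro S' t hS'
      refine Protocol.UniformRun.bind
        (g := fun z xS => (do
          let xs ← times n (do
            let i ← propose (compareIncentive T c₀ δ m act (S z) a)
            pure (if i = a then (1 : ℚ) else 0))
          pure (xS.1 :: xs) : Principal K (List ℚ)) xS.2)
        ((hS'.propose arm t hp).bind (f := fun i => pure (if i = a then (1 : ℚ) else 0))
          fun _ => .pure _) ?_
      rintro _ t' ⟨x, S'', hS'', rfl⟩
      exact (ih S'' t' hS'').bind (f := fun xs => pure (x :: xs)) fun _ => .pure _
  exact (key _ S t hS).bind (f := fun L => pure (decide (median L ≠ 0))) fun _ => .pure _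

theorem uniform_phase (T : ℕ) (c₀ δ : ℝ) (m : ℕ) (act : Finset (Fin K)) :
    Uniform (phase T c₀ δ m act) := by
  refine (Uniform.forEach (fun a => (Uniform.propose _).times _) _).bind fun _ => ?_
  refine (Uniform.forEach (fun a => ?_) _).bind fun found => ?_
  · exact Uniform.bind (Uniform.times (uniform_searchLoop T a false 1 0 1 0 0) _) fun _ => .pure _
  refine (Uniform.forEach (fun ab : Fin K × List ℝ => uniform_testAll T c₀ δ m ab.1 ab.2 0) _).bind fun _ => ?_
  refine (Uniform.forEach (fun a => ?_) _).bind fun kept => .pure _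
  exact Uniform.bind (uniform_keepArm T c₀ δ m act a) fun _ => .pure _

theorem uniform_phases (T : ℕ) (c₀ δ : ℝ) (n m : ℕ) (act : Finset (Fin K)) :
    Uniform (phases T c₀ δ n m act) := by
  induction n generalizing m act with
  | zero => exact .pure _
  | succ n ih => exact Uniform.bind (uniform_phase T c₀ δ m act) fun _ => ih _ _

theorem measurable_algorithm_incentiveAt (T : ℕ) (c₀ δ : ℝ) (arm : ℕ → Fin K) (n : ℕ) :
    Measurable (fun z : ℕ → ℝ =>
      (algorithm K T c₀ δ).incentiveAt (fun s => (arm s, z s)) n) := by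
  have h := (uniform_phases T c₀ δ T 1 Finset.univ arm (fun _ => Tally.empty K) 0
    ⟨⟨_, fun _ => rfl⟩, fun _ => measurable_const⟩).measurable_incentiveAt n
  simp only [zero_add] at h
  exact h

/-- The incentive of a round is measurable with respect to the observations of earlier rounds. -/
theorem measurable_incentive {Ω : Type*} {mΩ : MeasurableSpace Ω} {X : ℕ → Fin K → Ω → ℝ}
    {A : ℕ → Ω → Fin K} (T : ℕ) (c₀ δ : ℝ) {t : ℕ} (hA : ∀ s ∈ Finset.Ico 1 t, Measurable (A s))
    (hX : ∀ s ∈ Finset.Ico 1 t, Measurable (fun ω => X s (A s ω) ω)) :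
    Measurable (incentive X A (algorithm K T c₀ δ) t) := by
  rcases isEmpty_or_nonempty Ω with hΩ | ⟨⟨ω₀⟩⟩
  · exact measurable_of_empty _
  let i₀ : Fin K := A 1 ω₀
  let arm : (Fin (t - 1) → Fin K) → ℕ → Fin K := fun v s => if h : s < t - 1 then v ⟨s, h⟩ else i₀
  -- There are finitely many arm sequences of length `t - 1`, so joint measurability reduces to
  -- measurability in the rewards for each of them. The default arm `i₀` and the default reward `0`
  -- fill positions that step `t - 1` never reads.
  have hG : Measurable (fun q : (Fin (t - 1) → Fin K) × (ℕ → ℝ) =>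
      (algorithm K T c₀ δ).incentiveAt (fun s => (arm q.1 s, q.2 s)) (t - 1)) :=
    measurable_from_prod_countable_right fun v => measurable_algorithm_incentiveAt T c₀ δ (arm v) _
  have hv : Measurable (fun ω => ((fun s : Fin (t - 1) => A (s + 1) ω),
      (fun s : ℕ => if s < t - 1 then X (s + 1) (A (s + 1) ω) ω else 0))) := by
    refine (measurable_pi_lambda _ fun s => hA _ (by simp; omega)).prodMk
      (measurable_pi_lambda _ fun s => ?_)
    split_ifs with hs
    · exact hX _ (by simp; omega)
    · exact measurable_const
  convert hG.comp hv using 1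
  ext1 ω
  refine Protocol.incentiveAt_congr _ fun s hs => ?_
  simp [arm, hs]

end Exploratory

/-! ### Concentration of empirical means under adaptive sampling -/

namespace Exploratory

section Concentration

variable {Ω : Type*} {mΩ : MeasurableSpace Ω} {P : Measure Ω} {K : ℕ}

/-- The rewards `Z 1, …, Z T` of arm `b` lie in `[0, 1]`, have mean `ν`, and each is independent of
the past and of the arm played in its round. -/
structure FreshRewards (ℋ : ℕ → MeasurableSpace Ω) (A : ℕ → Ω → Fin K) (Z : ℕ → Ω → ℝ) (b : Fin K)
    (P : Measure Ω) (T : ℕ) (ν : ℝ) : Prop where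
  le : ∀ t ≤ T + 1, ℋ t ≤ mΩ
  mono : Monotone ℋ
  arm : ∀ s ∈ Finset.Icc 1 T, Measurable[ℋ (s + 1)] (A s)
  reward : ∀ s ∈ Finset.Icc 1 T, Measurable[ℋ (s + 1)] (fun ω => if A s ω = b then Z s ω else 0)
  meas : ∀ s ∈ Finset.Icc 1 T, Measurable (Z s)
  indep : ∀ s ∈ Finset.Icc 1 T, Indep (MeasurableSpace.comap (Z s) inferInstance)
    (ℋ s ⊔ MeasurableSpace.comap (A s) inferInstance) P
  mem_Icc : ∀ s ∈ Finset.Icc 1 T, ∀ᵐ ω ∂P, Z s ω ∈ Set.Icc (0 : ℝ) 1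
  mean : ∀ s ∈ Finset.Icc 1 T, ∫ ω, Z s ω ∂P = ν

/-- The compensated sum of the observed rewards of arm `b`. -/
noncomputable def deviation (A : ℕ → Ω → Fin K) (Z : ℕ → Ω → ℝ) (b : Fin K) (ν : ℝ) (t : ℕ)
    (ω : Ω) : ℝ :=
  ∑ s ∈ Finset.Ico 1 t, if A s ω = b then Z s ω - ν else 0

theorem plays_succ (A : ℕ → Ω → Fin K) (b : Fin K) {t : ℕ} (ht : 1 ≤ t) (ω : Ω) :
    plays A b (t + 1) ω = plays A b t ω + if A t ω = b then 1 else 0 := by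
  unfold plays
  rw [Finset.card_filter, Finset.sum_Ico_succ_top ht, ← Finset.card_filter]

theorem plays_le (A : ℕ → Ω → Fin K) (b : Fin K) (t : ℕ) (ω : Ω) : plays A b t ω ≤ t - 1 := by
  unfold plays
  exact (Finset.card_filter_le _ _).trans (by simp)

variable {ℋ : ℕ → MeasurableSpace Ω} {A : ℕ → Ω → Fin K} {Z : ℕ → Ω → ℝ} {b : Fin K} {T : ℕ}
  {ν : ℝ}

theorem FreshRewards.measurableSet_arm (h : FreshRewards ℋ A Z b P T ν) {s t : ℕ}
    (hs : s ∈ Finset.Ico 1 t) (ht : t ≤ T + 1) : MeasurableSet[ℋ t] {ω | A s ω = b} := by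
  have hs' := Finset.mem_Ico.1 hs
  exact h.mono (by omega : s + 1 ≤ t) _
    (h.arm s (Finset.mem_Icc.2 ⟨hs'.1, by omega⟩) (measurableSet_singleton b))

theorem FreshRewards.measurable_deviation (h : FreshRewards ℋ A Z b P T ν) {t : ℕ}
    (ht : t ≤ T + 1) : Measurable[ℋ t] (deviation A Z b ν t) := by
  refine Finset.measurable_fun_sum _ fun s hs => ?_
  have hs' := Finset.mem_Ico.1 hs
  have h1 : Measurable[ℋ t] (fun ω => if A s ω = b then Z s ω else 0) :=
    (h.reward s (Finset.mem_Icc.2 ⟨hs'.1, by omega⟩)).mono (h.mono (by omega)) le_rfl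
  have h2 : Measurable[ℋ t] (fun ω => if A s ω = b then ν else 0) :=
    Measurable.ite (h.measurableSet_arm hs ht) measurable_const measurable_const
  convert h1.sub h2 using 1
  ext ω
  simp only [Pi.sub_apply]
  split_ifs <;> simp

theorem FreshRewards.measurable_plays (h : FreshRewards ℋ A Z b P T ν) {t : ℕ}
    (ht : t ≤ T + 1) : Measurable[ℋ t] (plays A b t) := by
  unfold plays
  simp only [Finset.card_filter]
  exact Finset.measurable_fun_sum _ fun s hs =>
    Measurable.ite (h.measurableSet_arm hs ht) measurable_const measurable_const

variable [IsProbabilityMeasure P]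

/-- Hoeffding's lemma: a variable in an interval of length one is sub-Gaussian with variance proxy
`1 / 4`. -/
theorem lintegral_exp_centered_le {Z : Ω → ℝ} (hZ : Measurable Z)
    (hb : ∀ᵐ ω ∂P, Z ω ∈ Set.Icc (0 : ℝ) 1) (r : ℝ) :
    ∫⁻ ω, ENNReal.ofReal (Real.exp (r * (Z ω - ∫ ω, Z ω ∂P) - r ^ 2 / 8)) ∂P ≤ 1 := by
  have hs := hasSubgaussianMGF_of_mem_Icc hZ.aemeasurable hb
  have hint := hs.integrable_exp_mul r
  have hle := hs.mgf_le r
  rw [← ofReal_integral_eq_lintegral_ofReal]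
  · rw [← ENNReal.ofReal_one]
    apply ENNReal.ofReal_le_ofReal
    simp only [Real.exp_sub, integral_div]
    rw [div_le_one (Real.exp_pos _)]
    refine hle.trans (Real.exp_le_exp.2 (le_of_eq ?_))
    norm_num
    ring
  · simp only [Real.exp_sub]
    exact hint.div_const _
  · exact Filter.Eventually.of_forall fun _ => (Real.exp_pos _).le

/-- An exponential supermartingale. A play of `b` multiplies the exponential by a factor of mean at
most one that is independent of the past and of the choice of the arm; any other round leaves it
unchanged. The compensator uses the random number of plays, so adaptive sampling does no harm. -/
theorem FreshRewards.lintegral_exp_deviation_le (h : FreshRewards ℋ A Z b P T ν) (r : ℝ) {t : ℕ}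
    (ht1 : 1 ≤ t) (ht : t ≤ T + 1) :
    ∫⁻ ω, ENNReal.ofReal (Real.exp (r * deviation A Z b ν t ω - r ^ 2 / 8 * plays A b t ω)) ∂P
      ≤ 1 := by
  induction t, ht1 using Nat.le_induction with
  | base => simp [deviation, plays]
  | succ t ht1 ih =>
    have htT : t ∈ Finset.Icc 1 T := Finset.mem_Icc.2 ⟨ht1, by omega⟩
    have ih := ih (by omega)
    set G : Ω → ENNReal := fun ω =>
      ENNReal.ofReal (Real.exp (r * deviation A Z b ν t ω - r ^ 2 / 8 * plays A b t ω)) with hG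
    have hGm : Measurable[ℋ t] G := by
      refine ENNReal.measurable_ofReal.comp (Real.measurable_exp.comp ?_)
      refine ((h.measurable_deviation (by omega)).const_mul r).sub (Measurable.const_mul ?_ _)
      exact measurable_from_top.comp (h.measurable_plays (by omega))
    set E : Ω → ENNReal := fun ω => ENNReal.ofReal (Real.exp (r * (Z t ω - ν) - r ^ 2 / 8)) with hE
    have hEle : ∫⁻ ω, E ω ∂P ≤ 1 := by
      rw [hE, ← h.mean t htT]
      exact lintegral_exp_centered_le (h.meas t htT) (h.mem_Icc t htT) r
    have hS' : MeasurableSet[ℋ t ⊔ MeasurableSpace.comap (A t) inferInstance] {ω | A t ω = b} :=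
      le_sup_right (a := ℋ t) _ ⟨{b}, measurableSet_singleton b, rfl⟩
    have hS : MeasurableSet {ω | A t ω = b} :=
      h.le (t + 1) ht _ (h.measurableSet_arm (by simp; omega) ht)
    have hsplit : ∀ ω, ENNReal.ofReal (Real.exp (r * deviation A Z b ν (t + 1) ω -
        r ^ 2 / 8 * plays A b (t + 1) ω)) =
        {ω | A t ω = b}ᶜ.indicator G ω + {ω | A t ω = b}.indicator G ω * E ω := by
      intro ω
      rw [plays_succ A b ht1]
      unfold deviation
      rw [Finset.sum_Ico_succ_top ht1]
      by_cases hA : A t ω = b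
      · simp only [hA, if_true, Set.indicator_of_notMem (show ω ∉ {ω | A t ω = b}ᶜ by simpa using hA),
          Set.indicator_of_mem (show ω ∈ {ω | A t ω = b} from hA), zero_add, hG, hE]
        rw [← ENNReal.ofReal_mul (Real.exp_pos _).le, ← Real.exp_add]
        congr 2
        unfold deviation
        push_cast
        ring
      · simp only [hA, if_false, Set.indicator_of_mem (show ω ∈ {ω | A t ω = b}ᶜ by simpa using hA),
          Set.indicator_of_notMem (show ω ∉ {ω | A t ω = b} from hA), add_zero, zero_mul, hG]
        rfl
    simp only [hsplit]
    have hGm0 : Measurable G := hGm.mono (h.le t (by omega)) le_rfl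
    rw [lintegral_add_left (hGm0.indicator hS.compl)]
    have hle : ℋ t ⊔ MeasurableSpace.comap (A t) inferInstance ≤ mΩ := by
      refine sup_le (h.le t (by omega)) ?_
      exact ((h.arm t htT).mono (h.le _ ht) le_rfl).comap_le
    have hmul : ∫⁻ ω, {ω | A t ω = b}.indicator G ω * E ω ∂P =
        (∫⁻ ω, {ω | A t ω = b}.indicator G ω ∂P) * ∫⁻ ω, E ω ∂P := by
      refine lintegral_mul_eq_lintegral_mul_lintegral_of_independent_measurableSpace hle
        (h.meas t htT).comap_le (h.indep t htT).symm ?_ ?_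
      · exact Measurable.indicator (hGm.mono le_sup_left le_rfl) hS'
      · refine ENNReal.measurable_ofReal.comp (Real.measurable_exp.comp ?_)
        exact (((comap_measurable (Z t)).sub_const ν).const_mul r).sub_const _
    rw [hmul]
    calc _ ≤ (∫⁻ ω, {ω | A t ω = b}ᶜ.indicator G ω ∂P) +
          (∫⁻ ω, {ω | A t ω = b}.indicator G ω ∂P) * 1 := by gcongr
      _ = ∫⁻ ω, G ω ∂P := by
        rw [mul_one, lintegral_indicator hS.compl, lintegral_indicator hS, add_comm]
        exact lintegral_add_compl G hS
      _ ≤ 1 := ih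

/-- For a fixed number of plays this is Markov's inequality for the supermartingale. The number of
plays is random, so a union over at most `T` values and two signs is paid. -/
theorem FreshRewards.measure_deviation_le (h : FreshRewards ℋ A Z b P T ν) {l : ℝ} (hl : 0 ≤ l)
    {t : ℕ} (ht1 : 1 ≤ t) (ht : t ≤ T + 1) :
    P {ω | 1 ≤ plays A b t ω ∧ √(plays A b t ω * l / 2) < |deviation A Z b ν t ω|} ≤
      ENNReal.ofReal (2 * T * Real.exp (-l)) := by
  have key : ∀ N : ℕ, 1 ≤ N → ∀ σ : ℝ, σ ^ 2 = 1 →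
      P {ω | plays A b t ω = N ∧ √(N * l / 2) < σ * deviation A Z b ν t ω} ≤
        ENNReal.ofReal (Real.exp (-l)) := by
    intro N hN σ hσ
    have hN' : (0 : ℝ) < N := by exact_mod_cast hN
    set x := √(N * l / 2) with hx
    have hx2 : x ^ 2 = N * l / 2 := Real.sq_sqrt (by positivity)
    -- The optimal Chernoff parameter: the compensator equals `l` and the linear term is at least `2
    -- * l`, so the exponential is at least `exp l`. The sign `σ` selects the tail.
    set r : ℝ := σ * (4 * x / N) with hr
    have h1 := h.lintegral_exp_deviation_le r ht1 ht
    have h2 : {ω | plays A b t ω = N ∧ x < σ * deviation A Z b ν t ω} ⊆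
        {ω | ENNReal.ofReal (Real.exp l) ≤ ENNReal.ofReal
          (Real.exp (r * deviation A Z b ν t ω - r ^ 2 / 8 * plays A b t ω))} := by
      rintro ω ⟨hω1, hω2⟩
      apply ENNReal.ofReal_le_ofReal
      apply Real.exp_le_exp.2
      rw [hω1]
      have e1 : r ^ 2 / 8 * N = l := by
        rw [hr, mul_pow, hσ, div_pow, mul_pow, hx2]; field_simp; ring
      have e2 : r * deviation A Z b ν t ω = 4 * x / N * (σ * deviation A Z b ν t ω) := by
        rw [hr]; ring
      have e3 : 4 * x / N * x = 2 * l := by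
        rw [show 4 * x / N * x = 4 * x ^ 2 / N by ring, hx2]; field_simp; ring
      have e4 : 4 * x / N * x ≤ 4 * x / N * (σ * deviation A Z b ν t ω) :=
        mul_le_mul_of_nonneg_left hω2.le (by positivity)
      linarith
    have hm : Measurable (fun ω => ENNReal.ofReal
        (Real.exp (r * deviation A Z b ν t ω - r ^ 2 / 8 * plays A b t ω))) := by
      refine ENNReal.measurable_ofReal.comp (Real.measurable_exp.comp ?_)
      refine (((h.measurable_deviation ht).mono (h.le t ht) le_rfl).const_mul r).sub
        (Measurable.const_mul ?_ _)
      exact measurable_from_top.comp ((h.measurable_plays ht).mono (h.le t ht) le_rfl)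
    have h3 := (mul_meas_ge_le_lintegral hm (μ := P) (ENNReal.ofReal (Real.exp l))).trans h1
    have h4 := measure_mono (μ := P) h2
    rw [Real.exp_neg, ENNReal.ofReal_inv_of_pos (Real.exp_pos _)]
    refine h4.trans ?_
    rw [ENNReal.le_inv_iff_mul_le, mul_comm]
    exact h3
  have hsub : {ω | 1 ≤ plays A b t ω ∧ √(plays A b t ω * l / 2) < |deviation A Z b ν t ω|} ⊆
      ⋃ N ∈ Finset.Icc 1 T,
        ({ω | plays A b t ω = N ∧ √(N * l / 2) < 1 * deviation A Z b ν t ω} ∪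
         {ω | plays A b t ω = N ∧ √(N * l / 2) < -1 * deviation A Z b ν t ω}) := by
    rintro ω ⟨hω1, hω2⟩
    have := plays_le A b t ω
    refine Set.mem_biUnion (x := plays A b t ω) (by simp; omega) ?_
    rcases lt_abs.1 hω2 with h' | h'
    · exact Or.inl ⟨rfl, by simpa using h'⟩
    · exact Or.inr ⟨rfl, by simpa using h'⟩
  refine (measure_mono hsub).trans ((measure_biUnion_finset_le _ _).trans ?_)
  refine (Finset.sum_le_card_nsmul _ _ (ENNReal.ofReal (2 * Real.exp (-l))) fun N hN => ?_).trans ?_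
  · have hN := (Finset.mem_Icc.1 hN).1
    refine (measure_union_le _ _).trans ?_
    rw [two_mul, ENNReal.ofReal_add (Real.exp_pos _).le (Real.exp_pos _).le]
    exact add_le_add (key N hN 1 (by norm_num)) (key N hN (-1) (by norm_num))
  · rw [Nat.card_Icc, nsmul_eq_mul, show 2 * (T : ℝ) * Real.exp (-l) = T * (2 * Real.exp (-l)) by ring,
      ENNReal.ofReal_mul (p := (T : ℝ)) (by positivity)]
    simp

end Concentration

end Exploratory

/-! ### Measurability with respect to the history, and concentration of exploration -/

namespace Exploratory

section Histories

variable {Ω : Type*} {K : ℕ} {X R : ℕ → Fin K → Ω → ℝ} {A : ℕ → Ω → Fin K}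

theorem history_mono : Monotone (history X R A) := fun s t hst =>
  biSup_mono fun i hi => by simp only [Finset.mem_Ico] at hi ⊢; omega

theorem measurable_observation {s t : ℕ} (hs : s ∈ Finset.Ico 1 t) :
    Measurable[history X R A t] (fun ω => (A s ω, X s (A s ω) ω, R s (A s ω) ω)) :=
  (comap_measurable _).mono (le_biSup (fun s => MeasurableSpace.comap
    (fun ω => (A s ω, X s (A s ω) ω, R s (A s ω) ω)) inferInstance) hs) le_rfl

theorem measurable_arm_history {s t : ℕ} (hs : s ∈ Finset.Ico 1 t) :
    Measurable[history X R A t] (A s) :=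
  measurable_fst.comp (measurable_observation hs)

theorem measurable_principal_history {s t : ℕ} (hs : s ∈ Finset.Ico 1 t) :
    Measurable[history X R A t] (fun ω => X s (A s ω) ω) :=
  (measurable_fst.comp measurable_snd).comp (measurable_observation hs)

theorem measurable_agent_history {s t : ℕ} (hs : s ∈ Finset.Ico 1 t) :
    Measurable[history X R A t] (fun ω => R s (A s ω) ω) :=
  (measurable_snd.comp measurable_snd).comp (measurable_observation hs)

theorem measurable_plays_history (a : Fin K) (t : ℕ) :
    Measurable[history X R A t] (plays A a t) := by
  unfold plays
  simp only [Finset.card_filter]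
  exact Finset.measurable_fun_sum _ fun s hs =>
    Measurable.ite (measurable_arm_history hs (measurableSet_singleton a)) measurable_const
      measurable_const

/-- The history holds only the reward of the arm that was played; on the event in question that is
the reward of `a`. -/
theorem ite_arm_eq {F : ℕ → Fin K → Ω → ℝ} (s : ℕ) (a : Fin K) :
    (fun ω => if A s ω = a then F s a ω else 0) =
      fun ω => if A s ω = a then F s (A s ω) ω else 0 := by
  ext ω
  split_ifs with h
  · rw [h]
  · rfl

theorem measurable_agentMean_history (a : Fin K) (t : ℕ) :
    Measurable[history X R A t] (agentMean R A a t) := by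
  unfold agentMean
  refine Measurable.div (Finset.measurable_fun_sum _ fun s hs => ?_) ?_
  · rw [ite_arm_eq]
    exact Measurable.ite (measurable_arm_history hs (measurableSet_singleton a))
      (measurable_agent_history hs) measurable_const
  · exact (measurable_from_top (f := fun n : ℕ => ((max 1 n : ℕ) : ℝ))).comp
      (measurable_plays_history a t)

theorem measurable_incentive_history (T : ℕ) (c₀ δ : ℝ) (t : ℕ) :
    Measurable[history X R A t] (incentive X A (algorithm K T c₀ δ) t) :=
  measurable_incentive (mΩ := history X R A t) T c₀ δ (fun _ hs => measurable_arm_history hs)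
    (fun _ hs => measurable_principal_history hs)

theorem measurableSet_explores_history (T : ℕ) (c₀ δ : ℝ) {t : ℕ} (ht : 1 ≤ t) :
    MeasurableSet[history X R A (t + 1)] (explores X R A (algorithm K T c₀ δ) t) := by
  set alg := algorithm K T c₀ δ
  have hmono : history X R A t ≤ history X R A (t + 1) := history_mono (Nat.le_succ t)
  have hsum : ∀ b, Measurable[history X R A (t + 1)]
      (fun ω => agentMean R A b t ω + incentive X A alg t ω b) := fun b =>
    ((measurable_agentMean_history b t).add
      ((measurable_pi_apply b).comp (measurable_incentive_history T c₀ δ t))).mono hmono le_rfl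
  have : explores X R A alg t = ⋃ i : Fin K, ⋃ b : Fin K, {ω | A t ω = i} ∩
      {ω | agentMean R A i t ω + incentive X A alg t ω i <
        agentMean R A b t ω + incentive X A alg t ω b} := by
    ext ω
    simp [explores]
  rw [this]
  refine MeasurableSet.iUnion fun i => MeasurableSet.iUnion fun b => MeasurableSet.inter ?_ ?_
  · exact measurable_arm_history (by simp; omega) (measurableSet_singleton i)
  · exact measurableSet_lt (hsum i) (hsum b)

end Histories

/-! ### Rewards and exploration in the game. -/

namespace IsExploratoryGame

variable {Ω : Type*} {mΩ : MeasurableSpace Ω} {P : Measure Ω} {K : ℕ} {X R : ℕ → Fin K → Ω → ℝ}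
  {A : ℕ → Ω → Fin K} {T : ℕ} {c₀ δ : ℝ} {D : Arms K} {alg : Protocol K (Unit × Tally K)}

theorem measurable_selected {F : ℕ → Fin K → Ω → ℝ}
    (hF : ∀ t ∈ Finset.Icc 1 T, ∀ a, Measurable (F t a))
    (hA : ∀ t ∈ Finset.Icc 1 T, Measurable (A t)) {t : ℕ} (ht : t ∈ Finset.Icc 1 T) :
    Measurable (fun ω => F t (A t ω) ω) :=
  (measurable_from_prod_countable_right (f := fun q : Fin K × Ω => F t q.1 q.2) (hF t ht)).comp
    ((hA t ht).prodMk measurable_id)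

theorem history_le (h : IsExploratoryGame X R A alg P T c₀ D) {t : ℕ} (ht : t ≤ T + 1) :
    history X R A t ≤ mΩ := by
  refine iSup₂_le fun s hs => ?_
  have hs' : s ∈ Finset.Icc 1 T := by simp at hs ⊢; omega
  exact ((h.measurable_A s hs').prodMk ((measurable_selected h.measurable_X h.measurable_A hs').prodMk
    (measurable_selected h.measurable_R h.measurable_A hs'))).comap_le

theorem freshRewards_agent (h : IsExploratoryGame X R A alg P T c₀ D) (b : Fin K) :
    FreshRewards (history X R A) A (fun t => R t b) b P T (D.μ b) where
  le _ ht := h.history_le ht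
  mono := history_mono
  arm s hs := measurable_arm_history (by simp at hs ⊢; omega)
  reward s hs := by
    rw [ite_arm_eq (F := R)]
    have : s ∈ Finset.Ico 1 (s + 1) := by simp at hs ⊢; omega
    exact Measurable.ite (measurable_arm_history this (measurableSet_singleton b))
      (measurable_agent_history this) measurable_const
  meas s hs := h.measurable_R s hs b
  indep s hs := h.indep_R s hs b
  mem_Icc s hs := by
    have := D.agent_supp b
    rw [← h.law_R s hs b] at this
    exact ae_of_ae_map (h.measurable_R s hs b).aemeasurable this
  mean s hs := by
    rw [Arms.μ, ← h.law_R s hs b]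
    exact (integral_map (h.measurable_R s hs b).aemeasurable (f := fun x => x)
      aestronglyMeasurable_id).symm

theorem freshRewards_principal (h : IsExploratoryGame X R A alg P T c₀ D) (b : Fin K) :
    FreshRewards (history X R A) A (fun t => X t b) b P T (D.θ b) where
  le _ ht := h.history_le ht
  mono := history_mono
  arm s hs := measurable_arm_history (by simp at hs ⊢; omega)
  reward s hs := by
    rw [ite_arm_eq (F := X)]
    have : s ∈ Finset.Ico 1 (s + 1) := by simp at hs ⊢; omega
    exact Measurable.ite (measurable_arm_history this (measurableSet_singleton b))
      (measurable_principal_history this) measurable_const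
  meas s hs := h.measurable_X s hs b
  indep s hs := h.indep_X s hs b
  mem_Icc s hs := by
    have := D.principal_supp b
    rw [← h.law_X s hs b] at this
    exact ae_of_ae_map (h.measurable_X s hs b).aemeasurable this
  mean s hs := by
    rw [Arms.θ, ← h.law_X s hs b]
    exact (integral_map (h.measurable_X s hs b).aemeasurable (f := fun x => x)
      aestronglyMeasurable_id).symm

open Classical in
/-- The number of exploration rounds in `J`. -/
noncomputable def exploreCount (X R : ℕ → Fin K → Ω → ℝ) (A : ℕ → Ω → Fin K)
    (alg : Protocol K (Unit × Tally K)) (J : Finset ℕ) (ω : Ω) : ℕ :=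
  (J.filter (fun s => ω ∈ explores X R A alg s)).card

theorem exploreCount_le_card (J : Finset ℕ) (ω : Ω) : exploreCount X R A alg J ω ≤ J.card := by
  classical exact Finset.card_filter_le _ _

theorem exploreCount_eq_sum (J : Finset ℕ) (ω : Ω) :
    (exploreCount X R A alg J ω : ℝ) =
      ∑ s ∈ J, (explores X R A alg s).indicator (fun _ => (1 : ℝ)) ω := by
  classical
  unfold exploreCount
  rw [Finset.card_filter]
  push_cast
  refine Finset.sum_congr rfl fun s _ => ?_
  by_cases hs : ω ∈ explores X R A alg s <;> simp [hs]

variable [IsProbabilityMeasure P]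

/-- Given the history, one more round multiplies the moment generating function by at most `1 + (exp
r - 1) q ≤ exp ((exp r - 1) q)`. Independence between rounds is not needed. -/
theorem integral_exp_exploreCount_le
    (h : IsExploratoryGame X R A (algorithm K T c₀ δ) P T c₀ D) {J : Finset ℕ}
    -- The `max 1` excludes round `0` without a proof that the set defining `explorationTime` is
    -- nonempty, as `sInf ∅ = 0`.
    (hJ : J ⊆ Finset.Icc (max 1 (explorationTime c₀)) T) {q : ℕ → ℝ}
    (hq : ∀ s ∈ J, c₀ * √(Real.log (2 * s) / s) ≤ q s) {r : ℝ} (hr : 0 ≤ r) {t : ℕ}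
    (ht : t ≤ T + 1) :
    ∫ ω, Real.exp (r * exploreCount X R A (algorithm K T c₀ δ) (J.filter (· < t)) ω) ∂P ≤
      Real.exp ((Real.exp r - 1) * ∑ s ∈ J.filter (· < t), q s) := by
  set alg := algorithm K T c₀ δ
  have hmeas : ∀ t ≤ T + 1, Measurable[history X R A t]
      (fun ω => Real.exp (r * exploreCount X R A alg (J.filter (· < t)) ω)) := by
    intro t ht
    simp only [exploreCount_eq_sum]
    refine Real.measurable_exp.comp (Measurable.const_mul ?_ r)
    refine Finset.measurable_fun_sum _ fun s hs => ?_
    rw [Finset.mem_filter] at hs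
    have hs1 := Finset.mem_Icc.1 (hJ hs.1)
    refine Measurable.indicator measurable_const ?_
    exact history_mono (by omega : s + 1 ≤ t) _
      (measurableSet_explores_history T c₀ δ ((le_max_left _ _).trans hs1.1))
  induction t with
  | zero => simp [exploreCount]
  | succ t ih =>
    have ih := ih (by omega)
    by_cases htJ : t ∈ J
    · have ht1 := Finset.mem_Icc.1 (hJ htJ)
      have hins : J.filter (· < t + 1) = insert t (J.filter (· < t)) := by
        ext s
        simp only [Finset.mem_filter, Finset.mem_insert]
        constructor
        · rintro ⟨h1, h2⟩
          rcases Nat.lt_succ_iff_lt_or_eq.1 h2 with h3 | h3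
          · exact Or.inr ⟨h1, h3⟩
          · exact Or.inl h3
        · rintro (rfl | ⟨h1, h2⟩)
          · exact ⟨htJ, by omega⟩
          · exact ⟨h1, by omega⟩
      have hnot : t ∉ J.filter (· < t) := by simp
      set F : Ω → ℝ := fun ω => Real.exp (r * exploreCount X R A alg (J.filter (· < t)) ω) with hF
      set G : Ω → ℝ := (explores X R A alg t).indicator (fun _ => (1 : ℝ)) with hG
      have hFm : Measurable[history X R A t] F := hmeas t (by omega)
      have hle := h.history_le (t := t) (by omega)
      have hFm0 : Measurable F := hFm.mono hle le_rfl
      have hEx : MeasurableSet (explores X R A alg t) :=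
        h.history_le (t := t + 1) (by omega) _ (measurableSet_explores_history T c₀ δ (by omega))
      have hGi : Integrable G P := (integrable_const (1 : ℝ)).indicator hEx
      have hFb : ∀ ω, ‖F ω‖ ≤ Real.exp (r * J.card) := fun ω => by
        rw [Real.norm_eq_abs, abs_of_pos (Real.exp_pos _)]
        apply Real.exp_le_exp.2
        refine mul_le_mul_of_nonneg_left ?_ hr
        exact Nat.cast_le.2 ((exploreCount_le_card (J.filter (· < t)) ω).trans (Finset.card_filter_le _ _))
      have hFi : Integrable F P :=
        Integrable.of_bound hFm0.aestronglyMeasurable _ (Filter.Eventually.of_forall hFb)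
      have hFGi : Integrable (F * G) P := by
        refine hFi.mul_bdd (c := 1) hGi.aestronglyMeasurable (Filter.Eventually.of_forall fun ω => ?_)
        by_cases hω : ω ∈ explores X R A alg t <;> simp [hG, hω]
      have hstep : ∀ ω, Real.exp (r * exploreCount X R A alg (J.filter (· < t + 1)) ω) =
          F ω + (Real.exp r - 1) * (F * G) ω := by
        intro ω
        rw [hins, exploreCount_eq_sum, Finset.sum_insert hnot, ← exploreCount_eq_sum, mul_add,
          Real.exp_add]
        by_cases hω : ω ∈ explores X R A alg t
        · simp [hF, hG, hω]; ring
        · simp [hF, hG, hω]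
      -- The earlier count is known from the history, so it leaves the conditional expectation, and
      -- what remains is the conditional exploration probability.
      have hcond : ∫ ω, (F * G) ω ∂P ≤ q t * ∫ ω, F ω ∂P := by
        have h1 := condExp_stronglyMeasurable_mul_of_bound hle hFm.stronglyMeasurable hGi _
          (Filter.Eventually.of_forall hFb)
        have h2 := h.explore_le t (Finset.mem_Icc.2 ⟨(le_max_right _ _).trans ht1.1, ht1.2⟩)
        rw [← integral_condExp hle, ← integral_const_mul]
        refine integral_mono_ae integrable_condExp (hFi.const_mul _) ?_
        filter_upwards [h1, h2] with ω hω1 hω2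
        rw [hω1, Pi.mul_apply, mul_comm]
        exact mul_le_mul_of_nonneg_right (hω2.trans (hq t htJ)) (Real.exp_pos _).le
      simp only [hstep]
      rw [integral_add hFi (hFGi.const_mul _), integral_const_mul, hins, Finset.sum_insert hnot]
      have hr' : 0 ≤ Real.exp r - 1 := by linarith [Real.add_one_le_exp r]
      have hF0 : 0 ≤ ∫ ω, F ω ∂P := integral_nonneg fun ω => (Real.exp_pos _).le
      calc _ ≤ (∫ ω, F ω ∂P) + (Real.exp r - 1) * (q t * ∫ ω, F ω ∂P) := by gcongr
        _ = ((Real.exp r - 1) * q t + 1) * ∫ ω, F ω ∂P := by ring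
        _ ≤ Real.exp ((Real.exp r - 1) * q t) * ∫ ω, F ω ∂P :=
          mul_le_mul_of_nonneg_right (Real.add_one_le_exp _) hF0
        _ ≤ Real.exp ((Real.exp r - 1) * q t) *
            Real.exp ((Real.exp r - 1) * ∑ s ∈ J.filter (· < t), q s) := by gcongr
        _ = _ := by rw [← Real.exp_add]; ring_nf
    · have : J.filter (· < t + 1) = J.filter (· < t) := by
        ext s
        simp only [Finset.mem_filter]
        constructor
        · rintro ⟨h1, h2⟩
          exact ⟨h1, lt_of_le_of_ne (by omega) fun h3 => htJ (h3 ▸ h1)⟩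
        · rintro ⟨h1, h2⟩
          exact ⟨h1, by omega⟩
      rw [this]
      exact ih

/-- A Chernoff bound for the number of exploration rounds. -/
theorem measure_exploreCount_ge_le
    (h : IsExploratoryGame X R A (algorithm K T c₀ δ) P T c₀ D) {J : Finset ℕ}
    (hJ : J ⊆ Finset.Icc (max 1 (explorationTime c₀)) T) {q : ℕ → ℝ}
    (hq : ∀ s ∈ J, c₀ * √(Real.log (2 * s) / s) ≤ q s) {r : ℝ} (hr : 0 ≤ r) {k m : ℝ}
    (hm : ∑ s ∈ J, q s ≤ m) :
    P {ω | k ≤ exploreCount X R A (algorithm K T c₀ δ) J ω} ≤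
      ENNReal.ofReal (Real.exp ((Real.exp r - 1) * m - r * k)) := by
  have hJT : J.filter (· < T + 1) = J := by
    refine Finset.filter_true_of_mem fun s hs => ?_
    have := Finset.mem_Icc.1 (hJ hs)
    omega
  have h1 := h.integral_exp_exploreCount_le hJ hq hr le_rfl
  rw [hJT] at h1
  have hmeas : Measurable
      (fun ω => Real.exp (r * exploreCount X R A (algorithm K T c₀ δ) J ω)) := by
    simp only [exploreCount_eq_sum]
    refine Real.measurable_exp.comp (Measurable.const_mul ?_ r)
    refine Finset.measurable_fun_sum _ fun s hs => ?_
    have hs1 := Finset.mem_Icc.1 (hJ hs)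
    refine Measurable.indicator measurable_const ?_
    exact h.history_le (t := s + 1) (by omega) _
      (measurableSet_explores_history T c₀ δ ((le_max_left _ _).trans hs1.1))
  have hint : Integrable
      (fun ω => Real.exp (r * exploreCount X R A (algorithm K T c₀ δ) J ω)) P := by
    refine Integrable.of_bound hmeas.aestronglyMeasurable (Real.exp (r * J.card))
      (Filter.Eventually.of_forall fun ω => ?_)
    rw [Real.norm_eq_abs, abs_of_pos (Real.exp_pos _)]
    apply Real.exp_le_exp.2
    refine mul_le_mul_of_nonneg_left ?_ hr
    exact Nat.cast_le.2 (exploreCount_le_card J ω)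
  have hr' : 0 ≤ Real.exp r - 1 := by linarith [Real.add_one_le_exp r]
  have h2 := mul_meas_ge_le_integral_of_nonneg (μ := P)
    (Filter.Eventually.of_forall fun ω => (Real.exp_pos _).le) hint (Real.exp (r * k))
  have hsub : {ω | k ≤ exploreCount X R A (algorithm K T c₀ δ) J ω} ⊆
      {ω | Real.exp (r * k) ≤ Real.exp (r * exploreCount X R A (algorithm K T c₀ δ) J ω)} :=
    fun ω hω => Real.exp_le_exp.2 (mul_le_mul_of_nonneg_left hω hr)
  refine (measure_mono hsub).trans ?_
  rw [← ofReal_measureReal]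
  apply ENNReal.ofReal_le_ofReal
  rw [Real.exp_sub, le_div_iff₀ (Real.exp_pos _), mul_comm]
  refine h2.trans (h1.trans (Real.exp_le_exp.2 ?_))
  exact mul_le_mul_of_nonneg_left hm hr'

end IsExploratoryGame

end Exploratory

/-! ### The search along a path -/

namespace Exploratory

open Principal

section Path

variable {K : ℕ} {T : ℕ} {θ μ : Fin K → ℝ} {V M : ℝ} {obs : ℕ → Fin K × ℝ} {π : ℕ → Fin K → ℝ}
  {μh : Fin K → ℕ → ℝ} {Ex : ℕ → Prop}

/-- In the rounds `k < T` without exploration the played arm maximizes `μh + π`. -/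
def PlaysBest (T : ℕ) (obs : ℕ → Fin K × ℝ) (π : ℕ → Fin K → ℝ) (μh : Fin K → ℕ → ℝ)
    (Ex : ℕ → Prop) : Prop :=
  ∀ k < T, ¬ Ex k → ∀ b, μh b k + π k b ≤ μh (obs k).1 k + π k (obs k).1

/-- From step `t` on, the means `μh` are within `ε` of `μ`. -/
def AccurateFrom (T : ℕ) (μ : Fin K → ℝ) (μh : Fin K → ℕ → ℝ) (ε : ℝ) (t : ℕ) : Prop :=
  ∀ k, t ≤ k → k < T → ∀ b, |μh b k - μ b| ≤ ε

/-- Together with `le_need_of_not_plays`: without exploration, the response to the incentive `y` on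
`a` tells on which side of `M - μ a` it lies. Two empirical means are compared, each with error `ε`.
-/
theorem need_le_of_plays {ε : ℝ} {k : ℕ} (hbest : PlaysBest T obs π μh Ex) (hk : k < T)
    (hEx : ¬ Ex k) (hacc : ∀ b, |μh b k - μ b| ≤ ε) {z : Fin K} (hz : μ z = M) {a : Fin K} {y : ℝ}
    (hy : 0 ≤ y) (hπ : π k = oneHot a y) (ha : (obs k).1 = a) : M - μ a - 2 * ε ≤ y := by
  have h1 := hbest k hk hEx z
  have h2 := abs_le.1 (hacc z)
  have h3 := abs_le.1 (hacc a)
  rw [hπ, ha] at h1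
  simp only [oneHot, if_true] at h1
  split_ifs at h1 with h4
  · subst h4; linarith [h2.1, h2.2]
  · linarith [h2.1, h3.2]

theorem le_need_of_not_plays {ε : ℝ} {k : ℕ} (hbest : PlaysBest T obs π μh Ex) (hk : k < T)
    (hEx : ¬ Ex k) (hacc : ∀ b, |μh b k - μ b| ≤ ε) (hM : ∀ b, μ b ≤ M) {a : Fin K} {y : ℝ}
    (hπ : π k = oneHot a y) (ha : (obs k).1 ≠ a) : y ≤ M - μ a + 2 * ε := by
  have h1 := hbest k hk hEx a
  have h2 := abs_le.1 (hacc (obs k).1)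
  have h3 := abs_le.1 (hacc a)
  rw [hπ] at h1
  simp only [oneHot, if_true, if_neg ha] at h1
  linarith [h2.2, h3.1, hM (obs k).1]

/-- All incentives in the steps `t ≤ k < t'` are one-hot with values in `[0, c]`. -/
def OneHotDuring (π : ℕ → Fin K → ℝ) (c : ℝ) (t t' : ℕ) : Prop :=
  ∀ k, t ≤ k → k < t' → ∃ a, ∃ y, 0 ≤ y ∧ y ≤ c ∧ π k = oneHot a y

theorem OneHotDuring.cons {c : ℝ} {t t' : ℕ} (h : OneHotDuring π c (t + 1) t') {a : Fin K} {y : ℝ}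
    (hy : 0 ≤ y) (hyc : y ≤ c) (hπ : π t = oneHot a y) : OneHotDuring π c t t' := by
  intro k hk hkt
  rcases hk.eq_or_lt with rfl | hk
  · exact ⟨a, y, hy, hyc, hπ⟩
  · exact h k hk hkt

theorem OneHotDuring.single {c : ℝ} {t : ℕ} {a : Fin K} {y : ℝ}
    (hy : 0 ≤ y) (hyc : y ≤ c) (hπ : π t = oneHot a y) : OneHotDuring π c t (t + 1) :=
  OneHotDuring.cons (fun k hk hkt => by omega) hy hyc hπ

theorem OneHotDuring.trans {c : ℝ} {t t' t'' : ℕ} (h : OneHotDuring π c t t')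
    (h' : OneHotDuring π c t' t'') : OneHotDuring π c t t'' := by
  intro k hk hkt
  rcases lt_or_ge k t' with hk' | hk'
  · exact h k hk hk'
  · exact h' k hk' hkt

theorem half_pow_le {T C : ℕ} (hT : 1 ≤ T) (hC : ⌈Real.logb 2 T⌉₊ ≤ C) :
    (1 / 2 : ℝ) ^ C ≤ 1 / T := by
  have hT' : (0 : ℝ) < T := by exact_mod_cast hT
  have h1 : Real.logb 2 T ≤ C := (Nat.le_ceil _).trans (by exact_mod_cast hC)
  have h2 : (T : ℝ) ≤ 2 ^ C := by
    rw [Real.logb_le_iff_le_rpow (by norm_num) hT'] at h1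
    simpa using h1
  rw [one_div_pow]
  exact one_div_le_one_div_of_le hT' h2

/-- Bisection with the bracket `[lo, hi]` around `M - μ a`, valid up to `2 * ε` and of width `2 ^
(-C1)`; the last enticing incentive is its right end. The bound on `t'` is the termination measure
of the loop plus one. The error terms `3 / T` and `e` cover what the different exits add. -/
theorem Wp_searchLoop (hT : 1 ≤ T) (hbest : PlaysBest T obs π μh Ex) (hM : ∀ b, μ b ≤ M)
    {z : Fin K} (hz : μ z = M) {ε e : ℝ} {t₀ : ℕ} (a : Fin K)
    (check : Bool) (up lo hi : ℝ) (C1 C2 t : ℕ) (ht : t₀ ≤ t) (hup : up = hi) (hlo : 0 ≤ lo)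
    (hlohi : lo ≤ hi) (hhi : hi ≤ 1) (hwidth : hi - lo = (1 / 2) ^ C1)
    -- Each check follows a refused proposal of its own. Hence `C2` reaches its limit only when `C1`
    -- has reached it too and the bracket has width at most `1 / T`.
    (hC : C2 + (if check = false then 0 else 1) ≤ C1) :
    Wp obs π (searchLoop T a check up lo hi C1 C2) t (fun b t' =>
      t < t' ∧ t' ≤ t + 2 * (⌈Real.logb 2 T⌉₊ - C2) + (⌈Real.logb 2 T⌉₊ - C1) +
        (if check = false then 1 else 0) + 1 ∧ 0 ≤ b ∧ OneHotDuring π 1 t t' ∧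
      (t' ≤ T → (∀ k, t ≤ k → k < t' → ¬ Ex k) → AccurateFrom T μ μh ε t₀ →
        (∀ k, t₀ ≤ k → k < T → 1 / ((max 1 ((Tally.ofPath obs k).count a) : ℕ) : ℝ) +
          2 / ((max 1 (⨅ i, (Tally.ofPath obs k).count i) : ℕ) : ℝ) ≤ e) →
        0 ≤ ε → lo ≤ M - μ a + 2 * ε → M - μ a - 2 * ε ≤ hi →
        M - μ a - 2 * ε ≤ b ∧ b ≤ M - μ a + 2 * ε + 3 / T + e)) := by
  have hTinv : (0 : ℝ) < 1 / T := by have : (0 : ℝ) < T := by exact_mod_cast hT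
                                     positivity
  have e2 : (2 : ℝ) / T = 2 * (1 / T) := by ring
  have e3 : (3 : ℝ) / T = 3 * (1 / T) := by ring
  rw [e3]
  have hepos : ∀ k, 0 ≤ 1 / ((max 1 ((Tally.ofPath obs k).count a) : ℕ) : ℝ) +
          2 / ((max 1 (⨅ i, (Tally.ofPath obs k).count i) : ℕ) : ℝ) := fun k => by positivity
  induction check, up, lo, hi, C1, C2 using searchLoop.induct T generalizing t with
  | case1 check up lo hi C1 C2 ih1 ih2 ih3 =>
  rw [searchLoop]
  refine Wp_bind (Wp_get ?_)
  subst hup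
  by_cases hc : check = false
  · rw [if_pos hc]
    simp only [if_pos hc, add_zero] at hC ⊢
    set mid : ℝ := (up + lo) / 2 with hmid1
    have hmid0 : 0 ≤ mid := by rw [hmid1]; linarith
    have hmidw1 : mid - lo = (1 / 2) ^ (C1 + 1) := by rw [pow_succ, ← hwidth, hmid1]; ring
    have hmidw2 : up - mid = (1 / 2) ^ (C1 + 1) := by rw [pow_succ, ← hwidth, hmid1]; ring
    have hpw : (0 : ℝ) < (1 / 2) ^ (C1 + 1) := by positivity
    refine Wp_bind (Wp_propose fun hπ => ?_)
    by_cases hi : (obs t).1 = a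
    · rw [if_pos hi]
      split
      · next hn =>
        refine Wp_pure ⟨by omega, by omega, by linarith, .single hmid0 (by linarith) hπ, ?_⟩
        intro htT hEx hacc hst hε hlo' hhi'
        have h1 := need_le_of_plays hbest htT (hEx t le_rfl (by omega)) (hacc t ht (by omega)) hz
          hmid0 hπ hi
        have h2 := half_pow_le hT hn
        have h3 := hst t ht (by omega)
        exact ⟨by linarith, by linarith [hepos t]⟩
      · next hn =>
        refine (ih1 hc hn (t + 1) (by omega) rfl hlo (by linarith) (by linarith) hmidw1
          (by simp; omega)).mono ?_
        rintro b t' - ⟨h1, h2, h3, h4, h5⟩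
        simp only [if_true] at h2
        refine ⟨by omega, by omega, h3, h4.cons hmid0 (by linarith) hπ, ?_⟩
        intro htT hEx hacc hst hε hlo' hhi'
        exact h5 htT (fun k hk => hEx k (by omega)) hacc hst hε hlo'
          (need_le_of_plays hbest (by omega) (hEx t le_rfl (by omega)) (hacc t ht (by omega)) hz
          hmid0 hπ hi)
    · rw [if_neg hi]
      refine (ih2 hc (t + 1) (by omega) rfl hmid0 (by linarith) hhi hmidw2 (by simp; omega)).mono ?_
      rintro b t' - ⟨h1, h2, h3, h4, h5⟩
      simp only [Bool.true_eq_false, if_false] at h2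
      refine ⟨by omega, by omega, h3, h4.cons hmid0 (by linarith) hπ, ?_⟩
      intro htT hEx hacc hst hε hlo' hhi'
      exact h5 htT (fun k hk => hEx k (by omega)) hacc hst hε
        (le_need_of_not_plays hbest (by omega) (hEx t le_rfl (by omega)) (hacc t ht (by omega)) hM
          hπ hi) hhi'
  · rw [if_neg hc]
    simp only [if_neg hc, add_zero] at hC ⊢
    have hup0 : 0 ≤ up := by linarith
    refine Wp_bind (Wp_propose fun hπ => ?_)
    by_cases hi : (obs t).1 = a
    · rw [if_pos hi]
      split
      · next hn =>
        refine Wp_pure ⟨by omega, by omega, by linarith, .single hup0 (by linarith) hπ, ?_⟩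
        intro htT hEx hacc hst hε hlo' hhi'
        have h2 : (1 / 2 : ℝ) ^ C1 ≤ 1 / T := half_pow_le hT (by omega)
        have h3 := hst t ht (by omega)
        exact ⟨by linarith, by linarith [hepos t]⟩
      · next hn =>
        refine (ih3 hc hn (t + 1) (by omega) rfl hlo hlohi hhi hwidth (by simp; omega)).mono ?_
        rintro b t' - ⟨h1, h2, h3, h4, h5⟩
        simp only [if_true] at h2
        refine ⟨by omega, by omega, h3, h4.cons hup0 hhi hπ, ?_⟩
        intro htT hEx hacc hst hε hlo' hhi'
        exact h5 htT (fun k hk => hEx k (by omega)) hacc hst hε hlo' hhi'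
    -- A refused check locates `up` from both sides: it is the right end of the bracket, and its
    -- refusal bounds it by `M - μ a + 2 * ε`.
    · rw [if_neg hi]
      refine Wp_pure ⟨by omega, by omega, ?_, .single hup0 (by linarith) hπ, ?_⟩
      · have := hepos t
        linarith
      · intro htT hEx hacc hst hε hlo' hhi'
        have h1 := le_need_of_not_plays hbest (by omega) (hEx t le_rfl (by omega))
          (hacc t ht (by omega)) hM hπ hi
        have h3 := hst t ht (by omega)
        exact ⟨by linarith [hepos t], by linarith [hepos t]⟩

end Path

end Exploratory

/-! ### Costs and exploration counts along a path; repeated searches -/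

namespace Exploratory

open Principal

section Path

variable {K : ℕ} {T : ℕ} {θ μ : Fin K → ℝ} {V M : ℝ} {obs : ℕ → Fin K × ℝ} {π : ℕ → Fin K → ℝ}
  {μh : Fin K → ℕ → ℝ} {Ex : ℕ → Prop}

open Classical in
/-- The number of exploration steps in `[t, t')` before the horizon. -/
noncomputable def exCount (T : ℕ) (Ex : ℕ → Prop) (t t' : ℕ) : ℕ :=
  ((Finset.Ico t t').filter (fun k => k < T ∧ Ex k)).card

theorem exCount_add {t t' t'' : ℕ} (h : t ≤ t') (h' : t' ≤ t'') :
    exCount T Ex t t' + exCount T Ex t' t'' = exCount T Ex t t'' := by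
  classical
  unfold exCount
  simp only [Finset.card_filter]
  exact Finset.sum_Ico_consecutive _ h h'

theorem exCount_mono {t t' t'' : ℕ} (h : t' ≤ t'') : exCount T Ex t t' ≤ exCount T Ex t t'' := by
  classical
  exact Finset.card_le_card (Finset.filter_subset_filter _ (Finset.Ico_subset_Ico_right h))

theorem one_le_exCount {t t' k : ℕ} (h1 : t ≤ k) (h2 : k < t') (h3 : k < T) (hk : Ex k) :
    1 ≤ exCount T Ex t t' := by
  classical
  exact Finset.card_pos.2 ⟨k, by simp [h1, h2, h3, hk]⟩

/-- The number of steps in `[t, t')` in which another arm than `a` is played. -/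
def misses (obs : ℕ → Fin K × ℝ) (a : Fin K) (t t' : ℕ) : ℕ :=
  ((Finset.Ico t t').filter (fun k => (obs k).1 ≠ a)).card

theorem misses_cons {a : Fin K} {t t' : ℕ} (h : t < t') :
    misses obs a t t' = (if (obs t).1 = a then 0 else 1) + misses obs a (t + 1) t' := by
  unfold misses
  simp only [Finset.card_filter]
  rw [Finset.sum_eq_sum_Ico_succ_bot h]
  congr 1
  by_cases ha : (obs t).1 = a <;> simp [ha]

theorem count_add_misses {a : Fin K} {t t' : ℕ} (h : t ≤ t') :
    (Tally.ofPath obs t').count a + misses obs a t t' =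
      (Tally.ofPath obs t).count a + (t' - t) := by
  induction t', h using Nat.le_induction with
  | base => simp [misses]
  | succ n hn ih =>
    have h1 : misses obs a t (n + 1) = misses obs a t n + if (obs n).1 = a then 0 else 1 := by
      unfold misses
      simp only [Finset.card_filter]
      rw [Finset.sum_Ico_succ_top hn]
      congr 1
      by_cases ha : (obs n).1 = a <;> simp [ha]
    rw [h1, Tally.ofPath_count_succ]
    split_ifs <;> omega

theorem misses_le_exCount {a : Fin K} {t t' : ℕ} (ht : t' ≤ T)
    (h : ∀ k, t ≤ k → k < t' → ¬ Ex k → (obs k).1 = a) :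
    misses obs a t t' ≤ exCount T Ex t t' := by
  classical
  refine Finset.card_le_card fun k hk => ?_
  simp only [Finset.mem_filter, Finset.mem_Ico] at hk ⊢
  refine ⟨hk.1, by omega, ?_⟩
  by_contra hEx
  exact hk.2 (h k hk.1.1 hk.1.2 hEx)

/-- The positive part of the regret of step `k`, where `B` is the benchmark. -/
noncomputable def roundCost (T : ℕ) (θ : Fin K → ℝ) (B : ℝ) (obs : ℕ → Fin K × ℝ)
    (π : ℕ → Fin K → ℝ) (k : ℕ) : ℝ :=
  if k < T then max 0 (B - (θ (obs k).1 - ∑ a, π k a)) else 0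

/-- The sum of the costs of the steps in `[t, t')`. -/
noncomputable def cost (T : ℕ) (θ : Fin K → ℝ) (B : ℝ) (obs : ℕ → Fin K × ℝ)
    (π : ℕ → Fin K → ℝ) (t t' : ℕ) : ℝ :=
  ∑ k ∈ Finset.Ico t t', roundCost T θ B obs π k

variable {B : ℝ}

theorem roundCost_nonneg (k : ℕ) : 0 ≤ roundCost T θ B obs π k := by
  unfold roundCost
  split_ifs
  · exact le_max_left _ _
  · exact le_rfl

theorem cost_add {t t' t'' : ℕ} (h : t ≤ t') (h' : t' ≤ t'') :
    cost T θ B obs π t t' + cost T θ B obs π t' t'' = cost T θ B obs π t t'' :=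
  Finset.sum_Ico_consecutive _ h h'

theorem cost_eq_zero {t : ℕ} (h : T ≤ t) (t' : ℕ) : cost T θ B obs π t t' = 0 := by
  refine Finset.sum_eq_zero fun k hk => ?_
  rw [roundCost, if_neg (by have := (Finset.mem_Ico.1 hk).1; omega)]

theorem cost_le_mul {c : ℝ} {t t' : ℕ} (h : t ≤ t')
    (hc : ∀ k, t ≤ k → k < t' → roundCost T θ B obs π k ≤ c) :
    cost T θ B obs π t t' ≤ c * ((t' : ℝ) - t) := by
  refine (Finset.sum_le_card_nsmul _ _ c fun k hk => ?_).trans ?_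
  · have := Finset.mem_Ico.1 hk
    exact hc k this.1 this.2
  · rw [Nat.card_Ico, nsmul_eq_mul, Nat.cast_sub h, mul_comm]

theorem sum_oneHot (a : Fin K) (y : ℝ) : ∑ i, oneHot a y i = y := by
  simp [oneHot]

theorem roundCost_le_of_oneHot (hB : B ≤ 1) (hθ : ∀ a, 0 ≤ θ a) {k : ℕ} {a : Fin K} {y : ℝ}
    (hy : 0 ≤ y) (hπ : π k = oneHot a y) : roundCost T θ B obs π k ≤ 1 + y := by
  unfold roundCost
  split_ifs
  · rw [hπ, sum_oneHot]
    exact max_le (by linarith) (by linarith [hθ (obs k).1])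
  · linarith

theorem cost_le_of_oneHotDuring (hB : B ≤ 1) (hθ : ∀ a, 0 ≤ θ a) {c : ℝ} {t t' : ℕ} (h : t ≤ t')
    (hπ : OneHotDuring π c t t') : cost T θ B obs π t t' ≤ (1 + c) * ((t' : ℝ) - t) := by
  refine cost_le_mul h fun k hk hkt => ?_
  obtain ⟨a, y, hy, hyc, hk'⟩ := hπ k hk hkt
  exact (roundCost_le_of_oneHot hB hθ hy hk').trans (by linarith)

/-- From step `t` on, the incentive `x` on arm `a` makes the agent play `a`, unless she explores. -/
def Covers (T : ℕ) (obs : ℕ → Fin K × ℝ) (π : ℕ → Fin K → ℝ) (Ex : ℕ → Prop) (a : Fin K) (x : ℝ)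
    (t : ℕ) : Prop :=
  ∀ k, t ≤ k → k < T → ¬ Ex k → π k = oneHot a x → (obs k).1 = a

theorem Covers.mono {a : Fin K} {x : ℝ} {t t' : ℕ} (h : Covers T obs π Ex a x t) (ht : t ≤ t') :
    Covers T obs π Ex a x t' := fun k hk => h k (ht.trans hk)

theorem covers_of_accurate (hbest : PlaysBest T obs π μh Ex) (hM : ∀ b, μ b ≤ M) {ε x : ℝ} {t : ℕ}
    {a : Fin K} (hacc : AccurateFrom T μ μh ε t) (hx : M - μ a + 2 * ε < x) :
    Covers T obs π Ex a x t := by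
  intro k hk hkT hEx hπ
  by_contra ha
  exact absurd hx (not_lt.2 (le_need_of_not_plays hbest hkT hEx (hacc k hk hkT) hM hπ ha))

/-- Empirical means lie in `[0, 1]`, so an incentive above one beats any other arm, however
inaccurate the means are. -/
theorem covers_of_one_lt (hbest : PlaysBest T obs π μh Ex)
    (hμh : ∀ k < T, ∀ b, μh b k ∈ Set.Icc (0 : ℝ) 1) {x : ℝ} {t : ℕ} {a : Fin K} (hx : 1 < x) :
    Covers T obs π Ex a x t := by
  intro k hk hkT hEx hπ
  by_contra ha
  have h1 := hbest k hkT hEx a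
  rw [hπ] at h1
  simp only [oneHot, if_true, if_neg ha] at h1
  linarith [(hμh k hkT a).1, (hμh k hkT (obs k).1).2]

/-- A sorted list of incentives for arm `a` that holds a covering incentive of size at most `U`. -/
structure GoodList (T : ℕ) (obs : ℕ → Fin K × ℝ) (π : ℕ → Fin K → ℝ) (Ex : ℕ → Prop) (r : ℕ)
    (U : ℝ) (a : Fin K) (l : List ℝ) (t : ℕ) : Prop where
  length : l.length = r
  sorted : l.Pairwise (· ≤ ·)
  mem_Icc : ∀ x ∈ l, x ∈ Set.Icc (0 : ℝ) (1 + 1 / T)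
  covers : t ≤ T → ∃ x ∈ l, x ≤ U ∧ Covers T obs π Ex a x t

theorem GoodList.mono {r : ℕ} {U : ℝ} {a : Fin K} {l : List ℝ} {t t' : ℕ}
    (h : GoodList T obs π Ex r U a l t) (ht : t ≤ t') : GoodList T obs π Ex r U a l t' :=
  ⟨h.length, h.sorted, h.mem_Icc, fun htT => by
    obtain ⟨x, hx, hxU, hc⟩ := h.covers (ht.trans htT)
    exact ⟨x, hx, hxU, hc.mono ht⟩⟩

/-- The largest number of rounds of a search. -/
noncomputable def searchRounds (T : ℕ) : ℕ := 3 * ⌈Real.logb 2 T⌉₊ + 2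

/-- A search with a useless output contains an exploration of its own, so with fewer than `r`
explorations some output is useful, and `f` lifts it above `M - μ a + 2 * ε`. The first alternative
of `hcase` serves phase one, where no accuracy is available and all outputs are lifted above one. -/
theorem Wp_searches (hT : 1 ≤ T) (hbest : PlaysBest T obs π μh Ex)
    (hμh : ∀ k < T, ∀ b, μh b k ∈ Set.Icc (0 : ℝ) 1) (hμ : ∀ b, μ b ∈ Set.Icc (0 : ℝ) 1)
    (hM : ∀ b, μ b ≤ M) {z : Fin K} (hz : μ z = M) {ε e U : ℝ} {t : ℕ} (a : Fin K) {r : ℕ}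
    (hr : 1 ≤ r) {f : ℝ → ℝ} (hf : Monotone f) (hf01 : ∀ b, 0 ≤ b → f b ∈ Set.Icc (0 : ℝ) (1 + 1 / T))
    (hcase : (∀ b, 0 ≤ b → 1 < f b ∧ f b ≤ U) ∨
      (0 ≤ ε ∧ AccurateFrom T μ μh ε t ∧
        (∀ k, t ≤ k → k < T → 1 / ((max 1 ((Tally.ofPath obs k).count a) : ℕ) : ℝ) +
          2 / ((max 1 (⨅ i, (Tally.ofPath obs k).count i) : ℕ) : ℝ) ≤ e) ∧
        exCount T Ex t (t + r * searchRounds T) < r ∧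
        (∀ b, M - μ a - 2 * ε ≤ b → b ≤ M - μ a + 2 * ε + 3 / T + e →
          (M - μ a + 2 * ε < f b ∨ 1 < f b) ∧ f b ≤ U))) :
    Wp obs π (do
      let bs ← times r (search T a)
      pure (a, (bs.insertionSort (· ≤ ·)).map f)) t (fun al t' =>
        al.1 = a ∧ t + r ≤ t' ∧ t' ≤ t + r * searchRounds T ∧ OneHotDuring π 1 t t' ∧
        GoodList T obs π Ex r U a al.2 t') := by
  have hM0 : 0 ≤ M - μ a := by linarith [hM a]
  have hM1 : M - μ a ≤ 1 := by linarith [(hμ a).1, (hμ z).2]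
  refine Wp_bind ((Wp_times (I := fun done t' =>
    t + done.length ≤ t' ∧ t' ≤ t + done.length * searchRounds T ∧ (∀ b ∈ done, 0 ≤ b) ∧
    OneHotDuring π 1 t t' ∧ (t' ≤ T → 0 ≤ ε → AccurateFrom T μ μh ε t →
      (∀ k, t ≤ k → k < T → 1 / ((max 1 ((Tally.ofPath obs k).count a) : ℕ) : ℝ) +
          2 / ((max 1 (⨅ i, (Tally.ofPath obs k).count i) : ℕ) : ℝ) ≤ e) →
      (∃ b ∈ done, M - μ a - 2 * ε ≤ b ∧ b ≤ M - μ a + 2 * ε + 3 / T + e) ∨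
        done.length ≤ exCount T Ex t t')) r ?_ ?_).mono ?_)
  · exact ⟨by simp, by simp, by simp, fun k hk hkt => by omega, fun _ _ _ _ => Or.inr (by simp)⟩
  · rintro done t1 - ⟨h1, h2, h3, h4, h5⟩
    refine (Wp_searchLoop hT hbest hM hz (ε := ε) (e := e) (t₀ := t) a false 1 0 1 0 0 t1 (by omega)
      rfl le_rfl zero_le_one le_rfl (by norm_num) (by simp)).mono ?_
    rintro b t' - ⟨g1, g2, g3, g4, g5⟩
    simp only [if_true] at g2
    simp only [List.length_append, List.length_singleton, searchRounds] at h2 ⊢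
    refine ⟨by omega, by rw [add_mul]; omega, ?_, h4.trans g4, ?_⟩
    · intro x hx
      rcases List.mem_append.1 hx with hx | hx
      · exact h3 x hx
      · rw [List.mem_singleton.1 hx]; exact g3
    · intro htT hε hacc hst
      rcases h5 (by omega) hε hacc hst with ⟨x, hx, hx'⟩ | hlen
      · exact Or.inl ⟨x, List.mem_append_left _ hx, hx'⟩
      · by_cases hE : ∀ k, t1 ≤ k → k < t' → ¬ Ex k
        · exact Or.inl ⟨b, by simp, g5 htT hE hacc hst hε (by linarith) (by linarith)⟩
        · push Not at hE
          obtain ⟨k, hk1, hk2, hk3⟩ := hE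
          right
          rw [← exCount_add (show t ≤ t1 by omega) g1.le]
          have := one_le_exCount (T := T) hk1 hk2 (by omega) hk3
          omega
  · rintro bs t' - ⟨hlen, h1, h2, h3, h4, h5⟩
    rw [hlen] at h1 h2 h5
    refine Wp_pure ⟨rfl, h1, h2, h4, ?_, ?_, ?_, ?_⟩
    · simp [hlen]
    · rw [List.pairwise_map]
      exact (List.pairwise_insertionSort (· ≤ ·) bs).imp fun h => hf h
    · intro x hx
      obtain ⟨b, hb, rfl⟩ := List.mem_map.1 hx
      exact hf01 b (h3 b ((List.mem_insertionSort _).1 hb))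
    · intro htT
      have hmem : ∀ b ∈ bs, f b ∈ (bs.insertionSort (· ≤ ·)).map f := fun b hb =>
        List.mem_map_of_mem ((List.mem_insertionSort _).2 hb)
      rcases hcase with hcase | ⟨hε, hacc, hst, hwin, hcase⟩
      · obtain ⟨b, hb⟩ := List.exists_mem_of_length_pos (l := bs) (by omega)
        exact ⟨f b, hmem b hb, (hcase b (h3 b hb)).2,
          covers_of_one_lt hbest hμh (hcase b (h3 b hb)).1⟩
      · rcases h5 htT hε hacc hst with ⟨b, hb, hb1, hb2⟩ | hcount
        · obtain ⟨hcov, hU⟩ := hcase b hb1 hb2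
          refine ⟨f b, hmem b hb, hU, ?_⟩
          rcases hcov with hcov | hcov
          · exact (covers_of_accurate hbest hM hacc hcov).mono (by omega)
          · exact covers_of_one_lt hbest hμh hcov
        · have := exCount_mono (T := T) (Ex := Ex) (t := t) h2
          omega

end Path

end Exploratory

/-! ### Incentive testing along a path -/

namespace Exploratory

open Principal

section Path

variable {K : ℕ} {T : ℕ} {θ μ : Fin K → ℝ} {V M : ℝ} {obs : ℕ → Fin K × ℝ} {π : ℕ → Fin K → ℝ}
  {μh : Fin K → ℕ → ℝ} {Ex : ℕ → Prop} {c₀ δ B : ℝ} {m : ℕ}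

/-- The loop stops at the first violation. One round before the end the misses were still below the
threshold, and the last round adds at most one. A stop without violation is due to the length. -/
theorem Wp_testLoop (a : Fin K) (b : ℝ) (Y c t : ℕ) (hY : (Y : ℝ) < 2 * phaseLength K T c₀ δ m) :
    Wp obs π (testLoop T c₀ δ m a b Y c) t (fun Yc t' =>
      t < t' ∧ Yc.1 = Y + (t' - t) ∧ Yc.2 = c + misses obs a t t' ∧
      (∀ k, t ≤ k → k < t' → π k = oneHot a b) ∧
      (Yc.1 : ℝ) < 2 * phaseLength K T c₀ δ m + 1 ∧
      ((Yc.2 : ℝ) ≤ threshold K T c₀ δ Yc.1 → 2 * phaseLength K T c₀ δ m ≤ Yc.1) ∧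
      (Yc.1 = Y + 1 ∨ (Yc.2 : ℝ) ≤ threshold K T c₀ δ (Yc.1 - 1) + 1)) := by
  induction Y, c using testLoop.induct (K := K) T c₀ δ m a generalizing t with
  | case1 Y c ih =>
  rw [testLoop]
  refine Wp_bind (Wp_propose fun hπ => ?_)
  have hc' : (if (obs t).1 = a then c else c + 1) = c + if (obs t).1 = a then 0 else 1 := by
    split_ifs <;> rfl
  have hle : (if (obs t).1 = a then c else c + 1) ≤ c + 1 := by split_ifs <;> omega
  set i := (obs t).1 with hi
  extract_lets c'
  have hcc : c' = c + if (obs t).1 = a then 0 else 1 := hc'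
  have hlt : ((Y + 1 : ℕ) : ℝ) < 2 * phaseLength K T c₀ δ m + 1 := by push_cast; linarith
  split
  · next h =>
    refine Wp_pure ⟨by omega, by simp, ?_, ?_, hlt, ?_, Or.inl rfl⟩
    · rw [misses_cons (by omega), hcc]
      simp [misses]
    · intro k h1 h2
      rw [show k = t by omega]; exact hπ
    · intro h'
      rcases h with h | h
      · exact absurd h (not_lt.2 h')
      · exact h
  · next h =>
    have hn : ¬ (((Y + 1 : ℕ) : ℝ) ≥ 2 * phaseLength K T c₀ δ m) := fun h' => h (Or.inr h')
    have hn' : (c' : ℝ) ≤ threshold K T c₀ δ (Y + 1) := not_lt.1 fun h' => h (Or.inl h')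
    refine Wp.mono (ih i h (t + 1) (not_le.1 hn)) ?_
    rintro Yc t' - ⟨h1, h2, h3, h4, h5, h6, h7⟩
    have h3' : Yc.2 = c' + misses obs a (t + 1) t' := h3
    refine ⟨by omega, by omega, ?_, ?_, h5, h6, ?_⟩
    · rw [h3', hcc, misses_cons (a := a) (by omega : t < t')]
      ring
    · intro k hk1 hk2
      rcases hk1.eq_or_lt with rfl | hk1
      · exact hπ
      · exact h4 k hk1 hk2
    · right
      rcases h7 with h7 | h7
      -- The recursive call lasted one round only, so the last but one round is the present one,
      -- which passed the test.
      · have ht' : t' = t + 2 := by omega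
        have hm : misses obs a (t + 1) t' ≤ 1 := by
          rw [ht']
          refine (Finset.card_filter_le _ _).trans (by simp)
        rw [h3', h7]
        push_cast
        have : ((misses obs a (t + 1) t' : ℕ) : ℝ) ≤ 1 := by exact_mod_cast hm
        simpa using add_le_add hn' this
      · exact h7

/-- A play of `a` costs at most `e`, a miss at most `1 + x ≤ 3`. -/
theorem cost_test_le (hB : B ≤ 1) (hθ : ∀ a, 0 ≤ θ a) {a : Fin K} {x e : ℝ} {t t' : ℕ}
    (htt' : t ≤ t') (hx : 0 ≤ x) (hx2 : x ≤ 2) (he : 0 ≤ e) (hxe : B - θ a + x ≤ e)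
    (hπ : ∀ k, t ≤ k → k < t' → π k = oneHot a x) :
    cost T θ B obs π t t' ≤ e * ((t' : ℝ) - t) + 3 * misses obs a t t' := by
  have h1 : cost T θ B obs π t t' ≤
      ∑ k ∈ Finset.Ico t t', (e + if (obs k).1 ≠ a then (3 : ℝ) else 0) := by
    refine Finset.sum_le_sum fun k hk => ?_
    have hk' := Finset.mem_Ico.1 hk
    by_cases ha : (obs k).1 = a
    · rw [if_neg (by simpa using ha), add_zero, roundCost, hπ k hk'.1 hk'.2, sum_oneHot, ha]
      split_ifs
      · exact max_le he (by linarith)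
      · exact he
    · rw [if_pos ha]
      have := roundCost_le_of_oneHot (T := T) (obs := obs) hB hθ hx (hπ k hk'.1 hk'.2)
      linarith
  refine h1.trans (le_of_eq ?_)
  rw [Finset.sum_add_distrib, Finset.sum_const, Nat.card_Ico, nsmul_eq_mul, Nat.cast_sub htt',
    Finset.sum_ite, Finset.sum_const_zero, add_zero, Finset.sum_const, nsmul_eq_mul, misses]
  ring

/-- A covering incentive is missed only through exploration. By `htest` its test never exceeds the
threshold, so it runs for `2 T_m` rounds, at least half of them plays, and ends the loop. Until then
a covering incentive remains in the sorted list, so every tested incentive is at most `U`. Of the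
two bounds for the threshold, `hhalf` bounds rounds by plays, and `hlin` bounds misses in a way that
can be summed over tests of different lengths. -/
theorem Wp_testAll (hB : B ≤ 1) (hθ : ∀ a, 0 ≤ θ a) (hT : 1 ≤ T) {a : Fin K} {t₀ : ℕ}
    {Y₀ lam d U e : ℝ} (hY₀ : 0 ≤ Y₀) (hlam : 0 ≤ lam) (hd : 0 ≤ d)
    (hhalf : ∀ Y : ℕ, Y₀ ≤ Y → threshold K T c₀ δ Y ≤ Y / 2)
    (hlin : ∀ Y : ℕ, 1 ≤ Y → threshold K T c₀ δ Y ≤ lam * Y + d)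
    (hlen : Y₀ ≤ 2 * phaseLength K T c₀ δ m) (hpos : 0 < phaseLength K T c₀ δ m)
    (htest : ∀ t, t₀ ≤ t → ∀ Y : ℕ, (Y : ℝ) < 2 * phaseLength K T c₀ δ m + 1 → t + Y ≤ T →
      (exCount T Ex t (t + Y) : ℝ) ≤ threshold K T c₀ δ Y)
    (he : 0 ≤ e) (hUe : t₀ ≤ T → B - θ a + U ≤ e) (l : List ℝ) (hsorted : l.Pairwise (· ≤ ·))
    (hl : ∀ x ∈ l, x ∈ Set.Icc (0 : ℝ) (1 + 1 / T)) (g : ℝ) (hg0 : 0 ≤ g)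
    (hg : g < phaseLength K T c₀ δ m) (t : ℕ) (ht : t₀ ≤ t)
    (hcov : t ≤ T → ∃ x ∈ l, x ≤ U ∧ Covers T obs π Ex a x t) :
    Wp obs π (testAll T c₀ δ m a l g) t (fun _ t' =>
      t ≤ t' ∧ OneHotDuring π 2 t t' ∧
      ((t' : ℝ) - t ≤ l.length * (Y₀ + 3) +
        2 * (((Tally.ofPath obs t').count a : ℝ) - (Tally.ofPath obs t).count a)) ∧
      -- Before the last test the total is below `T_m`, and the last test has fewer than `2 T_m + 1`
      -- rounds.
      ((Tally.ofPath obs t').count a : ℝ) - (Tally.ofPath obs t).count a ≤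
        3 * phaseLength K T c₀ δ m - g + 1 ∧
      (t' ≤ T → phaseLength K T c₀ δ m - g ≤
        ((Tally.ofPath obs t').count a : ℝ) - (Tally.ofPath obs t).count a) ∧
      cost T θ B obs π t t' ≤ (e + 3 * lam) * ((t' : ℝ) - t) + l.length * (3 * (d + 1))) := by
  have hTle : (1 : ℝ) / T ≤ 1 := by
    rw [div_le_one (by exact_mod_cast hT)]; exact_mod_cast hT
  induction l generalizing g t with
  | nil =>
    refine Wp_pure ⟨le_rfl, fun k h1 h2 => by omega, by simp, ?_, ?_, by simp [cost]⟩
    · simp only [sub_self]; linarith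
    · intro htT
      obtain ⟨x, hx, -⟩ := hcov htT
      simp at hx
  | cons b l ih =>
    rw [testAll]
    have hb := hl b (by simp)
    refine Wp_bind ((Wp_testLoop a b 0 0 t (by simpa using hpos)).mono ?_)
    rintro ⟨Y, c⟩ t1 - ⟨h1, h2, h3, h4, h5, h6, h7⟩
    simp only [zero_add] at h2 h3 h7
    simp only at h4 h5 h6
    have hcnt := count_add_misses (obs := obs) (a := a) h1.le
    rw [← h3, ← h2] at hcnt
    have hcnt' : ((Tally.ofPath obs t1).count a : ℝ) - (Tally.ofPath obs t).count a =
        (Y : ℝ) - c := by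
      have : ((Tally.ofPath obs t1).count a : ℝ) + c = (Tally.ofPath obs t).count a + Y := by
        exact_mod_cast hcnt
      linarith
    have htY : (t1 : ℝ) - t = Y := by rw [h2, Nat.cast_sub h1.le]
    have hY1 : 1 ≤ Y := by omega
    have hcY : c ≤ Y := by
      rw [h3, h2]
      exact (Finset.card_filter_le _ _).trans (by simp)
    have hcY' : (c : ℝ) ≤ Y := by exact_mod_cast hcY
    have hone : OneHotDuring π 2 t t1 := fun k hk1 hk2 =>
      ⟨a, b, hb.1, by linarith [hb.2], h4 k hk1 hk2⟩
    -- the number of misses is below the threshold of the last but one round, plus one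
    have hYm : ((Y - 1 : ℕ) : ℝ) = Y - 1 := by rw [Nat.cast_sub hY1]; simp
    have hclin : (c : ℝ) ≤ lam * Y + d + 1 := by
      rcases h7 with h7 | h7
      · have h8 : (c : ℝ) ≤ 1 := by rw [h7] at hcY'; simpa using hcY'
        have : 0 ≤ lam * Y := by positivity
        linarith
      · rcases Nat.eq_or_lt_of_le hY1 with h8 | h8
        · have h9 : (c : ℝ) ≤ 1 := by rw [← h8] at hcY'; simpa using hcY'
          have : 0 ≤ lam * Y := by positivity
          linarith
        · have h9 := hlin (Y - 1) (by omega)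
          rw [hYm] at h9
          nlinarith
    have hYgain : (Y : ℝ) ≤ Y₀ + 3 + 2 * ((Y : ℝ) - c) := by
      rcases h7 with h7 | h7
      · have : (Y : ℝ) = 1 := by exact_mod_cast h7
        linarith
      · rcases lt_or_ge ((Y - 1 : ℕ) : ℝ) Y₀ with h8 | h8
        · rw [hYm] at h8; linarith
        · have h9 := hhalf _ h8
          rw [hYm] at h9
          linarith
    have hcost : cost T θ B obs π t t1 ≤ (e + 3 * lam) * ((t1 : ℝ) - t) + 3 * (d + 1) := by
      rcases lt_or_ge T t with htT | htT
      · rw [cost_eq_zero (by omega), htY]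
        have : 0 ≤ (e + 3 * lam) * Y := by positivity
        linarith
      · obtain ⟨x, hx, hxU, -⟩ := hcov htT
        have hUe := hUe (by omega)
        -- The list is sorted and the covering entry `x ≤ U` is still in it, so the head is at most
        -- `U`, whether it covers or not.
        have hbU : b ≤ U := by
          rcases List.mem_cons.1 hx with rfl | hx'
          · exact hxU
          · exact ((List.pairwise_cons.1 hsorted).1 x hx').trans hxU
        have := cost_test_le (T := T) (obs := obs) hB hθ h1.le hb.1 (by linarith [hb.2]) he
          (x := b) (by linarith) h4
        rw [← h3] at this
        rw [htY] at this ⊢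
        linarith
    extract_lets g'
    have hg' : g' = g + ((Y : ℝ) - c) := rfl
    split_ifs with hdone
    · refine Wp_pure ⟨h1.le, hone, ?_, ?_, ?_, ?_⟩
      · rw [hcnt', htY, List.length_cons]
        push_cast
        have : 0 ≤ (l.length : ℝ) * (Y₀ + 3) := by positivity
        linarith
      · rw [hcnt']
        have : (0 : ℝ) ≤ c := by positivity
        linarith
      · intro _; rw [hcnt']; linarith
      · rw [List.length_cons]
        push_cast
        have : 0 ≤ (l.length : ℝ) * (3 * (d + 1)) := by positivity
        linarith
    · have hdone' := not_le.1 hdone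
      have hcov' : t1 ≤ T → ∃ x ∈ l, x ≤ U ∧ Covers T obs π Ex a x t1 := by
        intro h8
        obtain ⟨x, hx, hxU, hxc⟩ := hcov (by omega)
        rcases List.mem_cons.1 hx with rfl | hx'
        · exfalso
          have h9 : misses obs a t t1 ≤ exCount T Ex t t1 :=
            misses_le_exCount h8 fun k hk1 hk2 hEx => hxc k hk1 (by omega) hEx (h4 k hk1 hk2)
          have h10 := htest t ht Y h5 (by omega)
          rw [show t + Y = t1 by omega] at h10
          have h11 : (c : ℝ) ≤ exCount T Ex t t1 := by rw [h3]; exact_mod_cast h9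
          have h12 := h6 (h11.trans h10)
          have h13 := hhalf Y (hlen.trans h12)
          linarith
        · exact ⟨x, hx', hxU, hxc.mono h1.le⟩
      refine (ih (List.pairwise_cons.1 hsorted).2 (fun x hx => hl x (by simp [hx])) g' (by linarith)
        hdone' t1 (by omega) hcov').mono ?_
      rintro _ t' - ⟨k1, k2, k3, k4, k5, k6⟩
      refine ⟨by omega, hone.trans k2, ?_, by linarith, fun h => by linarith [k5 h], ?_⟩
      · rw [List.length_cons]; push_cast; linarith
      · rw [← cost_add h1.le k1, List.length_cons]; push_cast; linarith

end Path

end Exploratory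

/-! ### Stabilization and elimination along a path -/

namespace Exploratory

open Principal

/-- A sorted list of zeros and ones is determined by the two counts, so its middle entries can be
read off. -/
theorem insertionSort_binary (L : List ℚ) (h : ∀ x ∈ L, x = 0 ∨ x = 1) :
    L.insertionSort (· ≤ ·) =
      List.replicate (L.count 0) 0 ++ List.replicate (L.count 1) 1 := by
  have hperm : L.Perm (List.replicate (L.count 0) 0 ++ List.replicate (L.count 1) 1) := by
    rw [List.perm_iff_count]
    intro x
    rw [List.count_append, List.count_replicate, List.count_replicate]
    by_cases h0 : x = 0
    · subst h0; simp
    · by_cases h1 : x = 1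
      · subst h1; simp
      · have : L.count x = 0 := List.count_eq_zero.2 fun hx => by
          rcases h x hx with h' | h'
          · exact h0 h'
          · exact h1 h'
        simp [this, Ne.symm h0, Ne.symm h1]
  refine List.Perm.eq_of_pairwise (le := (· ≤ ·)) (fun a b _ _ hab hba => le_antisymm hab hba)
    (List.pairwise_insertionSort _ _) ?_ ((List.perm_insertionSort _ _).trans hperm)
  rw [List.pairwise_append]
  refine ⟨List.pairwise_replicate.2 (Or.inr le_rfl), List.pairwise_replicate.2 (Or.inr le_rfl), ?_⟩
  intro a ha b hb
  rw [(List.mem_replicate.1 ha).2, (List.mem_replicate.1 hb).2]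
  norm_num

theorem length_eq_count_binary (L : List ℚ) (h : ∀ x ∈ L, x = 0 ∨ x = 1) :
    L.length = L.count 0 + L.count 1 := by
  rw [← List.length_insertionSort (· ≤ ·) L, insertionSort_binary L h]
  simp

theorem median_ne_zero_of_binary {L : List ℚ} (h : ∀ x ∈ L, x = 0 ∨ x = 1)
    (hc : 2 * L.count 0 < L.length) : median L ≠ 0 := by
  have hlen := length_eq_count_binary L h
  have hL : 0 < L.length := by omega
  have key : ∀ i, L.count 0 ≤ i → i < L.length →
      (List.replicate (L.count 0) (0 : ℚ) ++ List.replicate (L.count 1) 1).getD i 0 = 1 := by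
    intro i h1 h2
    rw [List.getD_append_right _ _ _ _ (by simpa using h1), List.getD_replicate]
    simp; omega
  simp only [median, insertionSort_binary L h, List.length_append, List.length_replicate, ← hlen]
  rw [key _ (by omega) (by omega), key _ (by omega) (by omega)]
  norm_num

theorem median_eq_zero_of_binary {L : List ℚ} (h : ∀ x ∈ L, x = 0 ∨ x = 1)
    (hc : L.length < 2 * L.count 0) : median L = 0 := by
  have hlen := length_eq_count_binary L h
  have key : ∀ i, i < L.count 0 →
      (List.replicate (L.count 0) (0 : ℚ) ++ List.replicate (L.count 1) 1).getD i 0 = 0 := by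
    intro i h1
    rw [List.getD_append _ _ _ _ (by simpa using h1), List.getD_replicate]
    exact h1
  simp only [median, insertionSort_binary L h, List.length_append, List.length_replicate, ← hlen]
  rw [key _ (by omega), key _ (by omega)]
  norm_num

section Path

variable {K : ℕ} {T : ℕ} {θ μ : Fin K → ℝ} {V M : ℝ} {obs : ℕ → Fin K × ℝ} {π : ℕ → Fin K → ℝ}
  {μh : Fin K → ℕ → ℝ} {Ex : ℕ → Prop} {c₀ δ B : ℝ} {m : ℕ}

theorem Wp_times_propose (p : Fin K → ℝ) (n t : ℕ) :
    Wp obs π (times n (propose p)) t (fun _ t' => t' = t + n ∧ ∀ k, t ≤ k → k < t' → π k = p) := by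
  refine (Wp_times (I := fun done t' => t' = t + done.length ∧ ∀ k, t ≤ k → k < t' → π k = p) n
    ⟨by simp, fun k h1 h2 => by omega⟩ ?_).mono ?_
  · rintro done t1 - ⟨h1, h2⟩
    refine Wp_propose fun hπ => ⟨by simp; omega, fun k hk1 hk2 => ?_⟩
    rcases Nat.lt_succ_iff_lt_or_eq.1 hk2 with h | rfl
    · exact h2 k hk1 h
    · exact hπ
  · rintro xs t' - ⟨h1, h2, h3⟩
    exact ⟨by omega, h3⟩

/-- The incentive exceeds one, so every miss is an exploration, and these fill less than half of
each block. -/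
theorem Wp_stabilize (hT : 1 ≤ T) (hbest : PlaysBest T obs π μh Ex)
    (hμh : ∀ k < T, ∀ b, μh b k ∈ Set.Icc (0 : ℝ) 1) (Z : ℕ) (bad : List (Fin K)) (t : ℕ)
    (hhalf : ∀ a ∈ bad, ∀ t', t ≤ t' → t' + Z ≤ T → 2 * exCount T Ex t' (t' + Z) < Z) :
    Wp obs π (forEach (fun a => times Z (propose (oneHot a (1 + 1 / T)))) bad) t (fun _ t' =>
      t' = t + bad.length * Z ∧ OneHotDuring π 2 t t' ∧
      (t' ≤ T → ∀ b ∈ bad, Z ≤ 2 * (Tally.ofPath obs t').count b)) := by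
  have hTpos : (0 : ℝ) < 1 / T := by have : (0 : ℝ) < T := by exact_mod_cast hT
                                     positivity
  have hTle : (1 : ℝ) / T ≤ 1 := by
    rw [div_le_one (by exact_mod_cast hT)]; exact_mod_cast hT
  refine (Wp_forEach (I := fun done t' => t' = t + done.length * Z ∧ OneHotDuring π 2 t t' ∧
    (t' ≤ T → ∀ p ∈ done, Z ≤ 2 * (Tally.ofPath obs t').count p.1)) bad
    ⟨by simp, fun k h1 h2 => by omega, by simp⟩ ?_).mono ?_
  · rintro a ha done t1 ⟨h1, h2, h3⟩
    refine (Wp_times_propose _ Z t1).mono ?_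
    rintro xs t' - ⟨h4, h5⟩
    refine ⟨by simp; rw [add_mul]; omega, h2.trans fun k hk1 hk2 =>
      ⟨a, _, by positivity, by linarith, h5 k hk1 hk2⟩, fun htT p hp => ?_⟩
    rcases List.mem_append.1 hp with hp | hp
    · have := h3 (by omega) p hp
      have := Tally.ofPath_count_mono obs p.1 (show t1 ≤ t' by omega)
      simp only at this
      omega
    · rw [List.mem_singleton.1 hp]
      have e1 := count_add_misses (obs := obs) (a := a) (show t1 ≤ t' by omega)
      have e2 : misses obs a t1 t' ≤ exCount T Ex t1 t' :=
        misses_le_exCount htT fun k hk1 hk2 hEx =>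
          covers_of_one_lt hbest hμh (by linarith : (1 : ℝ) < 1 + 1 / T) (t := t1) k hk1 (by omega)
            hEx (h5 k hk1 hk2)
      have e3 := hhalf a ha t1 (by omega) (by omega)
      rw [← h4] at e3
      simp only
      omega
  · rintro xs t' - ⟨h0, h1, h2, h3⟩
    have hz : (bad.zip xs).length = bad.length := by simp [h0]
    refine ⟨by rw [h1, hz], h2, fun htT b hb => ?_⟩
    have : b ∈ (bad.zip xs).map Prod.fst := by rw [List.map_fst_zip (by omega)]; exact hb
    obtain ⟨p, hp, rfl⟩ := List.mem_map.1 this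
    exact h3 htT p hp

/-- The number of rounds in which the elimination of an arm is tested. -/
noncomputable def keepRounds (K T : ℕ) (δ : ℝ) : ℕ :=
  ⌊8 * Real.log (8 * K * Real.logb 2 T / δ)⌋₊ + 1

theorem Wp_keepArm (act : Finset (Fin K)) (a : Fin K) (t : ℕ) :
    Wp obs π (keepArm T c₀ δ m act a) t (fun kept t' => t' = t + keepRounds K T δ ∧
      (∀ k, t ≤ k → k < t' → π k = compareIncentive T c₀ δ m act (Tally.ofPath obs t) a) ∧
      (2 * misses obs a t t' < keepRounds K T δ → kept = true) ∧
      (keepRounds K T δ < 2 * misses obs a t t' → kept = false)) := by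
  refine Wp_bind (Wp_get (Wp_bind ((Wp_times (I := fun done t' => t' = t + done.length ∧
    (∀ k, t ≤ k → k < t' → π k = compareIncentive T c₀ δ m act (Tally.ofPath obs t) a) ∧
    (∀ x ∈ done, x = 0 ∨ x = 1) ∧ done.count 0 = misses obs a t t')
    (⌊8 * Real.log (8 * K * Real.logb 2 T / δ)⌋₊ + 1) ?_ ?_).mono ?_)))
  · exact ⟨by simp, fun k h1 h2 => by omega, by simp, by simp [misses]⟩
  · rintro done t1 - ⟨h1, h2, h3, h4⟩
    refine Wp_bind (Wp_propose fun hπ => Wp_pure ⟨by simp; omega, fun k hk1 hk2 => ?_, ?_, ?_⟩)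
    · rcases Nat.lt_succ_iff_lt_or_eq.1 hk2 with h | rfl
      · exact h2 k hk1 h
      · exact hπ
    · intro x hx
      rcases List.mem_append.1 hx with hx | hx
      · exact h3 x hx
      · rw [List.mem_singleton.1 hx]
        split_ifs <;> simp
    · rw [List.count_append, h4, misses, misses, Finset.card_filter, Finset.card_filter,
        Finset.sum_Ico_succ_top (by omega)]
      congr 1
      by_cases ha : (obs t1).1 = a <;> simp [ha]
  · rintro L t' - ⟨h0, h1, h2, h3, h4⟩
    refine Wp_pure ⟨by rw [h1, h0]; rfl, h2, fun h => ?_, fun h => ?_⟩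
    · exact decide_eq_true (median_ne_zero_of_binary h3 (by rw [h4, h0]; exact h))
    · exact decide_eq_false (not_not.2 (median_eq_zero_of_binary h3 (by rw [h4, h0]; exact h)))

/-- In a comparison of the best arm, the agent plays it unless she explores. -/
theorem plays_best_of_compare (hbest : PlaysBest T obs π μh Ex)
    (hμh : ∀ k < T, ∀ b, μh b k ∈ Set.Icc (0 : ℝ) 1) {w : ℝ} {act : Finset (Fin K)} {k : ℕ}
    (hk : k < T) (hEx : ¬ Ex k) {S : Tally K} (hθ : ∀ b, 0 ≤ θ b)
    -- Two arms are compared by the sums of the players' means, which makes four errors; the bonus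
    -- outweighs them.
    (hw4 : 4 * w < 5 * √(Real.log (16 * K * T / δ) / (2 * phaseLength K T c₀ δ m))) (hw0 : 0 ≤ w)
    (hagent : ∀ b ∈ act, |μh b k - μ b| ≤ w) (hprinc : ∀ b ∈ act, |S.mean b - θ b| ≤ w)
    {a : Fin K} (ha : a ∈ act) (hV : ∀ b, θ b + μ b ≤ θ a + μ a)
    (hπ : π k = compareIncentive T c₀ δ m act S a) : (obs k).1 = a := by
  by_contra hne
  have h1 := hbest k hk hEx a
  rw [hπ] at h1
  simp only [compareIncentive, if_true, if_neg hne] at h1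
  have a1 := abs_le.1 (hagent a ha)
  have a2 := abs_le.1 (hprinc a ha)
  split_ifs at h1 with hmem
  · have b1 := abs_le.1 (hagent _ hmem)
    have b2 := abs_le.1 (hprinc _ hmem)
    linarith [hV (obs k).1]
  -- Bad arms get no incentive while the target gets more than one, so accuracy is needed for active
  -- arms only.
  · have b1 := (hμh k hk (obs k).1).2
    have b2 := (hμh k hk a).1
    linarith [hθ a]

/-- In a comparison of a clearly suboptimal arm, the agent plays another arm unless she explores. -/
theorem not_plays_of_compare (hbest : PlaysBest T obs π μh Ex) {w : ℝ} {act : Finset (Fin K)}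
    {k : ℕ} (hk : k < T) (hEx : ¬ Ex k) {S : Tally K}
    (hw4 : 4 * w < 5 * √(Real.log (16 * K * T / δ) / (2 * phaseLength K T c₀ δ m)))
    (hw0 : 0 ≤ w)
    (hagent : ∀ b ∈ act, |μh b k - μ b| ≤ w) (hprinc : ∀ b ∈ act, |S.mean b - θ b| ≤ w)
    {a s : Fin K} (ha : a ∈ act) (hs : s ∈ act)
    -- Twice the bonus: once for the bonus that favours `a`, once for the four errors.
    (hgap : 10 * √(Real.log (16 * K * T / δ) / (2 * phaseLength K T c₀ δ m)) <
      θ s + μ s - (θ a + μ a))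
    (hπ : π k = compareIncentive T c₀ δ m act S a) : (obs k).1 ≠ a := by
  intro hplay
  have h1 := hbest k hk hEx s
  have hsa : s ≠ a := by
    rintro rfl
    linarith
  rw [hπ] at h1
  simp only [compareIncentive, hplay, if_true, if_neg hsa, if_pos hs] at h1
  have a1 := abs_le.1 (hagent a ha)
  have a2 := abs_le.1 (hprinc a ha)
  have b1 := abs_le.1 (hagent s hs)
  have b2 := abs_le.1 (hprinc s hs)
  linarith

theorem misses_ge {a : Fin K} {t t' : ℕ} (ht : t' ≤ T)
    (h : ∀ k, t ≤ k → k < t' → ¬ Ex k → (obs k).1 ≠ a) :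
    t' - t ≤ misses obs a t t' + exCount T Ex t t' := by
  classical
  unfold misses exCount
  rw [← Nat.card_Ico t t']
  refine le_trans (Finset.card_le_card fun k hk => ?_) (Finset.card_union_le _ _)
  have hk' := Finset.mem_Ico.1 hk
  simp only [Finset.mem_union, Finset.mem_filter, hk, true_and]
  by_cases hEx : Ex k
  · exact Or.inr ⟨by omega, hEx⟩
  · exact Or.inl (h k hk'.1 hk'.2 hEx)

end Path

end Exploratory

/-! ### Good paths -/

namespace Exploratory

open Principal

/-- The logarithm `log (16 K T / δ)`. -/
noncomputable def confLog (K T : ℕ) (δ : ℝ) : ℝ := Real.log (16 * K * T / δ)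

/-- The constant in the range of lengths for which the number of explorations is controlled. -/
noncomputable def testConst (c₀ : ℝ) : ℝ := 512 * c₀ ^ 3 + 1

/-- The length from which on the threshold of a test is at most half of its length. -/
noncomputable def halfLength (K T : ℕ) (c₀ δ : ℝ) : ℝ :=
  (64 * c₀ ^ 2 + 128) * Real.log (iota K T δ)

/-- Inequalities between the parameters of the algorithm that hold for large horizons. -/
structure Large (K T : ℕ) (c₀ δ : ℝ) : Prop where
  c₀_pos : 0 < c₀
  one_le_K : 1 ≤ K
  two_le_T : 2 ≤ T
  one_le_confLog : 1 ≤ confLog K T δ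
  one_le_log_iota : 1 ≤ Real.log (iota K T δ)
  log_two_T_le : Real.log (2 * T) ≤ Real.log (iota K T δ)
  halfLength_le : halfLength K T c₀ δ ≤ phaseLength K T c₀ δ 1
  confLog_le : confLog K T δ ≤ phaseLength K T c₀ δ 1
  K_le : K ≤ phaseLength K T c₀ δ 1
  log_T_le : 2 * Real.log T ≤ phaseLength K T c₀ δ 1
  calls : 2 * Real.log T ≤ searchCalls T δ
  calls_pos : 1 ≤ searchCalls T δ
  -- The right side contains a lower bound for the length of the searches in phase one, which
  -- precede its first test. It puts the tests into the range of `GoodPath.test`.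
  test_first : 2 * phaseLength K T c₀ δ 1 + 1 ≤
    testConst c₀ * Real.log (iota K T δ) ^ 2 * (2 * Real.log T * K)
  test_later : 9 ≤ testConst c₀ * Real.log (iota K T δ) ^ 2
  -- Through `first_div_le`, each stabilization block has at least `8 log T` rounds, the shortest
  -- window that `GoodPath.half` controls.
  stabilize : 8 * Real.log T ≤ 2 * (phaseLength K T c₀ δ 1 / K) ^ (2 / 3 : ℝ)
  keep : 8 * Real.log T ≤ keepRounds K T δ

section Numbers

variable {K T : ℕ} {c₀ δ : ℝ}

theorem phaseLength_zero : phaseLength K T c₀ δ 0 = 1 := by simp [phaseLength]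

theorem phaseLength_of_pos {m : ℕ} (hm : 1 ≤ m) : phaseLength K T c₀ δ m =
    32 * c₀ ^ 3 * 4 ^ m * K * confLog K T δ * Real.log (iota K T δ) ^ 2 := by
  rw [phaseLength, if_neg (by omega), confLog, pow_mul,
    show (16 : ℝ) * T * K / δ = 16 * K * T / δ by ring]
  norm_num

theorem phaseLength_succ {m : ℕ} (hm : 1 ≤ m) :
    phaseLength K T c₀ δ (m + 1) = 4 * phaseLength K T c₀ δ m := by
  rw [phaseLength_of_pos hm, phaseLength_of_pos (by omega), pow_succ]
  ring

namespace Large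

variable (h : Large K T c₀ δ)

include h

theorem one_le_first : 1 ≤ phaseLength K T c₀ δ 1 := h.one_le_confLog.trans h.confLog_le

theorem first_le {m : ℕ} (hm : 1 ≤ m) : phaseLength K T c₀ δ 1 ≤ phaseLength K T c₀ δ m := by
  induction m, hm using Nat.le_induction with
  | base => exact le_rfl
  | succ n hn ih =>
    rw [phaseLength_succ hn]
    linarith [h.one_le_first]

theorem one_le (m : ℕ) : 1 ≤ phaseLength K T c₀ δ m := by
  rcases Nat.eq_zero_or_pos m with rfl | hm
  · rw [phaseLength_zero]
  · exact h.one_le_first.trans (h.first_le hm)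

theorem K_pos : (0 : ℝ) < K := by exact_mod_cast h.one_le_K

/-- Both summands are at most `Y / 4`: the first by `64 c₀² log(2 T) ≤ Y`, the second by `128 log ι
≤ Y`. -/
theorem threshold_le_half {Y : ℕ} (hY : halfLength K T c₀ δ ≤ Y) :
    threshold K T c₀ δ Y ≤ Y / 2 := by
  unfold halfLength at hY
  set I := Real.log (iota K T δ) with hI
  have hI1 := h.one_le_log_iota
  have hc := h.c₀_pos
  have hY128 : 128 * I ≤ Y := by nlinarith [sq_nonneg c₀]
  have hY64 : 64 * c₀ ^ 2 * I ≤ Y := by nlinarith [sq_nonneg c₀]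
  have hYpos : (0 : ℝ) < Y := by linarith
  have hlog := h.log_two_T_le
  have h1 : 2 * c₀ * √(Y * Real.log (2 * T)) ≤ Y / 4 := by
    have : √(Y * Real.log (2 * T)) ≤ Y / (8 * c₀) := by
      apply Real.sqrt_le_iff.2
      refine ⟨by positivity, ?_⟩
      rw [div_pow, le_div_iff₀ (by positivity)]
      have h2 : 64 * c₀ ^ 2 * Real.log (2 * T) ≤ Y :=
        (mul_le_mul_of_nonneg_left hlog (by positivity)).trans hY64
      nlinarith
    calc _ ≤ 2 * c₀ * (Y / (8 * c₀)) := by gcongr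
      _ = Y / 4 := by field_simp; ring
  have h2 : √(8 * I / Y) ≤ Y / 4 := by
    apply Real.sqrt_le_iff.2
    refine ⟨by positivity, ?_⟩
    rw [div_le_iff₀ hYpos]
    have : (1 : ℝ) ≤ Y := by linarith
    have h3 : (Y : ℝ) ≤ Y ^ 3 := by nlinarith [sq_nonneg ((Y : ℝ) - 1), sq_nonneg (Y : ℝ)]
    nlinarith
  unfold threshold
  linarith

/-- The inequality of arithmetic and geometric means for the square root, with free weight `lam`. -/
theorem threshold_le_linear {lam : ℝ} (hlam : 0 < lam) {Y : ℕ} (hY : 1 ≤ Y) :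
    threshold K T c₀ δ Y ≤ lam * Y +
      (c₀ ^ 2 * Real.log (iota K T δ) / lam + √(8 * Real.log (iota K T δ))) := by
  set I := Real.log (iota K T δ) with hI
  have hI1 := h.one_le_log_iota
  have hc := h.c₀_pos
  have hY' : (1 : ℝ) ≤ Y := by exact_mod_cast hY
  have h1 : 2 * c₀ * √(Y * Real.log (2 * T)) ≤ lam * Y + c₀ ^ 2 * I / lam := by
    have e1 : √(Y * Real.log (2 * T)) ≤ √(Y * I) :=
      Real.sqrt_le_sqrt (mul_le_mul_of_nonneg_left h.log_two_T_le (by positivity))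
    have e2 : √(Y * I) = √Y * √I := Real.sqrt_mul (by positivity) _
    have e3 : c₀ ^ 2 * I / lam = (c₀ * √I) ^ 2 / lam := by
      rw [mul_pow, Real.sq_sqrt (by linarith)]
    have e4 : lam * Y = (lam * √Y) ^ 2 / lam := by
      rw [mul_pow, Real.sq_sqrt (by positivity)]; field_simp
    rw [e3, e4, ← add_div, le_div_iff₀ hlam]
    rw [e2] at e1
    nlinarith [sq_nonneg (lam * √Y - c₀ * √I), mul_le_mul_of_nonneg_left e1
      (show 0 ≤ 2 * c₀ * lam by positivity)]
  have h2 : √(8 * I / Y) ≤ √(8 * I) := by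
    apply Real.sqrt_le_sqrt
    exact div_le_self (by linarith) hY'
  unfold threshold
  linarith

end Large

end Numbers

/-- A path of `T` rounds on which the agent's behaviour and all estimators are typical. -/
structure GoodPath (K T : ℕ) (c₀ δ : ℝ) (θ μ : Fin K → ℝ) (obs : ℕ → Fin K × ℝ)
    (π : ℕ → Fin K → ℝ) (μh : Fin K → ℕ → ℝ) (Ex : ℕ → Prop) : Prop where
  best : PlaysBest T obs π μh Ex
  mem_Icc : ∀ k < T, ∀ b, μh b k ∈ Set.Icc (0 : ℝ) 1
  agent : ∀ k < T, ∀ b, 1 ≤ (Tally.ofPath obs k).count b →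
    |μh b k - μ b| ≤ √(3 / 4 * confLog K T δ / (Tally.ofPath obs k).count b)
  principal : ∀ k < T, ∀ b, 1 ≤ (Tally.ofPath obs k).count b →
    |(Tally.ofPath obs k).mean b - θ b| ≤ √(3 / 4 * confLog K T δ / (Tally.ofPath obs k).count b)
  half : ∀ t Y : ℕ, phaseLength K T c₀ δ 1 ≤ t → 8 * Real.log T ≤ Y → t + Y ≤ T →
    2 * exCount T Ex t (t + Y) < Y
  -- No condition at the horizon is needed, since `exCount` ignores the steps from `T` on.
  window : ∀ t : ℕ, phaseLength K T c₀ δ 1 ≤ t →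
    exCount T Ex t (t + searchCalls T δ * searchRounds T) < searchCalls T δ
  test : ∀ t Y : ℕ, 2 * Real.log T ≤ t →
    (Y : ℝ) ≤ testConst c₀ * Real.log (iota K T δ) ^ 2 * t → t + Y ≤ T →
    (exCount T Ex t (t + Y) : ℝ) ≤ threshold K T c₀ δ Y

/-! ### Accuracy of the means from the numbers of plays. -/

section Path

variable {K T : ℕ} {c₀ δ : ℝ} {θ μ : Fin K → ℝ} {obs : ℕ → Fin K × ℝ}
    {π : ℕ → Fin K → ℝ} {μh : Fin K → ℕ → ℝ} {Ex : ℕ → Prop} {m : ℕ} {act : Finset (Fin K)}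

theorem ratio_pos (h : Large K T c₀ δ) (hact : act.Nonempty) : 0 < ratio K T c₀ δ m act := by
  unfold ratio
  have := hact.card_pos
  have h1 := h.one_le (m - 1)
  positivity

theorem sqrt_le_eps (h : Large K T c₀ δ) (hact : act.Nonempty) :
    √(confLog K T δ / phaseLength K T c₀ δ (m - 1)) ≤ eps K T c₀ δ m act := by
  have h1 : 0 ≤ confLog K T δ := by linarith [h.one_le_confLog]
  unfold confLog at h1 ⊢
  have h2 := (ratio_pos (m := m) h hact).le
  unfold eps
  have : 0 ≤ (Real.log (16 * K * T / δ) * ratio K T c₀ δ m act) ^ (1 / 3 : ℝ) := by positivity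
  linarith

theorem rpow_le_eps : (confLog K T δ * ratio K T c₀ δ m act) ^ (1 / 3 : ℝ) ≤
    eps K T c₀ δ m act := by
  unfold eps confLog
  linarith [Real.sqrt_nonneg (Real.log (16 * K * T / δ) / phaseLength K T c₀ δ (m - 1))]

/-- The number of stabilizing rounds is at least `2 L^{1/3} ρ^{-2/3}`. -/
theorem le_stabilizeRounds (h : Large K T c₀ δ) (hact : act.Nonempty) :
    2 * confLog K T δ ^ (1 / 3 : ℝ) * (1 / ratio K T c₀ δ m act) ^ (2 / 3 : ℝ) ≤
      stabilizeRounds K T c₀ δ m act := by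
  refine le_trans (le_of_eq ?_) (Nat.le_ceil _)
  unfold ratio confLog
  congr 2
  have := hact.card_pos
  have h1 := h.one_le (m - 1)
  field_simp

/-- With `N` plays the error is at most `√(L / N)`, where `L` is `confLog`. For active arms `N ≥
T_{m-1}` yields the square root in `eps`. For bad arms half of the stabilizing rounds, `N ≥ L^{1/3}
ρ^{-2/3}`, yields `L / N ≤ (L ρ)^{2/3}`, hence the cube root. -/
theorem accurate_of_counts (h : Large K T c₀ δ) (hg : GoodPath K T c₀ δ θ μ obs π μh Ex)
    (hact : act.Nonempty) {t : ℕ}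
    (hA : ∀ b ∈ act, phaseLength K T c₀ δ (m - 1) ≤ (Tally.ofPath obs t).count b)
    (hB : ∀ b ∉ act, stabilizeRounds K T c₀ δ m act ≤ 2 * (Tally.ofPath obs t).count b) :
    AccurateFrom T μ μh (eps K T c₀ δ m act) t := by
  have hL := h.one_le_confLog
  have hρ := ratio_pos (m := m) h hact
  have hTm := h.one_le (m - 1)
  intro k hk hkT b
  have hmono : (Tally.ofPath obs t).count b ≤ (Tally.ofPath obs k).count b :=
    Tally.ofPath_count_mono obs b hk
  by_cases hb : b ∈ act
  · have h1 := hA b hb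
    have h2 : phaseLength K T c₀ δ (m - 1) ≤ (Tally.ofPath obs k).count b :=
      h1.trans (by exact_mod_cast hmono)
    have h3 : 1 ≤ (Tally.ofPath obs k).count b := by
      have : (1 : ℝ) ≤ (Tally.ofPath obs k).count b := hTm.trans h2
      exact_mod_cast this
    refine (hg.agent k hkT b h3).trans (le_trans (Real.sqrt_le_sqrt ?_) (sqrt_le_eps h hact))
    gcongr
    linarith
  · have h1 := le_stabilizeRounds (m := m) h hact
    have h2 : (stabilizeRounds K T c₀ δ m act : ℝ) ≤ 2 * (Tally.ofPath obs k).count b := by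
      exact_mod_cast (hB b hb).trans (Nat.mul_le_mul_left 2 hmono)
    set N : ℝ := (((Tally.ofPath obs k).count b : ℕ) : ℝ) with hN
    set ρ := ratio K T c₀ δ m act with hρdef
    set L := confLog K T δ with hLdef
    have h3 : L ^ (1 / 3 : ℝ) * (1 / ρ) ^ (2 / 3 : ℝ) ≤ N := by linarith
    have hpos : 0 < L ^ (1 / 3 : ℝ) * (1 / ρ) ^ (2 / 3 : ℝ) := by positivity
    have hNpos : 0 < N := hpos.trans_le h3
    have h4 : 1 ≤ (Tally.ofPath obs k).count b := by
      have : (0 : ℝ) < (Tally.ofPath obs k).count b := hNpos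
      exact_mod_cast this
    refine (hg.agent k hkT b h4).trans (le_trans ?_ rpow_le_eps)
    rw [← hN, ← hLdef, ← hρdef]
    apply Real.sqrt_le_iff.2
    refine ⟨by positivity, ?_⟩
    rw [div_le_iff₀ hNpos, ← Real.rpow_natCast, ← Real.rpow_mul (by positivity)]
    have e1 : (L * ρ) ^ (1 / 3 * ((2 : ℕ) : ℝ)) * (L ^ (1 / 3 : ℝ) * (1 / ρ) ^ (2 / 3 : ℝ)) = L := by
      rw [Real.mul_rpow (by linarith) hρ.le, one_div ρ, Real.inv_rpow hρ.le]
      have : (1 / 3 * ((2 : ℕ) : ℝ)) = (2 / 3 : ℝ) := by norm_num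
      rw [this]
      have e2 : ρ ^ (2 / 3 : ℝ) ≠ 0 := (Real.rpow_pos_of_pos hρ _).ne'
      field_simp
      rw [← Real.rpow_add (by linarith)]
      norm_num
    calc 3 / 4 * L ≤ L := by linarith
      _ = _ := e1.symm
      _ ≤ _ := by gcongr

/-- This bounds what a search adds after a refused check. Since `L ≥ 1`, bad arms have at least
`ρ^{-2/3}` plays. -/
theorem tally_terms_le (h : Large K T c₀ δ) (hact : act.Nonempty) {t k : ℕ} (hk : t ≤ k)
    (hA : ∀ b ∈ act, phaseLength K T c₀ δ (m - 1) ≤ (Tally.ofPath obs t).count b)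
    (hB : ∀ b ∉ act, stabilizeRounds K T c₀ δ m act ≤ 2 * (Tally.ofPath obs t).count b)
    {a : Fin K} (ha : a ∈ act) :
    1 / ((max 1 ((Tally.ofPath obs k).count a) : ℕ) : ℝ) +
      2 / ((max 1 (⨅ i, (Tally.ofPath obs k).count i) : ℕ) : ℝ) ≤
    3 / phaseLength K T c₀ δ (m - 1) + 2 * ratio K T c₀ δ m act ^ (2 / 3 : ℝ) := by
  have hL := h.one_le_confLog
  have hρ := ratio_pos (m := m) h hact
  have hTm := h.one_le (m - 1)
  have hmono : ∀ b, (Tally.ofPath obs t).count b ≤ (Tally.ofPath obs k).count b := fun b =>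
    Tally.ofPath_count_mono obs b hk
  have hone : ∀ b ∈ act, phaseLength K T c₀ δ (m - 1) ≤
      ((max 1 ((Tally.ofPath obs k).count b) : ℕ) : ℝ) := fun b hb =>
    (hA b hb).trans (by exact_mod_cast (hmono b).trans (le_max_right _ _))
  have h1 : 1 / ((max 1 ((Tally.ofPath obs k).count a) : ℕ) : ℝ) ≤
      1 / phaseLength K T c₀ δ (m - 1) :=
    one_div_le_one_div_of_le (by linarith) (hone a ha)
  have hρ' : 0 < ratio K T c₀ δ m act ^ (2 / 3 : ℝ) := by positivity
  have h2 : 2 / ((max 1 (⨅ i, (Tally.ofPath obs k).count i) : ℕ) : ℝ) ≤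
      2 / phaseLength K T c₀ δ (m - 1) + 2 * ratio K T c₀ δ m act ^ (2 / 3 : ℝ) := by
    have : Nonempty (Fin K) := ⟨a⟩
    obtain ⟨i, hi⟩ := exists_eq_ciInf_of_finite (f := fun i => (Tally.ofPath obs k).count i)
    rw [← hi]
    by_cases hb : i ∈ act
    · have : 2 / ((max 1 ((Tally.ofPath obs k).count i) : ℕ) : ℝ) ≤
          2 / phaseLength K T c₀ δ (m - 1) :=
        div_le_div_of_nonneg_left (by norm_num) (by linarith) (hone i hb)
      linarith
    · have g1 := le_stabilizeRounds (m := m) h hact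
      have g2 : (stabilizeRounds K T c₀ δ m act : ℝ) ≤ 2 * (Tally.ofPath obs k).count i := by
        exact_mod_cast (hB i hb).trans (Nat.mul_le_mul_left 2 (hmono i))
      have g3 : (1 : ℝ) ≤ confLog K T δ ^ (1 / 3 : ℝ) := Real.one_le_rpow hL (by norm_num)
      have g4 : (1 / ratio K T c₀ δ m act) ^ (2 / 3 : ℝ) ≤
          ((max 1 ((Tally.ofPath obs k).count i) : ℕ) : ℝ) := by
        have g5 : (0 : ℝ) < (1 / ratio K T c₀ δ m act) ^ (2 / 3 : ℝ) := by positivity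
        have g6 : ((Tally.ofPath obs k).count i : ℝ) ≤
            ((max 1 ((Tally.ofPath obs k).count i) : ℕ) : ℝ) := by
          exact_mod_cast le_max_right _ _
        nlinarith
      have g7 : 2 / ((max 1 ((Tally.ofPath obs k).count i) : ℕ) : ℝ) ≤
          2 / (1 / ratio K T c₀ δ m act) ^ (2 / 3 : ℝ) :=
        div_le_div_of_nonneg_left (by norm_num) (by positivity) g4
      have g8 : 2 / (1 / ratio K T c₀ δ m act) ^ (2 / 3 : ℝ) =
          2 * ratio K T c₀ δ m act ^ (2 / 3 : ℝ) := by
        rw [one_div, Real.inv_rpow hρ.le, div_inv_eq_mul]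
      have : 0 ≤ 2 / phaseLength K T c₀ δ (m - 1) := by positivity
      linarith
  have : 3 / phaseLength K T c₀ δ (m - 1) = 1 / phaseLength K T c₀ δ (m - 1) +
      2 / phaseLength K T c₀ δ (m - 1) := by ring
  linarith

end Path

end Exploratory

/-! ### One phase along a good path -/

namespace Exploratory

open Principal

section Path

variable {K T : ℕ} {c₀ δ B : ℝ} {θ μ : Fin K → ℝ} {obs : ℕ → Fin K × ℝ}
    {π : ℕ → Fin K → ℝ} {μh : Fin K → ℕ → ℝ} {Ex : ℕ → Prop} {m : ℕ} {act : Finset (Fin K)}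
    {s z : Fin K}

/-- What is added to the incentives found by the searches. -/
noncomputable def slack (K T : ℕ) (c₀ δ : ℝ) (m : ℕ) (act : Finset (Fin K)) : ℝ :=
  ratio K T c₀ δ m act ^ (2 / 3 : ℝ) + 1 / phaseLength K T c₀ δ (m - 1) + 4 * eps K T c₀ δ m act

theorem enlarge_eq (b : ℝ) :
    enlarge K T c₀ δ m act b = min (1 + 1 / (T : ℝ)) (b + slack K T c₀ δ m act) := by
  unfold enlarge slack
  congr 1
  ring

theorem enlarge_mono : Monotone (enlarge K T c₀ δ m act) := fun x y h => by
  rw [enlarge_eq, enlarge_eq]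
  exact min_le_min le_rfl (by linarith)

/-- An output may be too low by `2 * eps`, and `covers_of_accurate` asks for an excess of `2 * eps`;
adding more than `4 * eps` bridges both. -/
theorem slack_ge (h : Large K T c₀ δ) (hact : act.Nonempty) :
    4 * eps K T c₀ δ m act < slack K T c₀ δ m act := by
  have := ratio_pos (m := m) h hact
  have h1 := h.one_le (m - 1)
  unfold slack
  have : 0 < 1 / phaseLength K T c₀ δ (m - 1) := by positivity
  have : 0 ≤ ratio K T c₀ δ m act ^ (2 / 3 : ℝ) := by positivity
  linarith

theorem ratio_nonneg (h : Large K T c₀ δ) : 0 ≤ ratio K T c₀ δ m act := by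
  unfold ratio
  have h1 := h.one_le (m - 1)
  positivity

theorem eps_nonneg (h : Large K T c₀ δ) : 0 ≤ eps K T c₀ δ m act := by
  have h1 := ratio_nonneg (m := m) (act := act) h
  have h2 : 0 ≤ Real.log (16 * K * T / δ) := zero_le_one.trans h.one_le_confLog
  unfold eps
  positivity

/-- An upper bound for the incentives up to which arm `a` is tested. -/
noncomputable def testCap (K T : ℕ) (c₀ δ : ℝ) (need : ℝ) (m : ℕ) (act : Finset (Fin K)) : ℝ :=
  if m = 1 then 1 + 1 / T
  else need + 2 * eps K T c₀ δ m act + 3 / T +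
    (3 / phaseLength K T c₀ δ (m - 1) + 2 * ratio K T c₀ δ m act ^ (2 / 3 : ℝ)) +
    slack K T c₀ δ m act

/-- The state of a run at the start of phase `m`. -/
structure PhaseInv (K T : ℕ) (c₀ δ : ℝ) (θ μ : Fin K → ℝ) (obs : ℕ → Fin K × ℝ) (s : Fin K) (m : ℕ)
    (act : Finset (Fin K)) (t : ℕ) : Prop where
  best_mem : s ∈ act
  first : m = 1 → act = Finset.univ
  counts : 2 ≤ m → ∀ a ∈ act, phaseLength K T c₀ δ (m - 1) ≤ (Tally.ofPath obs t).count a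
  gaps : 2 ≤ m → ∀ a ∈ act, θ s + μ s - (θ a + μ a) ≤
    10 * √(confLog K T δ / (2 * phaseLength K T c₀ δ (m - 1)))

theorem count_le (obs : ℕ → Fin K × ℝ) (t : ℕ) (b : Fin K) : (Tally.ofPath obs t).count b ≤ t := by
  rw [Tally.ofPath_count_eq]
  exact (Finset.card_filter_le _ _).trans (by simp)

theorem PhaseInv.first_le {t : ℕ} (h : Large K T c₀ δ) (hinv : PhaseInv K T c₀ δ θ μ obs s m act t)
    (hm : 2 ≤ m) : phaseLength K T c₀ δ (m - 1) ≤ t ∧ phaseLength K T c₀ δ 1 ≤ t := by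
  have h1 := hinv.counts hm s hinv.best_mem
  have h2 : ((Tally.ofPath obs t).count s : ℝ) ≤ t := by exact_mod_cast count_le obs t s
  exact ⟨h1.trans h2, (h.first_le (by omega)).trans (h1.trans h2)⟩

/-- The searches of a phase. -/
theorem Wp_searchAll (h : Large K T c₀ δ) (hg : GoodPath K T c₀ δ θ μ obs π μh Ex)
    (hμ : ∀ b, μ b ∈ Set.Icc (0 : ℝ) 1) (hM : ∀ b, μ b ≤ μ z) (hm : 1 ≤ m) (t : ℕ)
    (hacc : 2 ≤ m → t ≤ T → phaseLength K T c₀ δ 1 ≤ t ∧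
      (∀ b ∈ act, phaseLength K T c₀ δ (m - 1) ≤ (Tally.ofPath obs t).count b) ∧
      ∀ b ∉ act, stabilizeRounds K T c₀ δ m act ≤ 2 * (Tally.ofPath obs t).count b) :
    Wp obs π (forEach (fun a => do
        let bs ← times (searchCalls T δ) (search T a)
        pure (a, (bs.insertionSort (· ≤ ·)).map (enlarge K T c₀ δ m act)))
      (act.sort (· ≤ ·))) t (fun found t' =>
        found.length = act.card ∧
        t + act.card * searchCalls T δ ≤ t' ∧
        t' ≤ t + act.card * (searchCalls T δ * searchRounds T) ∧
        OneHotDuring π 1 t t' ∧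
        (∀ a ∈ act, ∃ p ∈ found, p.1 = a) ∧
        ∀ p ∈ found, p.1 ∈ act ∧ GoodList T obs π Ex (searchCalls T δ)
          (testCap K T c₀ δ (μ z - μ p.1) m act) p.1 p.2 t') := by
  refine (Wp_forEach (I := fun done t' =>
    t + done.length * searchCalls T δ ≤ t' ∧
    t' ≤ t + done.length * (searchCalls T δ * searchRounds T) ∧ OneHotDuring π 1 t t' ∧
    ∀ p ∈ done, p.2.1 = p.1 ∧ GoodList T obs π Ex (searchCalls T δ)
      (testCap K T c₀ δ (μ z - μ p.1) m act) p.1 p.2.2 t') _ ?_ ?_).mono ?_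
  · exact ⟨by simp, by simp, fun k h1 h2 => by omega, by simp⟩
  · rintro a ha done t1 ⟨h1, h2, h3, h4⟩
    have ha : a ∈ act := by simpa using ha
    have hact : act.Nonempty := ⟨a, ha⟩
    have hT : 1 ≤ T := by have := h.two_le_T; omega
    have hTinv : (0 : ℝ) < 1 / T := by have : (0 : ℝ) < T := by exact_mod_cast hT
                                       positivity
    have hε := eps_nonneg (m := m) (act := act) h
    have hsl := slack_ge (m := m) h hact
    refine (Wp_searches (ε := eps K T c₀ δ m act)
      (e := 3 / phaseLength K T c₀ δ (m - 1) + 2 * ratio K T c₀ δ m act ^ (2 / 3 : ℝ))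
      (U := testCap K T c₀ δ (μ z - μ a) m act)
      hT hg.best hg.mem_Icc hμ hM rfl a h.calls_pos enlarge_mono ?_ ?_).mono ?_
    · intro b hb
      rw [enlarge_eq]
      exact ⟨le_min (by linarith) (by linarith), min_le_left _ _⟩
    · rcases Nat.eq_or_lt_of_le hm with hm1 | hm2
      -- In phase one `T_0 = 1` forces `eps ≥ 1`, so every enlargement hits the cap `1 + 1 / T`.
      · left
        intro b hb
        have h8 : 1 ≤ eps K T c₀ δ m act := by
          refine le_trans ?_ (sqrt_le_eps h hact)
          rw [← hm1, Nat.sub_self, phaseLength_zero, div_one]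
          exact Real.one_le_sqrt.2 h.one_le_confLog
        have h9 : (1 : ℝ) / T ≤ 1 := by
          rw [div_le_one (by exact_mod_cast hT)]; exact_mod_cast hT
        have h10 : enlarge K T c₀ δ m act b = 1 + 1 / T := by
          rw [enlarge_eq]
          exact min_eq_left (by linarith)
        rw [h10, testCap, if_pos hm1.symm]
        exact ⟨by linarith, le_rfl⟩
      · right
        refine ⟨hε, ?_, ?_, ?_, ?_⟩
        · intro k hk hkT
          obtain ⟨-, g1, g2⟩ := hacc hm2 (by omega)
          exact accurate_of_counts h hg hact g1 g2 k (by omega) hkT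
        · intro k hk hkT
          obtain ⟨-, g1, g2⟩ := hacc hm2 (by omega)
          exact tally_terms_le h hact (by omega) g1 g2 ha
        · rcases lt_or_ge T t1 with h5 | h5
          · have : exCount T Ex t1 (t1 + searchCalls T δ * searchRounds T) = 0 := by
              classical
              unfold exCount
              rw [Finset.card_eq_zero, Finset.filter_eq_empty_iff]
              intro k hk
              have := Finset.mem_Ico.1 hk
              omega
            rw [this]
            exact h.calls_pos
          · obtain ⟨g0, -, -⟩ := hacc hm2 (by omega)
            exact hg.window t1 (g0.trans (by exact_mod_cast (by omega : t ≤ t1)))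
        · intro b hb1 hb2
          rw [enlarge_eq, testCap, if_neg (by omega)]
          refine ⟨?_, (min_le_right _ _).trans (by linarith)⟩
          -- If the cap is attained, the incentive covers because it exceeds one, otherwise because
          -- of the slack.
          rcases min_choice (1 + 1 / (T : ℝ)) (b + slack K T c₀ δ m act) with h6 | h6
          · right; rw [h6]; linarith
          · left; rw [h6]; linarith
    · rintro ⟨a', l⟩ t' - ⟨g1, g2, g3, g4, g5⟩
      simp only [List.length_append, List.length_singleton] at *
      refine ⟨by rw [add_mul]; omega, by rw [add_mul]; omega, h3.trans g4, ?_⟩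
      intro p hp
      rcases List.mem_append.1 hp with hp | hp
      · exact ⟨(h4 p hp).1, (h4 p hp).2.mono (by omega)⟩
      · rw [List.mem_singleton.1 hp]
        exact ⟨g1, g5⟩
  · rintro found t' - ⟨h0, h1, h2, h3, h4⟩
    rw [Finset.length_sort] at h0
    have hz : ((act.sort (· ≤ ·)).zip found).length = act.card := by simp [h0]
    rw [hz] at h1 h2
    refine ⟨h0, h1, h2, h3, ?_, ?_⟩
    · intro a ha
      have : a ∈ ((act.sort (· ≤ ·)).zip found).map Prod.fst := by
        rw [List.map_fst_zip (by simp [h0])]; simpa using ha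
      obtain ⟨p, hp, rfl⟩ := List.mem_map.1 this
      exact ⟨p.2, (List.of_mem_zip (show (p.1, p.2) ∈ _ from hp)).2, (h4 p hp).1⟩
    · intro q hq
      have : q ∈ ((act.sort (· ≤ ·)).zip found).map Prod.snd := by
        rw [List.map_snd_zip (by simp [h0])]; exact hq
      obtain ⟨p, hp, rfl⟩ := List.mem_map.1 this
      have hp1 := (List.of_mem_zip (show (p.1, p.2) ∈ _ from hp)).1
      rw [(h4 p hp).1]
      exact ⟨by simpa using hp1, (h4 p hp).2⟩

/-- A bound for the cost of testing one arm, if `e` bounds the regret of a play of this arm. -/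
noncomputable def testCost (K T : ℕ) (c₀ δ : ℝ) (m : ℕ) (e : ℝ) : ℝ :=
  -- With this weight the misses over about `T_m` rounds and the additive term `d` of each test are
  -- both of order `√T_m` up to logarithms.
  let lam := Real.log (iota K T δ) / √(phaseLength K T c₀ δ m)
  let d := c₀ ^ 2 * Real.log (iota K T δ) / lam + √(8 * Real.log (iota K T δ))
  (e + 3 * lam) * (searchCalls T δ * (halfLength K T c₀ δ + 3) +
    2 * (3 * phaseLength K T c₀ δ m + 1)) + searchCalls T δ * (3 * (d + 1))

theorem halfLength_nonneg (h : Large K T c₀ δ) : 0 ≤ halfLength K T c₀ δ := by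
  unfold halfLength
  have := h.one_le_log_iota
  positivity

/-- The tests of a phase. -/
theorem Wp_testFound (h : Large K T c₀ δ) (hg : GoodPath K T c₀ δ θ μ obs π μh Ex)
    (hB : B ≤ 1) (hθ : ∀ a, 0 ≤ θ a) (hm : 1 ≤ m) {e : ℝ} (he : 0 ≤ e) (t : ℕ)
    (found : List (Fin K × List ℝ)) (U : Fin K → ℝ)
    (hUe : t ≤ T → ∀ p ∈ found, B - θ p.1 + U p.1 ≤ e)
    (hfound : ∀ p ∈ found, GoodList T obs π Ex (searchCalls T δ) (U p.1) p.1 p.2 t)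
    (hlogt : t ≤ T → 2 * Real.log T ≤ t)
    (ht : t ≤ T → 2 * phaseLength K T c₀ δ m + 1 ≤
      testConst c₀ * Real.log (iota K T δ) ^ 2 * t) :
    Wp obs π (forEach (fun ab : Fin K × List ℝ => testAll T c₀ δ m ab.1 ab.2 0) found) t
      (fun _ t' => t ≤ t' ∧ cost T θ B obs π t t' ≤ found.length * testCost K T c₀ δ m e ∧
        (t' ≤ T → ∀ p ∈ found, phaseLength K T c₀ δ m ≤ (Tally.ofPath obs t').count p.1)) := by
  have hpl := h.one_le m
  have hI := h.one_le_log_iota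
  refine (Wp_forEach (I := fun done t' => t ≤ t' ∧
    cost T θ B obs π t t' ≤ done.length * testCost K T c₀ δ m e ∧
    (t' ≤ T → ∀ q ∈ done, phaseLength K T c₀ δ m ≤ (Tally.ofPath obs t').count q.1.1)) _
    ?_ ?_).mono ?_
  · exact ⟨le_rfl, by simp [cost], by simp⟩
  · rintro p hp done t1 ⟨h1, h2, h3⟩
    have hgl := (hfound p hp).mono h1
    set lam := Real.log (iota K T δ) / √(phaseLength K T c₀ δ m) with hlam
    have hlampos : 0 < lam := by positivity
    set d := c₀ ^ 2 * Real.log (iota K T δ) / lam + √(8 * Real.log (iota K T δ)) with hd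
    have hdpos : 0 ≤ d := by positivity
    refine (Wp_testAll (T := T) (B := B) (m := m) (c₀ := c₀) (δ := δ) (t₀ := t1) (lam := lam) (d := d)
      (U := U p.1) (e := e) (Y₀ := halfLength K T c₀ δ) hB hθ (by have := h.two_le_T; omega)
      (halfLength_nonneg h)
      hlampos.le hdpos (fun Y hY => h.threshold_le_half hY)
      (fun Y hY => h.threshold_le_linear hlampos hY)
      (by linarith [h.halfLength_le, h.first_le hm]) (by linarith) ?_ he
      (fun h' => hUe (by omega) p hp) p.2 hgl.sorted hgl.mem_Icc 0 le_rfl (by linarith) t1 le_rfl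
      hgl.covers).mono ?_
    · intro t2 ht2 Y hY hYT
      have htt2 : (t : ℝ) ≤ t2 := by exact_mod_cast h1.trans ht2
      refine hg.test t2 Y ((hlogt (by omega)).trans htt2) ?_ hYT
      refine hY.le.trans ((ht (by omega)).trans (mul_le_mul_of_nonneg_left htt2 ?_))
      have := h.c₀_pos
      unfold testConst
      positivity
    · rintro _ t' - ⟨g1, g2, g3, g4, g5, g6⟩
      rw [hgl.length] at g3 g6
      refine ⟨h1.trans g1, ?_, ?_⟩
      · rw [← cost_add h1 g1, List.length_append, List.length_singleton]
        push_cast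
        have e1 : (t' : ℝ) - t1 ≤ searchCalls T δ * (halfLength K T c₀ δ + 3) +
            2 * (3 * phaseLength K T c₀ δ m + 1) := by linarith
        have e2 : (e + 3 * lam) * ((t' : ℝ) - t1) ≤ (e + 3 * lam) *
            (searchCalls T δ * (halfLength K T c₀ δ + 3) +
              2 * (3 * phaseLength K T c₀ δ m + 1)) :=
          mul_le_mul_of_nonneg_left e1 (by positivity)
        have e3 : testCost K T c₀ δ m e = (e + 3 * lam) *
          (searchCalls T δ * (halfLength K T c₀ δ + 3) +
            2 * (3 * phaseLength K T c₀ δ m + 1)) + searchCalls T δ * (3 * (d + 1)) := rfl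
        linarith
      · intro htT q hq
        rcases List.mem_append.1 hq with hq | hq
        · refine (h3 (by omega) q hq).trans ?_
          exact_mod_cast Tally.ofPath_count_mono obs q.1.1 g1
        · rw [List.mem_singleton.1 hq]
          have := g5 htT
          have h6 : (0 : ℝ) ≤ (Tally.ofPath obs t1).count p.1 := by positivity
          linarith
  · rintro xs t' - ⟨h0, h1, h2, h3⟩
    have hz : (found.zip xs).length = found.length := by simp [h0]
    rw [hz] at h2
    refine ⟨h1, h2, fun htT p hp => ?_⟩
    have : p ∈ (found.zip xs).map Prod.fst := by
      rw [List.map_fst_zip (by simp [h0])]; exact hp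
    obtain ⟨q, hq, rfl⟩ := List.mem_map.1 this
    exact h3 htT q hq

/-- This is `12 < 25 / 2`. The factor `3 / 4` in the radii is small enough for this and large enough
for the union bound in `Scales.four_mul_exp_le`. -/
theorem confidence_radius_lt (h : Large K T c₀ δ) :
    4 * √(3 / 4 * confLog K T δ / phaseLength K T c₀ δ m) <
      5 * √(Real.log (16 * K * T / δ) / (2 * phaseLength K T c₀ δ m)) := by
  have h1 := h.one_le m
  have h2 := h.one_le_confLog
  have e1 : 4 * √(3 / 4 * confLog K T δ / phaseLength K T c₀ δ m) =
      √(12 * (confLog K T δ / phaseLength K T c₀ δ m)) := by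
    rw [show (4 : ℝ) = √16 by rw [show (16 : ℝ) = 4 ^ 2 by norm_num]; simp,
      ← Real.sqrt_mul (by norm_num)]
    congr 1
    rw [show √(16 : ℝ) = 4 by rw [show (16 : ℝ) = 4 ^ 2 by norm_num]; simp]
    ring
  have e2 : 5 * √(Real.log (16 * K * T / δ) / (2 * phaseLength K T c₀ δ m)) =
      √(25 / 2 * (confLog K T δ / phaseLength K T c₀ δ m)) := by
    rw [show (5 : ℝ) = √25 by rw [show (25 : ℝ) = 5 ^ 2 by norm_num]; simp,
      ← Real.sqrt_mul (by norm_num), confLog]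
    congr 1
    field_simp
  rw [e1, e2]
  apply Real.sqrt_lt_sqrt (by positivity)
  have : 0 < confLog K T δ / phaseLength K T c₀ δ m := by positivity
  linarith

theorem sum_compareIncentive_le {S : Tally K} (h : Large K T c₀ δ) (hm : 1 ≤ m)
    (hS : ∀ b ∈ act, S.mean b ≤ 2) {a : Fin K} (ha : a ∈ act) :
    ∑ b, compareIncentive T c₀ δ m act S a b ≤ 10 * K := by
  have h1 := h.one_le m
  have h2 : √(Real.log (16 * K * T / δ) / (2 * phaseLength K T c₀ δ m)) ≤ 1 := by
    apply Real.sqrt_le_one.2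
    rw [div_le_one (by positivity)]
    have := h.confLog_le.trans (h.first_le hm)
    unfold confLog at this
    linarith
  -- Each coordinate is at most `1 + 2 + 5`.
  refine (Finset.sum_le_card_nsmul _ _ 10 fun b _ => ?_).trans (by simp [mul_comm])
  unfold compareIncentive
  split_ifs with hb hb'
  · linarith [hS a ha]
  · linarith [hS b hb']
  · norm_num

/-- The comparisons of a phase. -/
theorem Wp_keepAll (h : Large K T c₀ δ) (hg : GoodPath K T c₀ δ θ μ obs π μh Ex)
    (hB : B ≤ 1) (hθ : ∀ a, θ a ∈ Set.Icc (0 : ℝ) 1)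
    (hV : ∀ b, θ b + μ b ≤ θ s + μ s) (hm : 1 ≤ m) (t : ℕ)
    (hs : t ≤ T → s ∈ act)
    (hcount : t ≤ T → ∀ a ∈ act, phaseLength K T c₀ δ m ≤ (Tally.ofPath obs t).count a) :
    Wp obs π (forEach (fun a => do
        let k ← keepArm T c₀ δ m act a
        pure (a, k))
      (act.sort (· ≤ ·))) t (fun kept t' => t ≤ t' ∧
        cost T θ B obs π t t' ≤ act.card * ((1 + 10 * K) * keepRounds K T δ) ∧
        (t' ≤ T → (s, true) ∈ kept ∧ ∀ a, (a, true) ∈ kept →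
          θ s + μ s - (θ a + μ a) ≤ 10 * √(confLog K T δ / (2 * phaseLength K T c₀ δ m)))) := by
  have hpl := h.one_le m
  refine (Wp_forEach (I := fun done t' => t ≤ t' ∧
    cost T θ B obs π t t' ≤ done.length * ((1 + 10 * K) * keepRounds K T δ) ∧
    ∀ q ∈ done, q.2.1 = q.1 ∧ (t' ≤ T → (q.1 = s → q.2.2 = true) ∧
      (q.2.2 = true → θ s + μ s - (θ q.1 + μ q.1) ≤
        10 * √(confLog K T δ / (2 * phaseLength K T c₀ δ m))))) _ ?_ ?_).mono ?_
  · exact ⟨le_rfl, by simp [cost], by simp⟩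
  · rintro a ha done t1 ⟨h1, h2, h3⟩
    have ha : a ∈ act := by simpa using ha
    refine Wp_bind ((Wp_keepArm act a t1).mono ?_)
    rintro kept t' - ⟨g1, g2, g3, g4⟩
    set w := √(3 / 4 * confLog K T δ / phaseLength K T c₀ δ m) with hw
    have hw0 : 0 ≤ w := Real.sqrt_nonneg _
    have hw4 := confidence_radius_lt (m := m) h
    have hnum : 1 ≤ keepRounds K T δ := by unfold keepRounds; omega
    have hradius : ∀ k, t1 ≤ k → k ≤ T → ∀ b ∈ act, 1 ≤ (Tally.ofPath obs k).count b ∧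
        √(3 / 4 * confLog K T δ / (Tally.ofPath obs k).count b) ≤ w := by
      intro k hk hkT b hb
      have k1 := hcount (by omega) b hb
      have k2 : phaseLength K T c₀ δ m ≤ (Tally.ofPath obs k).count b :=
        k1.trans (by exact_mod_cast Tally.ofPath_count_mono obs b (h1.trans hk))
      refine ⟨by exact_mod_cast (hpl.trans k2), Real.sqrt_le_sqrt ?_⟩
      have := h.one_le_confLog
      gcongr
    have hprinc : t1 < T → ∀ b ∈ act, |(Tally.ofPath obs t1).mean b - θ b| ≤ w :=
      fun hk b hb => (hg.principal t1 hk b (hradius t1 le_rfl hk.le b hb).1).trans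
        (hradius t1 le_rfl hk.le b hb).2
    have hagent : ∀ k, t1 ≤ k → k < T → ∀ b ∈ act, |μh b k - μ b| ≤ w :=
      fun k hk hkT b hb => (hg.agent k hkT b (hradius k hk hkT.le b hb).1).trans
        (hradius k hk hkT.le b hb).2
    have hw1 : w ≤ 1 := by
      apply Real.sqrt_le_one.2
      rw [div_le_one (by positivity)]
      have := h.confLog_le.trans (h.first_le hm)
      have := h.one_le_confLog
      linarith
    refine Wp_pure ⟨by omega, ?_, ?_⟩
    · rw [← cost_add h1 (show t1 ≤ t' by omega), List.length_append, List.length_singleton]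
      push_cast
      have hc : cost T θ B obs π t1 t' ≤ (1 + 10 * K) * ((t' : ℝ) - t1) := by
        refine cost_le_mul (by omega) fun k hk1 hk2 => ?_
        unfold roundCost
        split_ifs with hkT
        · refine max_le (by positivity) ?_
          have k1 := sum_compareIncentive_le (S := Tally.ofPath obs t1) h hm
            (fun b hb => by linarith [(abs_le.1 (hprinc (by omega) b hb)).2, (hθ b).2]) ha
          rw [g2 k hk1 hk2]
          linarith [(hθ (obs k).1).1]
        · positivity
      have : (t' : ℝ) - t1 = keepRounds K T δ := by rw [g1]; push_cast; ring
      rw [this] at hc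
      linarith
    · intro q hq
      rcases List.mem_append.1 hq with hq | hq
      · exact ⟨(h3 q hq).1, fun htT => (h3 q hq).2 (by omega)⟩
      · rw [List.mem_singleton.1 hq]
        refine ⟨rfl, fun htT => ?_⟩
        have hsact := hs (by omega)
        have hk1 : (t1 : ℝ) ≥ phaseLength K T c₀ δ 1 := by
          have k1 := hcount (by omega) s hsact
          have k2 : ((Tally.ofPath obs t).count s : ℝ) ≤ t1 := by
            exact_mod_cast (count_le obs t s).trans h1
          linarith [h.first_le hm]
        -- Fewer than half of the comparison rounds explore, so the median reports the best
        -- response.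
        have hhalf := hg.half t1 (keepRounds K T δ) hk1 h.keep (by omega)
        rw [← g1] at hhalf
        constructor
        · rintro rfl
          apply g3
          have := misses_le_exCount (T := T) (Ex := Ex) (obs := obs) (a := a) htT
            fun k hk1 hk2 hEx => plays_best_of_compare hg.best hg.mem_Icc (by omega) hEx
              (fun b => (hθ b).1) hw4 hw0 (hagent k hk1 (by omega)) (hprinc (by omega)) ha hV
              (g2 k hk1 hk2)
          omega
        · intro hkept
          by_contra hgap
          have hgap := not_le.1 hgap
          have := misses_ge (T := T) (Ex := Ex) (obs := obs) (a := a) (t := t1) htT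
            fun k hk1 hk2 hEx => not_plays_of_compare hg.best (by omega) hEx hw4 hw0
              (hagent k hk1 (by omega)) (hprinc (by omega)) ha hsact hgap (g2 k hk1 hk2)
          have hfalse := g4 (by omega)
          simp only at hkept
          rw [hkept] at hfalse
          exact absurd hfalse (by decide)
  · rintro kept t' - ⟨h0, h1, h2, h3⟩
    rw [Finset.length_sort] at h0
    have hz : ((act.sort (· ≤ ·)).zip kept).length = act.card := by simp [h0]
    rw [hz] at h2
    refine ⟨h1, h2, fun htT => ⟨?_, ?_⟩⟩
    · have : s ∈ ((act.sort (· ≤ ·)).zip kept).map Prod.fst := by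
        rw [List.map_fst_zip (by simp [h0])]; simpa using hs (by omega)
      obtain ⟨p, hp, hps⟩ := List.mem_map.1 this
      obtain ⟨k1, k2⟩ := h3 p hp
      have k3 := ((k2 htT).1 hps)
      have : p.2 = (s, true) := Prod.ext (k1.trans hps) k3
      rw [← this]
      exact (List.of_mem_zip (show (p.1, p.2) ∈ _ from hp)).2
    · intro a ha
      have : (a, true) ∈ ((act.sort (· ≤ ·)).zip kept).map Prod.snd := by
        rw [List.map_snd_zip (by simp [h0])]; exact ha
      obtain ⟨p, hp, hps⟩ := List.mem_map.1 this
      obtain ⟨k1, k2⟩ := h3 p hp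
      rw [hps] at k1 k2
      have := (k2 htT).2 rfl
      rwa [← k1] at this

end Path

end Exploratory

/-! ### The whole run along a good path -/

namespace Exploratory

open Principal

section Path

variable {K T : ℕ} {c₀ δ B : ℝ} {θ μ : Fin K → ℝ} {obs : ℕ → Fin K × ℝ}
    {π : ℕ → Fin K → ℝ} {μh : Fin K → ℕ → ℝ} {Ex : ℕ → Prop} {m : ℕ} {act : Finset (Fin K)}
    {s z : Fin K}

/-- A bound for the regret of a round of phase `m` in which the tested arm is played. -/
noncomputable def perPlay (K T : ℕ) (c₀ δ : ℝ) (m : ℕ) (act : Finset (Fin K)) : ℝ :=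
  if m = 1 then 3
  else 10 * √(confLog K T δ / (2 * phaseLength K T c₀ δ (m - 1))) + testCap K T c₀ δ 0 m act

/-- A bound for the regret of phase `m`. -/
noncomputable def phaseCost (K T : ℕ) (c₀ δ : ℝ) (m : ℕ) (act : Finset (Fin K)) : ℝ :=
  3 * (actᶜ.card * stabilizeRounds K T c₀ δ m act) +
    2 * (act.card * (searchCalls T δ * searchRounds T)) +
    act.card * testCost K T c₀ δ m (perPlay K T c₀ δ m act) +
    act.card * ((1 + 10 * K) * keepRounds K T δ)

theorem perPlay_nonneg (h : Large K T c₀ δ) : 0 ≤ perPlay K T c₀ δ m act := by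
  unfold perPlay testCap slack
  have h1 := ratio_nonneg (m := m) (act := act) h
  have h2 := eps_nonneg (m := m) (act := act) h
  have h3 := h.one_le (m - 1)
  split_ifs <;> positivity

/-- The need `μ z - μ a` inside the cap completes `θ s + μ s - μ z - θ a` to the gap of `a`, which
the last elimination has bounded. The rest of the cap is overpayment. -/
theorem le_perPlay (h : Large K T c₀ δ) {t : ℕ} (hm : 1 ≤ m)
    (hinv : PhaseInv K T c₀ δ θ μ obs s m act t) (hB : θ s + μ s - μ z ≤ 1) (hθ : ∀ a, 0 ≤ θ a)
    {a : Fin K} (ha : a ∈ act) :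
    θ s + μ s - μ z - θ a + testCap K T c₀ δ (μ z - μ a) m act ≤ perPlay K T c₀ δ m act := by
  rcases Nat.eq_or_lt_of_le hm with hm1 | hm2
  · rw [testCap, if_pos hm1.symm, perPlay, if_pos hm1.symm]
    have hT : 1 ≤ T := by have := h.two_le_T; omega
    have h9 : (1 : ℝ) / T ≤ 1 := by
      rw [div_le_one (by exact_mod_cast hT)]; exact_mod_cast hT
    linarith [hθ a]
  · have hne : m ≠ 1 := by omega
    have := hinv.gaps hm2 a ha
    rw [perPlay, if_neg hne]
    simp only [testCap, if_neg hne]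
    linarith

theorem first_div_le (h : Large K T c₀ δ) (hact : act.Nonempty) (hm : 2 ≤ m) :
    phaseLength K T c₀ δ 1 / K ≤ 1 / ratio K T c₀ δ m act := by
  have h1 := h.one_le (m - 1)
  have h2 : (1 : ℝ) ≤ act.card := by exact_mod_cast hact.card_pos
  have h3 : ((max 1 (actᶜ.card) : ℕ) : ℝ) ≤ K := by
    have := h.one_le_K
    have := Finset.card_le_univ actᶜ
    rw [Fintype.card_fin] at this
    exact_mod_cast max_le h.one_le_K this
  have h4 : (1 : ℝ) ≤ ((max 1 (actᶜ.card) : ℕ) : ℝ) := by exact_mod_cast le_max_left _ _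
  unfold ratio
  rw [one_div_div]
  have h5 := h.first_le (show 1 ≤ m - 1 by omega)
  have h6 := h.one_le 1
  refine div_le_div₀ (by positivity) ?_ (by positivity) h3
  nlinarith

/-- The tests provide the plays and the comparisons provide the surviving best arm and the gaps that
the next phase needs. All of this is conditional on the time being at most `T`: beyond the horizon
the path is arbitrary, but it costs nothing there. -/
theorem Wp_phase (h : Large K T c₀ δ) (hg : GoodPath K T c₀ δ θ μ obs π μh Ex)
    (hθ : ∀ a, θ a ∈ Set.Icc (0 : ℝ) 1) (hμ : ∀ b, μ b ∈ Set.Icc (0 : ℝ) 1)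
    (hM : ∀ b, μ b ≤ μ z) (hV : ∀ b, θ b + μ b ≤ θ s + μ s) (hm : 1 ≤ m) (t : ℕ)
    (hinv : t ≤ T → PhaseInv K T c₀ δ θ μ obs s m act t) :
    Wp obs π (phase T c₀ δ m act) t (fun act' t' => t ≤ t' ∧
      (t' ≤ T → PhaseInv K T c₀ δ θ μ obs s (m + 1) act' t') ∧
      cost T θ (θ s + μ s - μ z) obs π t t' ≤ phaseCost K T c₀ δ m act) := by
  have hT : 1 ≤ T := by have := h.two_le_T; omega
  have hTinv : (0 : ℝ) < 1 / T := by have : (0 : ℝ) < T := by exact_mod_cast hT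
                                     positivity
  set B := θ s + μ s - μ z with hBdef
  have hB : B ≤ 1 := by linarith [(hθ s).2, hM s]
  have hθ0 : ∀ a, 0 ≤ θ a := fun a => (hθ a).1
  have hpl := h.one_le m
  -- in later phases enough rounds are over
  have hlater : 2 ≤ m → t ≤ T → phaseLength K T c₀ δ (m - 1) ≤ t ∧ phaseLength K T c₀ δ 1 ≤ t :=
    fun hm2 htT => (hinv htT).first_le h hm2
  -- Each search lasts at least one round, and in phase one all `K` arms are searched.
  have hcalls : m = 1 → t ≤ T → ∀ t1 t2 : ℕ, t1 + act.card * searchCalls T δ ≤ t2 →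
      2 * Real.log T * K ≤ t2 := by
    intro hm1 htT t1 t2 ht
    have k1 : act.card = K := by rw [(hinv htT).first hm1]; simp
    rw [k1] at ht
    have k2 : (K : ℝ) * searchCalls T δ ≤ t2 := by exact_mod_cast (Nat.le_add_left _ _).trans ht
    have k3 := mul_le_mul_of_nonneg_left h.calls h.K_pos.le
    linarith
  unfold phase
  refine Wp_bind ((Wp_stabilize hT hg.best hg.mem_Icc (stabilizeRounds K T c₀ δ m act)
    (actᶜ.sort (· ≤ ·)) t ?_).mono ?_)
  · intro b hb t' ht' ht'T
    have hinv := hinv (by omega)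
    rcases Nat.eq_or_lt_of_le hm with hm1 | hm2
    · rw [hinv.first hm1.symm] at hb
      simp at hb
    · have hlt := (hlater hm2 (by omega)).2
      refine hg.half t' _ (hlt.trans (by exact_mod_cast ht')) (h.stabilize.trans ?_) ht'T
      have hact : act.Nonempty := ⟨s, hinv.best_mem⟩
      refine le_trans ?_ (le_stabilizeRounds h hact)
      rw [mul_assoc]
      refine mul_le_mul_of_nonneg_left ?_ zero_le_two
      have k1 : (1 : ℝ) ≤ confLog K T δ ^ (1 / 3 : ℝ) :=
        Real.one_le_rpow h.one_le_confLog (by norm_num)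
      have k2 := first_div_le (m := m) h hact (by omega)
      have k3 : 0 ≤ phaseLength K T c₀ δ 1 / K := by have := h.one_le 1; positivity
      have k4 := Real.rpow_le_rpow k3 k2 (show (0 : ℝ) ≤ 2 / 3 by norm_num)
      have k5 := ratio_pos (m := m) h hact
      exact k4.trans (le_mul_of_one_le_left (by positivity) k1)
  rintro _ t1 - ⟨a1, a2, a3⟩
  rw [Finset.length_sort] at a1
  refine Wp_bind ((Wp_searchAll (z := z) h hg hμ hM hm t1 ?_).mono ?_)
  · intro hm2 ht1T
    have htt1 : t ≤ t1 := by omega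
    refine ⟨(hlater hm2 (by omega)).2.trans (by exact_mod_cast htt1), fun b hb => ?_, fun b hb => ?_⟩
    · exact ((hinv (by omega)).counts hm2 b hb).trans
        (by exact_mod_cast Tally.ofPath_count_mono obs b htt1)
    · exact a3 ht1T b (by simpa using hb)
  rintro found t2 ht12 ⟨b0, b1, b2, b3, b4, b5⟩
  have htt2 : t ≤ t2 := by omega
  refine Wp_bind ((Wp_testFound (B := B) h hg hB hθ0 hm
    (perPlay_nonneg (m := m) (act := act) h) t2 found
    (fun a => testCap K T c₀ δ (μ z - μ a) m act) ?_ (fun p hp => (b5 p hp).2) ?_ ?_).mono ?_)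
  · intro ht2T p hp
    exact le_perPlay h hm (hinv (by omega)) hB hθ0 (b5 p hp).1
  · intro ht2T
    rcases Nat.eq_or_lt_of_le hm with hm1 | hm2
    · have := hcalls hm1.symm (by omega) t1 t2 b1
      have hK : (1 : ℝ) ≤ K := by exact_mod_cast h.one_le_K
      have hlog : 0 ≤ Real.log T := Real.log_natCast_nonneg T
      nlinarith
    · exact h.log_T_le.trans ((hlater hm2 (by omega)).2.trans (by exact_mod_cast htt2))
  · intro ht2T
    have hC : 0 ≤ testConst c₀ * Real.log (iota K T δ) ^ 2 := by linarith [h.test_later]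
    rcases Nat.eq_or_lt_of_le hm with hm1 | hm2
    · have := hcalls hm1.symm (by omega) t1 t2 b1
      rw [← hm1]
      exact h.test_first.trans (mul_le_mul_of_nonneg_left this hC)
    · have k1 : phaseLength K T c₀ δ m = 4 * phaseLength K T c₀ δ (m - 1) := by
        have := phaseLength_succ (K := K) (T := T) (c₀ := c₀) (δ := δ) (show 1 ≤ m - 1 by omega)
        rwa [Nat.sub_add_cancel hm] at this
      have k2 := h.one_le (m - 1)
      have k3 : phaseLength K T c₀ δ (m - 1) ≤ t2 :=
        (hlater hm2 (by omega)).1.trans (by exact_mod_cast htt2)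
      calc 2 * phaseLength K T c₀ δ m + 1 ≤ 9 * phaseLength K T c₀ δ (m - 1) := by
            rw [k1]; linarith
        _ ≤ testConst c₀ * Real.log (iota K T δ) ^ 2 * t2 := by
            have := h.test_later
            gcongr
  rintro _ t3 ht23 ⟨-, c1, c2⟩
  refine Wp_bind ((Wp_keepAll (B := B) (s := s) h hg hB hθ hV hm t3
    (fun ht3 => (hinv (by omega)).best_mem) ?_).mono ?_)
  · intro ht3T a ha
    obtain ⟨p, hp, rfl⟩ := b4 a ha
    exact c2 ht3T p hp
  rintro kept t4 ht34 ⟨-, d1, d2⟩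
  refine Wp_pure ⟨by omega, ?_, ?_⟩
  · intro ht4T
    obtain ⟨e1, e2⟩ := d2 ht4T
    have hs := (hinv (by omega)).best_mem
    refine ⟨by simp [hs, e1], by omega, fun _ a ha => ?_, fun _ a ha => ?_⟩
    · have ha' := (Finset.mem_filter.1 ha).1
      obtain ⟨p, hp, rfl⟩ := b4 a ha'
      rw [Nat.add_sub_cancel]
      exact (c2 (by omega) p hp).trans (by exact_mod_cast Tally.ofPath_count_mono obs p.1 ht34)
    · rw [Nat.add_sub_cancel]
      exact e2 a (Finset.mem_filter.1 ha).2
  · have htt1 : t ≤ t1 := by omega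
    rw [← cost_add (htt2.trans ht23) ht34, ← cost_add htt2 ht23, ← cost_add htt1 ht12]
    have f1 := cost_le_of_oneHotDuring (T := T) (obs := obs) hB hθ0 htt1 a2
    have f2 := cost_le_of_oneHotDuring (T := T) (obs := obs) hB hθ0 ht12 b3
    have f3 : (t1 : ℝ) - t = actᶜ.card * stabilizeRounds K T c₀ δ m act := by
      rw [a1]; push_cast; ring
    have f4 : (t2 : ℝ) - t1 ≤ act.card * (searchCalls T δ * searchRounds T) := by
      have : (t2 : ℝ) ≤ t1 + act.card * (searchCalls T δ * searchRounds T) := by exact_mod_cast b2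
      linarith
    rw [b0] at c1
    rw [f3] at f1
    unfold phaseCost
    linarith

/-- The plays of all arms add up to `t`. For a phase that starts in time this gives `|A_m| T_{m-1} ≤
T`, from which the powers of `T` in the rate arise. -/
theorem card_mul_le {t : ℕ} (hinv : PhaseInv K T c₀ δ θ μ obs s m act t) (hm : 2 ≤ m) :
    act.card * phaseLength K T c₀ δ (m - 1) ≤ t := by
  calc act.card * phaseLength K T c₀ δ (m - 1)
      ≤ ∑ a ∈ act, ((Tally.ofPath obs t).count a : ℝ) := by
        rw [← nsmul_eq_mul]
        exact Finset.card_nsmul_le_sum _ _ _ fun a ha => hinv.counts hm a ha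
    _ ≤ ∑ a, ((Tally.ofPath obs t).count a : ℝ) :=
        Finset.sum_le_sum_of_subset_of_nonneg (Finset.subset_univ _) fun _ _ _ => by positivity
    _ = t := by
        rw [← Nat.cast_sum, Tally.sum_ofPath_count]

/-- The later phases. At most `N` phases start before the horizon. -/
theorem Wp_phases (h : Large K T c₀ δ) (hg : GoodPath K T c₀ δ θ μ obs π μh Ex)
    (hθ : ∀ a, θ a ∈ Set.Icc (0 : ℝ) 1) (hμ : ∀ b, μ b ∈ Set.Icc (0 : ℝ) 1)
    (hM : ∀ b, μ b ≤ μ z) (hV : ∀ b, θ b + μ b ≤ θ s + μ s) {F : ℝ} {N : ℕ} (hF0 : 0 ≤ F)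
    (hF : ∀ m (act : Finset (Fin K)), 2 ≤ m → act.Nonempty →
      act.card * phaseLength K T c₀ δ (m - 1) ≤ T → phaseCost K T c₀ δ m act ≤ F)
    (hN : ∀ m, 2 ≤ m → phaseLength K T c₀ δ (m - 1) ≤ T → m ≤ N) (n m : ℕ) (hm : 2 ≤ m)
    (act : Finset (Fin K)) (t : ℕ) (hinv : t ≤ T → PhaseInv K T c₀ δ θ μ obs s m act t) :
    Wp obs π (phases T c₀ δ n m act) t (fun _ t' => t ≤ t' ∧ (N < m + n → T < t') ∧
      cost T θ (θ s + μ s - μ z) obs π t t' ≤ F * (N + 1 - m : ℕ)) := by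
  induction n generalizing m act t with
  | zero =>
    refine Wp_pure ⟨le_rfl, fun hNm => ?_, by simp only [cost, Finset.Ico_self, Finset.sum_empty]; positivity⟩
    by_contra htT
    have htT := not_lt.1 htT
    have := hN m hm (((hinv htT).first_le h hm).1.trans (by exact_mod_cast htT))
    omega
  | succ n ih =>
    refine Wp_bind ((Wp_phase h hg hθ hμ hM hV (by omega) t hinv).mono ?_)
    rintro act' t1 - ⟨h1, h2, h3⟩
    refine (ih (m + 1) (by omega) act' t1 h2).mono ?_
    rintro _ t2 - ⟨k1, k2, k3⟩
    refine ⟨by omega, fun hNm => k2 (by omega), ?_⟩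
    rcases lt_or_ge T t with htT | htT
    · rw [cost_eq_zero (by omega)]
      positivity
    · rw [← cost_add h1 k1]
      have hi := hinv htT
      have e1 := hN m hm ((hi.first_le h hm).1.trans (by exact_mod_cast htT))
      have e2 := hF m act hm ⟨s, hi.best_mem⟩
        ((card_mul_le hi hm).trans (by exact_mod_cast htT))
      have e3 : ((N + 1 - m : ℕ) : ℝ) = ((N + 1 - (m + 1) : ℕ) : ℝ) + 1 := by
        rw [show N + 1 - m = (N + 1 - (m + 1)) + 1 by omega]; push_cast; ring
      rw [e3]
      linarith

/-- The regret along a good path. -/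
theorem regret_le_of_goodPath (h : Large K T c₀ δ)
    (hg : GoodPath K T c₀ δ θ μ obs
      (fun k => (algorithm K T c₀ δ).incentiveAt obs k) μh Ex)
    (hθ : ∀ a, θ a ∈ Set.Icc (0 : ℝ) 1) (hμ : ∀ b, μ b ∈ Set.Icc (0 : ℝ) 1)
    (hM : ∀ b, μ b ≤ μ z) (hV : ∀ b, θ b + μ b ≤ θ s + μ s) {F F₁ : ℝ} {N : ℕ} (hF0 : 0 ≤ F)
    (hF : ∀ m (act : Finset (Fin K)), 2 ≤ m → act.Nonempty →
      act.card * phaseLength K T c₀ δ (m - 1) ≤ T → phaseCost K T c₀ δ m act ≤ F)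
    (hF₁ : phaseCost K T c₀ δ 1 Finset.univ ≤ F₁)
    (hN : ∀ m, 2 ≤ m → phaseLength K T c₀ δ (m - 1) ≤ T → m ≤ N) (hNT : N ≤ T) :
    ∑ k ∈ Finset.range T, (θ s + μ s - μ z - (θ (obs k).1 -
      ∑ a, (algorithm K T c₀ δ).incentiveAt obs k a)) ≤ F₁ + F * N := by
  set π : ℕ → Fin K → ℝ := fun k => (algorithm K T c₀ δ).incentiveAt obs k with hπ
  have hT := h.two_le_T
  have hinv : PhaseInv K T c₀ δ θ μ obs s 1 Finset.univ 0 :=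
    ⟨Finset.mem_univ _, fun _ => rfl, fun h => by omega, fun h => by omega⟩
  have hwp : Wp obs π (phases T c₀ δ T 1 Finset.univ) 0 (fun _ t' => T < t' ∧
      cost T θ (θ s + μ s - μ z) obs π 0 t' ≤ F₁ + F * N) := by
    -- Phase one has its own cost. The remaining `T - 1` phases lead beyond the horizon because `N ≤
    -- T`.
    obtain ⟨n, rfl⟩ : ∃ n, T = n + 1 := ⟨T - 1, by omega⟩
    refine Wp_bind ((Wp_phase h hg hθ hμ hM hV le_rfl 0 fun _ => hinv).mono ?_)
    rintro act' t1 - ⟨h1, h2, h3⟩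
    refine (Wp_phases h hg hθ hμ hM hV hF0 hF hN n 2 le_rfl act' t1 h2).mono ?_
    rintro _ t2 - ⟨k1, k2, k3⟩
    refine ⟨k2 (by omega), ?_⟩
    rw [← cost_add h1 k1]
    have : ((N + 1 - 2 : ℕ) : ℝ) ≤ N := by exact_mod_cast (by omega : N + 1 - 2 ≤ N)
    have := mul_le_mul_of_nonneg_left this hF0
    linarith
  obtain ⟨_, t', ⟨-, -, h1, h2⟩, -⟩ := Protocol.exists_of_wp hwp fun j => by
    simp only [zero_add]
    rfl
  calc _ ≤ ∑ k ∈ Finset.range T, roundCost T θ (θ s + μ s - μ z) obs π k := by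
        refine Finset.sum_le_sum fun k hk => ?_
        rw [roundCost, if_pos (Finset.mem_range.1 hk)]
        exact le_max_right _ _
    _ ≤ cost T θ (θ s + μ s - μ z) obs π 0 t' := by
        rw [cost, ← Finset.range_eq_Ico]
        exact Finset.sum_le_sum_of_subset_of_nonneg (Finset.range_subset_range.2 h1.le)
          fun k _ _ => roundCost_nonneg k
    _ ≤ _ := h2

end Path

end Exploratory

/-! ### Paths are good with high probability -/

namespace Exploratory

/-- Inequalities that make atypical exploration improbable. -/
structure RareExploration (K T : ℕ) (c₀ δ : ℝ) : Prop where
  time_le : (explorationTime c₀ : ℝ) ≤ 2 * Real.log T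
  time_le_first : (explorationTime c₀ : ℝ) ≤ phaseLength K T c₀ δ 1
  rate : ∃ q : ℝ, 0 ≤ q ∧ 16 * q ≤ 1 ∧ Real.exp 3 * searchRounds T * q ≤ 1 ∧
    ∀ s : ℕ, phaseLength K T c₀ δ 1 ≤ s → c₀ * √(Real.log (2 * s) / s) ≤ q
  test : ∀ t Y : ℕ, 2 * Real.log T ≤ t →
    (Y : ℝ) ≤ testConst c₀ * Real.log (iota K T δ) ^ 2 * t → t + Y ≤ T →
    Y ≤ threshold K T c₀ δ Y ∨ ∃ r m : ℝ, 0 ≤ r ∧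
      ∑ s ∈ Finset.Ico (t + 1) (t + Y + 1), c₀ * √(Real.log (2 * s) / s) ≤ m ∧
      (Real.exp r - 1) * m - r * threshold K T c₀ δ Y ≤ -4 * Real.log T

section

variable {Ω : Type*} {mΩ : MeasurableSpace Ω} {P : Measure Ω} {K : ℕ} {X R : ℕ → Fin K → Ω → ℝ}
  {A : ℕ → Ω → Fin K} {T : ℕ} {c₀ δ : ℝ} {D : Arms K} {alg : Protocol K (Unit × Tally K)}

/-- The observations of the principal in the outcome `ω`. -/
def pathOf (X : ℕ → Fin K → Ω → ℝ) (A : ℕ → Ω → Fin K) (ω : Ω) (k : ℕ) : Fin K × ℝ :=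
  (A (k + 1) ω, X (k + 1) (A (k + 1) ω) ω)

theorem ofPath_count_pathOf (b : Fin K) (k : ℕ) (ω : Ω) :
    (Tally.ofPath (pathOf X A ω) k).count b = plays A b (k + 1) ω := by
  induction k with
  | zero => simp [Tally.ofPath, Tally.empty, plays]
  | succ k ih => rw [Tally.ofPath_count_succ, ih, plays_succ A b (show 1 ≤ k + 1 by omega)]; rfl

theorem deviation_eq (Z : ℕ → Ω → ℝ) (b : Fin K) (ν : ℝ) (t : ℕ) (ω : Ω) :
    deviation A Z b ν t ω =
      (∑ s ∈ Finset.Ico 1 t, if A s ω = b then Z s ω else 0) - ν * plays A b t ω := by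
  unfold deviation plays
  rw [Finset.card_filter]
  push_cast
  rw [Finset.mul_sum, ← Finset.sum_sub_distrib]
  refine Finset.sum_congr rfl fun s _ => ?_
  split_ifs <;> simp

theorem ofPath_mean_pathOf (b : Fin K) (k : ℕ) (ω : Ω) :
    (Tally.ofPath (pathOf X A ω) k).mean b = agentMean X A b (k + 1) ω := by
  have : (Tally.ofPath (pathOf X A ω) k).total b =
      ∑ s ∈ Finset.Ico 1 (k + 1), if A s ω = b then X s b ω else 0 := by
    induction k with
    | zero => simp [Tally.ofPath, Tally.empty]
    | succ k ih =>
      rw [Tally.ofPath_total_succ, ih, Finset.sum_Ico_succ_top (show 1 ≤ k + 1 by omega)]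
      congr 1
      by_cases h : A (k + 1) ω = b
      · simp [pathOf, h]
      · simp [pathOf, h]
  rw [Tally.mean, this, ofPath_count_pathOf, agentMean]

theorem abs_mean_sub_le {Z : ℕ → Fin K → Ω → ℝ} {b : Fin K} {ν l : ℝ} {t : ℕ} {ω : Ω}
    (h1 : 1 ≤ plays A b t ω)
    (h : |deviation A (fun t => Z t b) b ν t ω| ≤ √(plays A b t ω * l / 2)) :
    |agentMean Z A b t ω - ν| ≤ √(l / 2 / plays A b t ω) := by
  have hN : (0 : ℝ) < plays A b t ω := by exact_mod_cast h1
  have e1 : agentMean Z A b t ω - ν =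
      deviation A (fun t => Z t b) b ν t ω / plays A b t ω := by
    rw [deviation_eq, agentMean, max_eq_right h1]
    field_simp
  rw [e1, abs_div, abs_of_pos hN, div_le_iff₀ hN]
  refine h.trans (le_of_eq ?_)
  rw [show (plays A b t ω : ℝ) * l / 2 = l / 2 / plays A b t ω * (plays A b t ω : ℝ) ^ 2 by
    field_simp, Real.sqrt_mul' _ (by positivity), Real.sqrt_sq hN.le]

theorem agentMean_mem_Icc {b : Fin K} {t : ℕ} {ω : Ω}
    (h : ∀ s ∈ Finset.Ico 1 t, R s b ω ∈ Set.Icc (0 : ℝ) 1) :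
    agentMean R A b t ω ∈ Set.Icc (0 : ℝ) 1 := by
  unfold agentMean
  have h1 : ∑ s ∈ Finset.Ico 1 t, (if A s ω = b then R s b ω else 0) ≤ plays A b t ω := by
    unfold plays
    rw [Finset.card_filter]
    push_cast
    refine Finset.sum_le_sum fun s hs => ?_
    split_ifs
    · exact (h s hs).2
    · exact le_rfl
  have h0 : 0 ≤ ∑ s ∈ Finset.Ico 1 t, (if A s ω = b then R s b ω else 0) :=
    Finset.sum_nonneg fun s hs => by
      split_ifs
      · exact (h s hs).1
      · exact le_rfl
  refine ⟨div_nonneg h0 (by positivity), ?_⟩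
  rw [div_le_one (by positivity)]
  exact h1.trans (by exact_mod_cast le_max_right _ _)

/-- Step `k` of a path is round `k + 1` of the game, and steps from `T` on are not counted; hence
the shift and the minimum. -/
theorem exCount_eq (t t' : ℕ) (ω : Ω) :
    exCount T (fun k => ω ∈ explores X R A alg (k + 1)) t t' =
      IsExploratoryGame.exploreCount X R A alg (Finset.Ico (t + 1) (min t' T + 1)) ω := by
  classical
  unfold exCount IsExploratoryGame.exploreCount
  refine Finset.card_nbij' (fun k => k + 1) (fun k => k - 1) ?_ ?_ ?_ ?_
  · intro k hk
    simp only [Finset.coe_filter, Finset.mem_Ico, Set.mem_ofPred_eq] at hk ⊢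
    exact ⟨by omega, hk.2.2⟩
  · intro k hk
    simp only [Finset.coe_filter, Finset.mem_Ico, Set.mem_ofPred_eq] at hk ⊢
    refine ⟨by omega, by omega, ?_⟩
    rw [Nat.sub_add_cancel (by omega)]
    exact hk.2
  · intro k _; simp
  · intro k hk
    simp only [Finset.coe_filter, Finset.mem_Ico, Set.mem_ofPred_eq] at hk
    exact Nat.sub_add_cancel (by omega)

theorem measure_biUnion_le_card_mul {ι : Type*} (I : Finset ι) (S : ι → Set Ω) {x : ℝ}
    (hS : ∀ i ∈ I, P (S i) ≤ ENNReal.ofReal x) :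
    P (⋃ i ∈ I, S i) ≤ ENNReal.ofReal (I.card * x) := by
  refine (measure_biUnion_finset_le _ _).trans ((Finset.sum_le_card_nsmul _ _ _ hS).trans ?_)
  rw [nsmul_eq_mul, ENNReal.ofReal_mul (by positivity)]
  simp

variable [IsProbabilityMeasure P]

theorem measure_mean_deviates_le {ℋ : ℕ → MeasurableSpace Ω} {Z : ℕ → Fin K → Ω → ℝ}
    {ν : Fin K → ℝ} (h : ∀ b, FreshRewards ℋ A (fun t => Z t b) b P T (ν b)) {l : ℝ} (hl : 0 ≤ l) :
    P {ω | ¬ ∀ k < T, ∀ b, 1 ≤ plays A b (k + 1) ω →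
      |agentMean Z A b (k + 1) ω - ν b| ≤ √(l / 2 / plays A b (k + 1) ω)} ≤
      ENNReal.ofReal (2 * K * T ^ 2 * Real.exp (-l)) := by
  have hsub : {ω | ¬ ∀ k < T, ∀ b, 1 ≤ plays A b (k + 1) ω →
      |agentMean Z A b (k + 1) ω - ν b| ≤ √(l / 2 / plays A b (k + 1) ω)} ⊆
      ⋃ i ∈ Finset.range T ×ˢ (Finset.univ : Finset (Fin K)),
        {ω | 1 ≤ plays A i.2 (i.1 + 1) ω ∧ √(plays A i.2 (i.1 + 1) ω * l / 2) <
          |deviation A (fun t => Z t i.2) i.2 (ν i.2) (i.1 + 1) ω|} := by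
    intro ω hω
    simp only [Set.mem_ofPred_eq, not_forall] at hω
    obtain ⟨k, hk, b, hb, hlt⟩ := hω
    refine Set.mem_biUnion (x := (k, b)) (by simp [hk]) ⟨hb, ?_⟩
    by_contra hle
    exact hlt (abs_mean_sub_le hb (not_lt.1 hle))
  refine (measure_mono hsub).trans ((measure_biUnion_le_card_mul (x := 2 * T * Real.exp (-l)) _ _
    fun i hi => ?_).trans ?_)
  · have := (Finset.mem_product.1 hi).1
    rw [Finset.mem_range] at this
    exact (h i.2).measure_deviation_le hl (by omega) (by omega)
  · apply ENNReal.ofReal_le_ofReal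
    rw [Finset.card_product, Finset.card_range, Finset.card_univ, Fintype.card_fin]
    push_cast
    apply le_of_eq
    ring

/-- The probability is `T ^ (-4)`, small enough for a union over all pairs of start and length of a
window. -/
theorem measure_exCount_ge_le (h : IsExploratoryGame X R A (algorithm K T c₀ δ) P T c₀ D)
    {t t' : ℕ} (ht1 : explorationTime c₀ ≤ t) {r k m : ℝ} (hr : 0 ≤ r)
    (hm : ∑ s ∈ Finset.Ico (t + 1) (min t' T + 1), c₀ * √(Real.log (2 * s) / s) ≤ m)
    (hle : (Real.exp r - 1) * m - r * k ≤ -4 * Real.log T) :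
    P {ω | k ≤ exCount T (fun k => ω ∈ explores X R A (algorithm K T c₀ δ) (k + 1)) t t'} ≤
      ENNReal.ofReal (Real.exp (-4 * Real.log T)) := by
  simp only [exCount_eq]
  refine (h.measure_exploreCount_ge_le (fun s hs => ?_) (fun s _ => le_rfl) hr hm).trans
    (ENNReal.ofReal_le_ofReal (Real.exp_le_exp.2 hle))
  simp only [Finset.mem_Ico, Finset.mem_Icc] at hs ⊢
  exact ⟨max_le (by omega) (by omega), by omega⟩

theorem sum_rate_le {q : ℝ} {t t' : ℕ} (hq0 : 0 ≤ q) (htt' : t ≤ t')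
    (hq : ∀ s : ℕ, t ≤ s → c₀ * √(Real.log (2 * s) / s) ≤ q) :
    ∑ s ∈ Finset.Ico (t + 1) (min t' T + 1), c₀ * √(Real.log (2 * s) / s) ≤ q * (t' - t : ℕ) := by
  refine (Finset.sum_le_card_nsmul _ _ q fun s hs => hq s ?_).trans ?_
  · have := (Finset.mem_Ico.1 hs).1
    omega
  · rw [Nat.card_Ico, nsmul_eq_mul, mul_comm]
    refine mul_le_mul_of_nonneg_left ?_ hq0
    exact_mod_cast (by omega)

theorem exp_two_le : Real.exp 2 ≤ 8 := by
  have := Real.exp_one_lt_d9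
  rw [show (2 : ℝ) = 1 + 1 by norm_num, Real.exp_add]
  nlinarith [Real.exp_pos 1]

/-- The path of the outcome `ω` is good. -/
def IsGood (X R : ℕ → Fin K → Ω → ℝ) (A : ℕ → Ω → Fin K) (T : ℕ) (c₀ δ : ℝ) (D : Arms K)
    (ω : Ω) : Prop :=
  GoodPath K T c₀ δ D.θ D.μ (pathOf X A ω)
    (fun k => (algorithm K T c₀ δ).incentiveAt (pathOf X A ω) k)
    (fun b k => agentMean R A b (k + 1) ω)
    (fun k => ω ∈ explores X R A (algorithm K T c₀ δ) (k + 1))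

/-- A union bound over five failures: the means of either player, together at most `1 / T`, and
three kinds of windows with too much exploration, each at most `2 / T`. That the agent plays a
maximizer otherwise is the definition of `explores`. -/
theorem exists_measure_bad_le (h : IsExploratoryGame X R A (algorithm K T c₀ δ) P T c₀ D)
    (hl : Large K T c₀ δ) (hr : RareExploration K T c₀ δ)
    (hexp : 4 * K * T ^ 2 * Real.exp (-(3 / 2 * confLog K T δ)) ≤ 1 / T) :
    ∃ S, MeasurableSet S ∧ P S ≤ ENNReal.ofReal (10 / T) ∧
      ∀ᵐ ω ∂P, ω ∉ S → IsGood X R A T c₀ δ D ω := by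
  set alg := algorithm K T c₀ δ with halg
  set Ex : Ω → ℕ → Prop := fun ω k => ω ∈ explores X R A alg (k + 1) with hEx
  set x := Real.exp (-4 * Real.log T) with hx
  have hT2 : (2 : ℝ) ≤ T := by exact_mod_cast hl.two_le_T
  have hxT : x = 1 / (T : ℝ) ^ 4 := by
    rw [hx, neg_mul, Real.exp_neg, show 4 * Real.log T = Real.log ((T : ℝ) ^ 4) by
      rw [Real.log_pow]; norm_num, Real.exp_log (by positivity), one_div]
  obtain ⟨q, hq0, hq16, hqW, hq⟩ := hr.rate
  -- deviations of the means
  have hconf : 0 ≤ confLog K T δ := by linarith [hl.one_le_confLog]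
  set S₁ := {ω | ¬ ∀ k < T, ∀ b, 1 ≤ plays A b (k + 1) ω →
      |agentMean R A b (k + 1) ω - D.μ b| ≤ √(3 / 2 * confLog K T δ / 2 / plays A b (k + 1) ω)}
  set S₂ := {ω | ¬ ∀ k < T, ∀ b, 1 ≤ plays A b (k + 1) ω →
      |agentMean X A b (k + 1) ω - D.θ b| ≤ √(3 / 2 * confLog K T δ / 2 / plays A b (k + 1) ω)}
  have hS₁ := measure_mean_deviates_le (fun b => h.freshRewards_agent b)
    (show 0 ≤ 3 / 2 * confLog K T δ by positivity)
  have hS₂ := measure_mean_deviates_le (fun b => h.freshRewards_principal b)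
    (show 0 ≤ 3 / 2 * confLog K T δ by positivity)
  -- exploration in long windows
  set I := Finset.range (T + 1) ×ˢ Finset.range (T + 1)
  have hI : ((I.card : ℕ) : ℝ) * x ≤ 2 / T := by
    rw [hxT, Finset.card_product, Finset.card_range]
    push_cast
    rw [mul_one_div, div_le_div_iff₀ (by positivity) (by positivity)]
    have h1 : (T + 1) * (T + 1) ≤ 3 * (T : ℝ) ^ 2 := by nlinarith
    have h2 : (T + 1) * (T + 1) * (T : ℝ) ≤ 3 * (T : ℝ) ^ 2 * T := by gcongr
    nlinarith [pow_pos (show (0 : ℝ) < T by linarith) 3]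
  set S₃ := ⋃ i ∈ I, {ω | phaseLength K T c₀ δ 1 ≤ i.1 ∧ 8 * Real.log T ≤ i.2 ∧ i.1 + i.2 ≤ T ∧
    (i.2 : ℝ) / 2 ≤ exCount T (Ex ω) i.1 (i.1 + i.2)}
  have hS₃ : P S₃ ≤ ENNReal.ofReal (I.card * x) := by
    refine measure_biUnion_le_card_mul _ _ fun i _ => ?_
    by_cases hc : phaseLength K T c₀ δ 1 ≤ i.1 ∧ 8 * Real.log T ≤ i.2 ∧ i.1 + i.2 ≤ T
    · refine (measure_mono fun ω hω => hω.2.2.2).trans (measure_exCount_ge_le h ?_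
        (zero_le_two : (0 : ℝ) ≤ 2) (sum_rate_le (T := T) hq0 (Nat.le_add_right _ _)
          fun s hs => hq s (hc.1.trans (by exact_mod_cast hs))) ?_)
      · exact_mod_cast hr.time_le_first.trans hc.1
      · rw [Nat.add_sub_cancel_left]
        have h1 : Real.exp 2 - 1 ≤ 8 := by linarith [exp_two_le]
        have h2 : 0 ≤ q * (i.2 : ℝ) := by positivity
        have h3 : (Real.exp 2 - 1) * (q * i.2) ≤ 8 * (q * i.2) :=
          mul_le_mul_of_nonneg_right h1 h2
        have h4 : 16 * (q * (i.2 : ℝ)) ≤ i.2 := by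
          have : (0 : ℝ) ≤ i.2 := by positivity
          nlinarith
        linarith [hc.2.1]
    · refine (le_of_eq ?_).trans zero_le
      convert measure_empty (μ := P)
      ext ω
      simp only [Set.mem_ofPred_eq, Set.mem_empty_iff_false, iff_false]
      rintro ⟨h1, h2, h3, -⟩
      exact hc ⟨h1, h2, h3⟩
  -- exploration in windows of searches
  set S₄ := ⋃ t ∈ Finset.range (T + 1), {ω | phaseLength K T c₀ δ 1 ≤ t ∧
    (searchCalls T δ : ℝ) ≤ exCount T (Ex ω) t (t + searchCalls T δ * searchRounds T)}
  have hS₄ : P S₄ ≤ ENNReal.ofReal ((Finset.range (T + 1)).card * x) := by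
    refine measure_biUnion_le_card_mul _ _ fun t _ => ?_
    by_cases hc : phaseLength K T c₀ δ 1 ≤ t
    · refine (measure_mono fun ω hω => hω.2).trans (measure_exCount_ge_le h ?_
        (by norm_num : (0 : ℝ) ≤ 3) (sum_rate_le (T := T) hq0 (Nat.le_add_right _ _)
          fun s hs => hq s (hc.trans (by exact_mod_cast hs))) ?_)
      · exact_mod_cast hr.time_le_first.trans hc
      · rw [Nat.add_sub_cancel_left]
        push_cast
        have h1 : (Real.exp 3 - 1) * (q * (searchCalls T δ * searchRounds T)) ≤
            searchCalls T δ * (Real.exp 3 * searchRounds T * q) := by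
          have : 0 ≤ q * (searchCalls T δ * searchRounds T : ℝ) := by positivity
          nlinarith
        have h2 : (searchCalls T δ : ℝ) * (Real.exp 3 * searchRounds T * q) ≤ searchCalls T δ * 1 :=
          mul_le_mul_of_nonneg_left hqW (by positivity)
        linarith [hl.calls]
    · refine (le_of_eq ?_).trans zero_le
      convert measure_empty (μ := P)
      ext ω
      simp only [Set.mem_ofPred_eq, Set.mem_empty_iff_false, iff_false]
      exact fun h1 => hc h1.1
  -- exploration in tests
  set S₅ := ⋃ i ∈ I, {ω | 2 * Real.log T ≤ i.1 ∧
    (i.2 : ℝ) ≤ testConst c₀ * Real.log (iota K T δ) ^ 2 * i.1 ∧ i.1 + i.2 ≤ T ∧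
    threshold K T c₀ δ i.2 < exCount T (Ex ω) i.1 (i.1 + i.2)}
  have hS₅ : P S₅ ≤ ENNReal.ofReal (I.card * x) := by
    refine measure_biUnion_le_card_mul _ _ fun i _ => ?_
    by_cases hc : 2 * Real.log T ≤ i.1 ∧
      (i.2 : ℝ) ≤ testConst c₀ * Real.log (iota K T δ) ^ 2 * i.1 ∧ i.1 + i.2 ≤ T
    · rcases hr.test i.1 i.2 hc.1 hc.2.1 hc.2.2 with hthr | ⟨r, m, hr0, hm, hle⟩
      · refine (le_of_eq ?_).trans zero_le
        convert measure_empty (μ := P)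
        ext ω
        simp only [Set.mem_ofPred_eq, Set.mem_empty_iff_false, iff_false]
        rintro ⟨-, -, -, h1⟩
        have h2 : exCount T (Ex ω) i.1 (i.1 + i.2) ≤ i.2 := by
          classical
          exact (Finset.card_filter_le _ _).trans (by simp)
        have h3 : (exCount T (Ex ω) i.1 (i.1 + i.2) : ℝ) ≤ i.2 := by exact_mod_cast h2
        linarith
      · refine (measure_mono fun ω hω => hω.2.2.2.le).trans (measure_exCount_ge_le h ?_ hr0 ?_ hle)
        · exact_mod_cast hr.time_le.trans hc.1
        · rw [min_eq_left hc.2.2]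
          exact hm
    · refine (le_of_eq ?_).trans zero_le
      convert measure_empty (μ := P)
      ext ω
      simp only [Set.mem_ofPred_eq, Set.mem_empty_iff_false, iff_false]
      rintro ⟨h1, h2, h3, -⟩
      exact hc ⟨h1, h2, h3⟩
  -- A measurable hull makes it unnecessary to show that the five sets are measurable.
  refine ⟨toMeasurable P (S₁ ∪ S₂ ∪ S₃ ∪ S₄ ∪ S₅), measurableSet_toMeasurable _ _, ?_, ?_⟩
  · rw [measure_toMeasurable]
    have hI4 : (((Finset.range (T + 1)).card : ℕ) : ℝ) * x ≤ 2 / T := by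
      refine le_trans (mul_le_mul_of_nonneg_right ?_ (Real.exp_pos _).le) hI
      rw [Finset.card_product, Finset.card_range]
      push_cast
      nlinarith
    have e0 : (0 : ℝ) ≤ 2 * K * T ^ 2 * Real.exp (-(3 / 2 * confLog K T δ)) := by positivity
    calc _ ≤ P S₁ + P S₂ + P S₃ + P S₄ + P S₅ :=
          (measure_union_le _ _).trans (add_le_add_left ((measure_union_le _ _).trans
            (add_le_add_left ((measure_union_le _ _).trans (add_le_add_left
              (measure_union_le _ _) _)) _)) _)
      _ ≤ ENNReal.ofReal (2 * K * T ^ 2 * Real.exp (-(3 / 2 * confLog K T δ))) +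
          ENNReal.ofReal (2 * K * T ^ 2 * Real.exp (-(3 / 2 * confLog K T δ))) +
          ENNReal.ofReal (2 / T) + ENNReal.ofReal (2 / T) + ENNReal.ofReal (2 / T) := by
            gcongr
            · exact hS₃.trans (ENNReal.ofReal_le_ofReal hI)
            · exact hS₄.trans (ENNReal.ofReal_le_ofReal hI4)
            · exact hS₅.trans (ENNReal.ofReal_le_ofReal hI)
      _ ≤ _ := by
        rw [← ENNReal.ofReal_add e0 e0, ← ENNReal.ofReal_add (by positivity) (by positivity),
          ← ENNReal.ofReal_add (by positivity) (by positivity),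
          ← ENNReal.ofReal_add (by positivity) (by positivity)]
        apply ENNReal.ofReal_le_ofReal
        have : (10 : ℝ) / T = 1 / T + 2 / T + 2 / T + 2 / T + 3 / T := by ring
        have : (0 : ℝ) ≤ 3 / T := by positivity
        linarith
  · have hae : ∀ᵐ ω ∂P, ∀ b, ∀ s ∈ Finset.Icc 1 T, R s b ω ∈ Set.Icc (0 : ℝ) 1 := by
      rw [ae_all_iff]
      intro b
      exact (ae_ball_iff (Finset.countable_toSet _)).2 fun s hs => (h.freshRewards_agent b).mem_Icc s hs
    filter_upwards [hae] with ω hω hnot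
    have hnot : ω ∉ S₁ ∪ S₂ ∪ S₃ ∪ S₄ ∪ S₅ := fun hh => hnot (subset_toMeasurable P _ hh)
    simp only [Set.mem_union, not_or] at hnot
    obtain ⟨⟨⟨⟨n1, n2⟩, n3⟩, n4⟩, n5⟩ := hnot
    have n1 := not_not.1 n1
    have n2 := not_not.1 n2
    refine ⟨?_, ?_, ?_, ?_, ?_, ?_, ?_⟩
    · intro k _ hk b
      by_contra hlt
      exact hk ⟨b, not_le.1 hlt⟩
    · intro k hk b
      refine agentMean_mem_Icc fun s hs => hω b s ?_
      simp only [Finset.mem_Ico, Finset.mem_Icc] at hs ⊢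
      omega
    · intro k hk b hb
      rw [ofPath_count_pathOf] at hb ⊢
      have := n1 k hk b hb
      rwa [show 3 / 2 * confLog K T δ / 2 = 3 / 4 * confLog K T δ by ring] at this
    · intro k hk b hb
      rw [ofPath_count_pathOf] at hb ⊢
      rw [ofPath_mean_pathOf]
      have := n2 k hk b hb
      rwa [show 3 / 2 * confLog K T δ / 2 = 3 / 4 * confLog K T δ by ring] at this
    · intro t Y h1 h2 h3
      by_contra hlt
      refine n3 (Set.mem_biUnion (x := (t, Y)) (by simp [I]; omega) ⟨h1, h2, h3, ?_⟩)
      have : (Y : ℝ) ≤ 2 * exCount T (Ex ω) t (t + Y) := by exact_mod_cast not_lt.1 hlt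
      simp only
      linarith
    · intro t h1
      by_contra hlt
      rcases lt_or_ge T t with htT | htT
      · apply hlt
        have : exCount T (fun k => ω ∈ explores X R A (algorithm K T c₀ δ) (k + 1)) t
            (t + searchCalls T δ * searchRounds T) = 0 := by
          classical
          unfold exCount
          rw [Finset.card_eq_zero, Finset.filter_eq_empty_iff]
          intro k hk
          have := Finset.mem_Ico.1 hk
          omega
        rw [this]
        exact hl.calls_pos
      · exact n4 (Set.mem_biUnion (x := t) (by simp; omega) ⟨h1, by exact_mod_cast not_lt.1 hlt⟩)
    · intro t Y h1 h2 h3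
      by_contra hlt
      exact n5 (Set.mem_biUnion (x := (t, Y)) (by simp [I]; omega) ⟨h1, h2, h3, not_le.1 hlt⟩)

end

end Exploratory

/-! ### The parameters for the confidence `1 / T` -/

namespace Exploratory

/-- The sizes of the parameters of the algorithm for `δ = 1 / T`, in terms of `log T`. -/
structure Scales (K T : ℕ) (c₀ : ℝ) : Prop where
  c₀_pos : 0 < c₀
  one_le_K : 1 ≤ K
  log_ge : 4 ≤ Real.log T
  conf_ge : 2 * Real.log T ≤ confLog K T (1 / T)
  conf_le : confLog K T (1 / T) ≤ 4 * Real.log T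
  iota_ge : 3 * Real.log T ≤ Real.log (iota K T (1 / T))
  iota_le : Real.log (iota K T (1 / T)) ≤ 6 * Real.log T
  two_le : Real.log (2 * T) ≤ 2 * Real.log T
  calls_ge : 2 * Real.log T ≤ searchCalls T (1 / T)
  calls_le : searchCalls T (1 / T) ≤ 5 * Real.log T
  rounds_le : searchRounds T ≤ 7 * Real.log T
  keep_ge : 8 * Real.log T ≤ keepRounds K T (1 / T)
  keep_le : keepRounds K T (1 / T) ≤ 33 * Real.log T

section

variable {K T : ℕ} {c₀ : ℝ}

theorem logb_two_mem (T : ℕ) :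
    Real.logb 2 T ∈ Set.Icc (Real.log T) (3 / 2 * Real.log T) := by
  have h0 : 0 ≤ Real.log T := Real.log_natCast_nonneg T
  have h1 := Real.log_two_gt_d9
  have h2 := Real.log_two_lt_d9
  rw [Real.logb]
  constructor
  · rw [le_div_iff₀ (by linarith)]
    nlinarith
  · rw [div_le_iff₀ (by linarith)]
    nlinarith

/-- For `δ = 1 / T` and `K` at most of order `T²`, all arguments of logarithms lie between fixed
powers of `T` up to constants; iterated logarithms are absorbed by `log² T ≤ 4 T`. -/
theorem scales (hc : 0 < c₀) (hK : 1 ≤ K) (hT : 4 ≤ Real.log T) (hKT : 512 * (K : ℝ) ≤ T ^ 2) :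
    Scales K T c₀ := by
  have hT0 : (0 : ℝ) < T := by
    rcases Nat.eq_zero_or_pos T with rfl | h
    · simp at hT; linarith
    · exact_mod_cast h
  set l := Real.log T with hl
  have hT1 : 1 ≤ T := by exact_mod_cast hT0
  have hK1 : (1 : ℝ) ≤ K := by exact_mod_cast hK
  have hexp : Real.exp l = T := Real.exp_log hT0
  have hT40 : (40 : ℝ) ≤ T := by
    rw [← hexp]
    refine le_trans ?_ (Real.exp_le_exp.2 hT)
    have := Real.exp_one_gt_d9
    rw [show (4 : ℝ) = (4 : ℕ) * 1 by norm_num, Real.exp_nat_mul]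
    calc (40 : ℝ) ≤ 2.7 ^ 4 := by norm_num
      _ ≤ _ := by gcongr; linarith
  have hsq : l ^ 2 ≤ 4 * T := by
    have h1 : Real.log (√T) ≤ √T - 1 := Real.log_le_sub_one_of_pos (by positivity)
    rw [Real.log_sqrt hT0.le] at h1
    have h2 : l ≤ 2 * √T := by linarith
    calc l ^ 2 ≤ (2 * √(T : ℝ)) ^ 2 := by gcongr
      _ = 4 * (T : ℝ) := by rw [mul_pow, Real.sq_sqrt hT0.le]; norm_num
  have hlT : 2 * l ≤ T := by nlinarith
  obtain ⟨b1, b2⟩ := logb_two_mem T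
  rw [← hl] at b1 b2
  set b := Real.logb 2 T
  have hlogpow (n : ℕ) : Real.log ((T : ℝ) ^ n) = n * l := Real.log_pow _ _
  have hconf : confLog K T (1 / T) = Real.log (16 * K * T ^ 2) := by
    rw [confLog]; congr 1; field_simp
  have hd : 4 * b / (1 / T) = 4 * b * T := by field_simp
  have hg1 : (T : ℝ) ≤ 4 * b * T := by nlinarith
  have hg2 : 4 * b * T ≤ T ^ (2 : ℕ) * 3 := by
    have : 4 * b ≤ 3 * T := by linarith
    nlinarith [mul_le_mul_of_nonneg_right this hT0.le]
  have hg3 : l ≤ Real.log (4 * b * T) := Real.log_le_log hT0 hg1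
  have hg4 : Real.log (4 * b * T) ≤ 2 * l + 3 / 2 := by
    refine (Real.log_le_log (by linarith) hg2).trans ?_
    rw [Real.log_mul (by positivity) (by norm_num), hlogpow]
    have : Real.log 3 ≤ 3 / 2 := by
      have := Real.log_le_sub_one_of_pos (show (0 : ℝ) < 3 / 2 by norm_num)
      have h2 := Real.log_two_lt_d9
      have : Real.log 3 = Real.log (3 / 2) + Real.log 2 := by
        rw [← Real.log_mul (by norm_num) (by norm_num)]; norm_num
      linarith
    push_cast
    linarith
  have hiota : iota K T (1 / T) = 16 * K * T ^ 3 * b * Real.log (4 * b * T) := by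
    rw [iota, hd]; field_simp; rfl
  have hkeep : 8 * K * b / (1 / T) = 8 * K * b * T := by field_simp
  have hk1 : (T : ℝ) ≤ 8 * K * b * T := by
    have : 1 ≤ 8 * K * b := by nlinarith
    nlinarith
  have hk2 : 8 * K * b * T ≤ (T : ℝ) ^ 4 := by
    have : 8 * K * b ≤ (T : ℝ) ^ 2 * T :=
      mul_le_mul (by linarith) (by linarith) (by linarith) (by positivity)
    calc 8 * K * b * (T : ℝ) ≤ (T : ℝ) ^ 2 * T * T := by gcongr
      _ = (T : ℝ) ^ 4 := by ring
  refine ⟨hc, hK, hT, ?_, ?_, ?_, ?_, ?_, ?_, ?_, ?_, ?_, ?_⟩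
  · rw [hconf, show 2 * l = (2 : ℕ) * l by norm_num, ← hlogpow]
    exact Real.log_le_log (by positivity) (by nlinarith [pow_pos hT0 2])
  · rw [hconf, show 4 * l = (4 : ℕ) * l by norm_num, ← hlogpow]
    refine Real.log_le_log (by positivity) ?_
    rw [show (T : ℝ) ^ 4 = T ^ 2 * T ^ 2 by ring]
    gcongr
    linarith
  · rw [hiota, show 3 * l = (3 : ℕ) * l by norm_num, ← hlogpow]
    refine Real.log_le_log (by positivity) ?_
    have h1 : (1 : ℝ) ≤ 16 * K := by linarith
    have h2 : (1 : ℝ) ≤ b := by linarith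
    have h3 : (1 : ℝ) ≤ Real.log (4 * b * T) := by linarith
    calc (T : ℝ) ^ 3 = 1 * T ^ 3 * 1 * 1 := by ring
      _ ≤ _ := by gcongr
  · have hb0 : 0 < 16 * K * (T : ℝ) ^ 3 * b := by
      have : 0 < b := by linarith
      positivity
    rw [hiota, show 6 * l = (6 : ℕ) * l by norm_num, ← hlogpow]
    refine Real.log_le_log (mul_pos hb0 (by linarith)) ?_
    calc 16 * K * T ^ 3 * b * Real.log (4 * b * T) ≤
        T ^ 2 / 32 * T ^ 3 * (3 / 2 * l) * (3 * l) := by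
          have : 16 * K ≤ (T : ℝ) ^ 2 / 32 := by linarith
          have : Real.log (4 * b * T) ≤ 3 * l := by linarith
          have : 0 ≤ Real.log (4 * b * T) := by linarith
          have : 0 ≤ b := by linarith
          gcongr
      _ = T ^ 5 * (9 / 64 * l ^ 2) := by ring
      _ ≤ T ^ 5 * T := by gcongr; linarith
      _ = _ := by ring
  · rw [Real.log_mul (by norm_num) hT0.ne']
    have h2 := Real.log_two_lt_d9
    linarith
  · rw [searchCalls, hd]
    refine le_trans ?_ (Nat.le_ceil _)
    linarith
  · rw [searchCalls, hd]
    refine (Nat.ceil_lt_add_one (by linarith)).le.trans ?_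
    linarith
  · rw [searchRounds]
    push_cast
    have := Nat.ceil_lt_add_one (show 0 ≤ b by linarith)
    change (⌈b⌉₊ : ℝ) < b + 1 at this
    linarith
  · rw [keepRounds]
    change 8 * l ≤ (⌊8 * Real.log (8 * K * b / (1 / T))⌋₊ + 1 : ℕ)
    rw [hkeep]
    push_cast
    have := Nat.lt_floor_add_one (8 * Real.log (8 * K * b * T))
    have := Real.log_le_log hT0 hk1
    linarith
  · rw [keepRounds]
    change (⌊8 * Real.log (8 * K * b / (1 / T))⌋₊ + 1 : ℕ) ≤ 33 * l
    rw [hkeep]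
    push_cast
    have h1 := Real.log_le_log hT0 hk1
    have h2 := Real.log_le_log (by linarith) hk2
    have := Nat.floor_le (show 0 ≤ 8 * Real.log (8 * K * b * T) by linarith)
    rw [hlogpow] at h2
    push_cast at h2
    linarith

/-! ### Consequences of the scales for the first phase length. -/

namespace Scales

variable (h : Scales K T c₀)

include h

theorem T_pos : (0 : ℝ) < T := by
  have := h.log_ge
  rcases Nat.eq_zero_or_pos T with rfl | h
  · simp at this; linarith
  · exact_mod_cast h

theorem K_ge : (1 : ℝ) ≤ K := by exact_mod_cast h.one_le_K

theorem first_ge : 2304 * c₀ ^ 3 * K * Real.log T ^ 3 ≤ phaseLength K T c₀ (1 / T) 1 := by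
  rw [phaseLength_of_pos le_rfl]
  have h1 := h.log_ge
  have h2 := h.c₀_pos
  have h3 := h.conf_ge
  have h4 := h.iota_ge
  have h5 : 0 ≤ confLog K T (1 / T) := by linarith
  calc _ = 32 * c₀ ^ 3 * 4 ^ 1 * K * (2 * Real.log T) * (3 * Real.log T) ^ 2 := by ring
    _ ≤ _ := by gcongr

theorem first_le : phaseLength K T c₀ (1 / T) 1 ≤ 18432 * c₀ ^ 3 * K * Real.log T ^ 3 := by
  rw [phaseLength_of_pos le_rfl]
  have h1 := h.log_ge
  have h2 := h.c₀_pos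
  have h3 := h.conf_ge
  have h4 := h.iota_ge
  calc _ ≤ 32 * c₀ ^ 3 * 4 ^ 1 * K * (4 * Real.log T) * (6 * Real.log T) ^ 2 := by
        have h5 := h.conf_le
        have h6 := h.iota_le
        have h7 : 0 ≤ Real.log (iota K T (1 / T)) := by linarith
        gcongr
    _ = _ := by ring

theorem halfLength_le :
    halfLength K T c₀ (1 / T) ≤ (64 * c₀ ^ 2 + 128) * (6 * Real.log T) := by
  unfold halfLength
  gcongr
  exact h.iota_le

/-- The length `T_1` is of order `c₀³ K log³ T`, so once `log T` is large in terms of `c₀` it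
dominates everything of order `K` or `log T`. -/
theorem large (h1 : 1 ≤ c₀ * Real.log T) (h2 : (64 * c₀ ^ 2 + 128) * 6 ≤ c₀ ^ 3 * Real.log T ^ 2)
    (h3 : 4 ≤ c₀ ^ 2 * Real.log T) : Large K T c₀ (1 / T) := by
  have hl := h.log_ge
  have hc := h.c₀_pos
  have hK := h.K_ge
  have hI := h.iota_ge
  set l := Real.log T with hlT
  have hlK : l ≤ K * l := by nlinarith
  have e1 := h.first_ge
  have hc3 : 1 ≤ c₀ ^ 3 * l ^ 3 := by rw [← mul_pow]; exact one_le_pow₀ h1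
  have hfK : (2304 : ℝ) * K ≤ phaseLength K T c₀ (1 / T) 1 := by
    refine le_trans ?_ e1
    calc (2304 : ℝ) * K = 2304 * K * 1 := by ring
      _ ≤ 2304 * K * (c₀ ^ 3 * l ^ 3) := by gcongr
      _ = _ := by ring
  have hfl : (64 * c₀ ^ 2 + 128) * 6 * l ≤ phaseLength K T c₀ (1 / T) 1 := by
    refine le_trans ?_ e1
    calc (64 * c₀ ^ 2 + 128) * 6 * l ≤ c₀ ^ 3 * l ^ 2 * l := by gcongr
      _ = 1 * (c₀ ^ 3 * 1 * l ^ 3) := by ring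
      _ ≤ 2304 * (c₀ ^ 3 * K * l ^ 3) := by gcongr; norm_num
      _ = _ := by ring
  have hfl' : 768 * l ≤ phaseLength K T c₀ (1 / T) 1 := by
    refine le_trans ?_ hfl
    nlinarith [sq_nonneg c₀]
  refine ⟨hc, h.one_le_K, ?_, ?_, ?_, ?_, ?_, ?_, ?_, ?_, h.calls_ge, ?_, ?_, ?_, ?_, h.keep_ge⟩
  · by_contra hT
    have : T ≤ 1 := by omega
    interval_cases T <;> simp [hlT] at hl <;> linarith
  · linarith [h.conf_ge]
  · linarith
  · linarith [h.two_le]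
  · exact h.halfLength_le.trans (by linarith)
  · linarith [h.conf_le]
  · linarith
  · linarith
  · have := h.calls_ge
    have : (1 : ℝ) ≤ searchCalls T (1 / T) := by linarith
    exact_mod_cast this
  -- Here `2 T_1 ≤ 1024 c₀³ K log T log² ι`, which explains `512 c₀³` in `testConst`; its summand
  -- `1` absorbs the last term.
  · rw [phaseLength_of_pos le_rfl, testConst]
    have h4 := h.conf_le
    have : 1 ≤ Real.log (iota K T (1 / T)) ^ 2 * (2 * l * K) := by
      have : 1 ≤ Real.log (iota K T (1 / T)) ^ 2 := one_le_pow₀ (by linarith)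
      nlinarith
    calc _ ≤ 2 * (32 * c₀ ^ 3 * 4 ^ 1 * K * (4 * l) * Real.log (iota K T (1 / T)) ^ 2) +
          Real.log (iota K T (1 / T)) ^ 2 * (2 * l * K) := by gcongr
      _ = _ := by ring
  · have e3 : (12 : ℝ) ^ 2 ≤ Real.log (iota K T (1 / T)) ^ 2 := by gcongr; linarith
    have e4 : 0 < c₀ ^ 3 := by positivity
    rw [testConst]
    nlinarith
  · have e3 : (c₀ * l) ^ 3 ≤ phaseLength K T c₀ (1 / T) 1 / K := by
      rw [le_div_iff₀ (by linarith)]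
      refine le_trans ?_ e1
      rw [mul_pow]
      have : 0 ≤ c₀ ^ 3 * l ^ 3 * K := by positivity
      nlinarith
    have e4 : ((c₀ * l) ^ 3) ^ (2 / 3 : ℝ) = (c₀ * l) ^ 2 := by
      rw [← Real.rpow_natCast, ← Real.rpow_mul (by positivity)]
      norm_num
    have e5 := Real.rpow_le_rpow (by positivity) e3 (show (0 : ℝ) ≤ 2 / 3 by norm_num)
    rw [e4] at e5
    have : 4 * l ≤ (c₀ * l) ^ 2 := by
      rw [mul_pow]; nlinarith
    linarith

/-- The exponential of `3 L / 2` is `(16 K T²)^{3/2} ≥ 16 K T² * 4 T`. -/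
theorem four_mul_exp_le :
    4 * K * T ^ 2 * Real.exp (-(3 / 2 * confLog K T (1 / T))) ≤ 1 / T := by
  have hT := h.T_pos
  have hK := h.K_ge
  have hconf : confLog K T (1 / T) = Real.log (16 * K * T ^ 2) := by
    rw [confLog]; congr 1; field_simp
  have e1 : 16 * K * T ^ 2 * (4 * T) ≤ Real.exp (3 / 2 * confLog K T (1 / T)) := by
    rw [hconf, ← Real.log_le_iff_le_exp (by positivity), Real.log_mul (by positivity) (by positivity)]
    have : Real.log ((4 * T) ^ 2) ≤ Real.log (16 * K * T ^ 2) :=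
      Real.log_le_log (by positivity) (by nlinarith [pow_pos hT 2])
    rw [Real.log_pow] at this
    push_cast at this
    linarith
  rw [Real.exp_neg, ← div_eq_mul_inv, div_le_div_iff₀ (Real.exp_pos _) hT]
  nlinarith [show 0 ≤ (K : ℝ) * T ^ 3 by positivity]

end Scales

end

end Exploratory

/-! ### Atypical exploration is improbable -/

namespace Exploratory

open Filter Topology

/-- Telescoping of `1 / √(x + 1) ≤ 2 (√(x + 1) - √x)`. -/
theorem sum_one_div_sqrt_le (t Y : ℕ) :
    ∑ s ∈ Finset.Ico (t + 1) (t + Y + 1), 1 / √(s : ℝ) ≤ 2 * (√(t + Y : ℝ) - √t) := by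
  induction Y with
  | zero => simp
  | succ Y ih =>
    rw [show t + (Y + 1) + 1 = (t + Y + 1) + 1 by ring, Finset.sum_Ico_succ_top (by omega)]
    have e1 : ((t + Y + 1 : ℕ) : ℝ) = t + Y + 1 := by push_cast; ring
    rw [e1]
    have e2 : (t + (Y + 1 : ℕ) : ℝ) = t + Y + 1 := by push_cast; ring
    rw [e2]
    set x : ℝ := t + Y with hx
    have hx0 : 0 ≤ x := by positivity
    have h1 : 0 < √(x + 1) := by positivity
    have h2 : 1 / √(x + 1) ≤ 2 * (√(x + 1) - √x) := by
      rw [div_le_iff₀ h1]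
      nlinarith [Real.sq_sqrt hx0, Real.sq_sqrt (show 0 ≤ x + 1 by linarith),
        sq_nonneg (√(x + 1) - √x)]
    linarith

theorem rate_le_of_log_le {c₀ lam : ℝ} (hc : 0 ≤ c₀) {s : ℕ}
    (h : Real.log (2 * s) ≤ lam) :
    c₀ * √(Real.log (2 * s) / s) ≤ c₀ * √lam * (1 / √s) := by
  rw [mul_assoc, mul_one_div, ← Real.sqrt_div' _ (Nat.cast_nonneg s)]
  gcongr

theorem sum_rate_le_sqrt {c₀ lam : ℝ} (hc : 0 ≤ c₀) (t Y : ℕ)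
    (h : ∀ s ∈ Finset.Ico (t + 1) (t + Y + 1), Real.log (2 * s) ≤ lam) :
    ∑ s ∈ Finset.Ico (t + 1) (t + Y + 1), c₀ * √(Real.log (2 * s) / s) ≤
      c₀ * √lam * (2 * (√(t + Y : ℝ) - √t)) := by
  refine (Finset.sum_le_sum fun s hs => rate_le_of_log_le hc (h s hs)).trans ?_
  rw [← Finset.mul_sum]
  gcongr
  exact sum_one_div_sqrt_le t Y

theorem sqrt_add_le {t Y : ℝ} (ht : 0 ≤ t) (hY : 0 ≤ Y) : √(t + Y) ≤ √t + √Y := by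
  refine Real.sqrt_le_iff.2 ⟨by positivity, ?_⟩
  nlinarith [Real.sq_sqrt ht, Real.sq_sqrt hY, mul_nonneg (Real.sqrt_nonneg t) (Real.sqrt_nonneg Y)]

theorem sqrt_add_sub_le {t Y : ℝ} (ht : 0 ≤ t) (hY : 0 ≤ Y) : √(t + Y) - √t ≤ √Y := by
  have := sqrt_add_le ht hY
  linarith

theorem sqrt_add_sub_le_div {t Y : ℝ} (ht : 0 < t) (hY : 0 ≤ Y) :
    2 * (√(t + Y) - √t) ≤ Y / √t := by
  have h1 : 0 < √t := Real.sqrt_pos.2 ht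
  rw [le_div_iff₀ h1]
  nlinarith [Real.sq_sqrt ht.le, Real.sq_sqrt (show 0 ≤ t + Y by linarith),
    sq_nonneg (√(t + Y) - √t)]

/-- The relative gain of a window of length `Y` that starts late. -/
theorem sqrt_add_sub_le_mul {t Y u : ℝ} (ht : 0 ≤ t) (hY : 0 ≤ Y)
    (h : u * (√Y + √t) ≤ √t) : √(t + Y) - √t ≤ (1 - u) * √Y := by
  have h1 := sqrt_add_le ht hY
  set a := √t with ha
  set b := √Y with hb
  set c := √(t + Y) with hcc
  have ea : a ^ 2 = t := Real.sq_sqrt ht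
  have eb : b ^ 2 = Y := Real.sq_sqrt hY
  have ec : c ^ 2 = t + Y := Real.sq_sqrt (by linarith)
  have a0 : 0 ≤ a := Real.sqrt_nonneg _
  have b0 : 0 ≤ b := Real.sqrt_nonneg _
  have c0 : 0 ≤ c := Real.sqrt_nonneg _
  rcases eq_or_lt_of_le (add_nonneg b0 a0) with h0 | h0
  · have : a = 0 := by linarith
    have hb' : b = 0 := by linarith
    rw [hb', mul_zero]
    linarith
  -- `(b + a - c) (b + a + c) = 2 a b`
  have h2 : a * b ≤ (b + a - c) * (b + a) := by
    have : (b + a - c) * (b + a + c) = 2 * (a * b) := by nlinarith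
    nlinarith [mul_nonneg (show 0 ≤ b + a - c by linarith) (show 0 ≤ b + a - c by linarith)]
  have h3 : u * b * (b + a) ≤ (b + a - c) * (b + a) := by nlinarith
  have := le_of_mul_le_mul_right h3 h0
  linarith

theorem exp_sub_one_le {x : ℝ} (h0 : 0 ≤ x) (h1 : x ≤ 1) : Real.exp x - 1 ≤ x + x ^ 2 := by
  have := Real.abs_exp_sub_one_sub_id_le (show |x| ≤ 1 by rwa [abs_of_nonneg h0])
  have := (abs_le.1 this).2
  linarith

section

variable {K T : ℕ} {c₀ : ℝ}

/-- Inequalities for large horizons that are used to control the exploration. -/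
structure RareScales (T : ℕ) (c₀ : ℝ) : Prop where
  time_le : (explorationTime c₀ : ℝ) ≤ 2 * Real.log T
  rate : ∀ s : ℕ, 2304 * c₀ ^ 3 * Real.log T ^ 3 ≤ s →
    Real.log (2 * s) ≤ (1 / 200) ^ 2 * (s : ℝ) ^ (1 / 3 : ℝ)
  long : 64 * (1 + 6 * √(testConst c₀) * Real.log T) ^ 4 ≤ c₀ ^ 2 * Real.log T ^ 5
  short_early : Real.log (4 * Real.log T ^ 8) ≤
    Real.exp (-(1 + 1 / c₀ ^ 2)) ^ 2 * Real.log T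
  short_late : 1 ≤ 2 * Real.exp (-(1 + 1 / c₀ ^ 2)) * Real.log T

/-- For tests the bound `2 c₀ √(log(2 T)) (√(t + Y) - √t)` for the mean approaches the threshold `k`
as `t / Y` becomes small, so three regimes are distinguished. If `Y ≤ 4 c₀² log(2 T)`, then `k ≥ Y`
and nothing is to show. If `Y ≥ log⁶ T`, then `Y` is at most a multiple of `t log² T`, so the mean
stays below `k` by a relative margin `u` of order `1 / log T`, and `k` is large enough to exploit
it. In between the mean is even below `η k` for a small constant `η`. -/
theorem RareScales.rareExploration (hr : RareScales T c₀) (h : Scales K T c₀)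
    (hL : Large K T c₀ (1 / T)) : RareExploration K T c₀ (1 / T) := by
  have hl4 := h.log_ge
  have hc := h.c₀_pos
  set l := Real.log T with hl
  have hT := h.T_pos
  have hl2 : l ≤ Real.log (2 * T) := Real.log_le_log hT (by linarith)
  -- The rate `1 / (200 log T)` suits the windows of searches: `exp 3 * searchRounds * q` is at most
  -- `21 * 7 / 200`.
  refine ⟨hr.time_le, hr.time_le.trans hL.log_T_le, ⟨1 / (200 * l), by positivity, ?_, ?_, ?_⟩, ?_⟩
  · rw [mul_one_div, div_le_one (by positivity)]
    linarith
  · have h1 := h.rounds_le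
    have h2 : Real.exp 3 ≤ 21 := by
      have := Real.exp_one_lt_d9
      rw [show (3 : ℝ) = (3 : ℕ) * 1 by norm_num, Real.exp_nat_mul]
      calc Real.exp 1 ^ 3 ≤ 2.7183 ^ 3 := by gcongr; linarith
        _ ≤ 21 := by norm_num
    calc Real.exp 3 * searchRounds T * (1 / (200 * l)) ≤ 21 * (7 * l) * (1 / (200 * l)) := by gcongr
      _ = 147 / 200 := by field_simp; norm_num
      _ ≤ 1 := by norm_num
  · intro s hs
    have hs1 : 2304 * c₀ ^ 3 * l ^ 3 ≤ s := by
      refine le_trans ?_ (h.first_ge.trans hs)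
      calc 2304 * c₀ ^ 3 * l ^ 3 = 2304 * c₀ ^ 3 * 1 * l ^ 3 := by ring
        _ ≤ _ := by gcongr; exact h.K_ge
    have hs0 : (0 : ℝ) < s := lt_of_lt_of_le (by positivity) hs1
    have h1 := hr.rate s hs1
    have h2 : (c₀ * l) ^ 2 ≤ (s : ℝ) ^ (2 / 3 : ℝ) := by
      have e4 : ((c₀ * l) ^ 3) ^ (2 / 3 : ℝ) = (c₀ * l) ^ 2 := by
        rw [← Real.rpow_natCast, ← Real.rpow_mul (by positivity)]
        norm_num
      rw [← e4]
      refine Real.rpow_le_rpow (by positivity) (le_trans ?_ hs1) (by norm_num)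
      rw [mul_pow]
      nlinarith [show 0 ≤ c₀ ^ 3 * l ^ 3 by positivity]
    have h3 : Real.log (2 * s) / s ≤ (1 / 200 / (c₀ * l)) ^ 2 := by
      rw [div_pow, div_le_div_iff₀ hs0 (by positivity)]
      calc Real.log (2 * s) * (c₀ * l) ^ 2 ≤
          (1 / 200) ^ 2 * (s : ℝ) ^ (1 / 3 : ℝ) * (s : ℝ) ^ (2 / 3 : ℝ) := by gcongr
        _ = (1 / 200) ^ 2 * (s : ℝ) := by
          rw [mul_assoc, ← Real.rpow_add hs0]
          norm_num
    calc c₀ * √(Real.log (2 * s) / s) ≤ c₀ * √((1 / 200 / (c₀ * l)) ^ 2) := by gcongr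
      _ = 1 / (200 * l) := by
        rw [Real.sqrt_sq (by positivity)]
        field_simp
  · intro t Y ht hY htY
    have ht0 : (0 : ℝ) < t := by linarith
    have hY0 : (0 : ℝ) ≤ Y := by positivity
    set b := Real.log (2 * T) with hb
    have hb0 : 0 < b := by linarith
    set k := 2 * c₀ * √(Y * b) with hk
    have hk0 : 0 ≤ k := by positivity
    have hk' : k = 2 * c₀ * (√Y * √b) := by rw [hk, Real.sqrt_mul hY0]
    have hthr : k ≤ threshold K T c₀ (1 / T) Y := by
      rw [threshold]
      have := Real.sqrt_nonneg (8 * Real.log (iota K T (1 / T)) / Y)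
      linarith
    have hlogle : ∀ s ∈ Finset.Ico (t + 1) (t + Y + 1), Real.log (2 * s) ≤ b := by
      intro s hs
      have hs' := Finset.mem_Ico.1 hs
      have : (0 : ℝ) < s := by exact_mod_cast (by omega : 0 < s)
      apply Real.log_le_log (by positivity)
      have : (s : ℝ) ≤ T := by exact_mod_cast (by omega : s ≤ T)
      linarith
    have hsum := sum_rate_le_sqrt hc.le t Y hlogle
    suffices hs : (Y : ℝ) ≤ k ∨ ∃ r m : ℝ, 0 ≤ r ∧
        ∑ s ∈ Finset.Ico (t + 1) (t + Y + 1), c₀ * √(Real.log (2 * s) / s) ≤ m ∧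
        (Real.exp r - 1) * m - r * k ≤ -4 * l by
      rcases hs with hs | ⟨r, m, h1, h2, h3⟩
      · exact Or.inl (hs.trans hthr)
      · refine Or.inr ⟨r, m, h1, h2, ?_⟩
        have := mul_le_mul_of_nonneg_left hthr h1
        linarith
    rcases le_or_gt ((Y : ℝ)) (4 * c₀ ^ 2 * b) with hA | hA
    · left
      have : √(Y : ℝ) ≤ 2 * c₀ * √b := by
        apply Real.sqrt_le_iff.2
        refine ⟨by positivity, ?_⟩
        rw [mul_pow, mul_pow, Real.sq_sqrt hb0.le]
        linarith
      calc (Y : ℝ) = √Y * √Y := (Real.mul_self_sqrt hY0).symm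
        _ ≤ 2 * c₀ * √b * √Y := by gcongr
        _ = k := by rw [hk']; ring
    right
    rcases le_or_gt (l ^ 6) (Y : ℝ) with hB | hB
    · -- long windows
      set g := 1 + 6 * √(testConst c₀) * l with hg
      have hg1 : 1 ≤ g := by
        have : 0 ≤ 6 * √(testConst c₀) * l := by positivity
        linarith
      set u := 1 / g with hu
      have hu0 : 0 < u := by positivity
      have hu1 : u ≤ 1 := by rw [hu, div_le_one (by linarith)]; exact hg1
      have hYt : √(Y : ℝ) ≤ 6 * √(testConst c₀) * l * √t := by
        apply Real.sqrt_le_iff.2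
        refine ⟨by positivity, hY.trans ?_⟩
        have hC : 0 ≤ testConst c₀ := by unfold testConst; positivity
        have e0 : 0 ≤ Real.log (iota K T (1 / T)) := by linarith [h.iota_ge]
        have e1 := h.iota_le
        rw [mul_pow, mul_pow, mul_pow, Real.sq_sqrt hC, Real.sq_sqrt ht0.le]
        calc _ ≤ testConst c₀ * (6 * l) ^ 2 * t := by gcongr
          _ = _ := by ring
      have hgain : √(t + Y : ℝ) - √t ≤ (1 - u) * √Y := by
        refine sqrt_add_sub_le_mul ht0.le hY0 ?_
        rw [hu, one_div, inv_mul_le_iff₀ (by linarith), hg]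
        linarith
      -- Half of the relative margin as Chernoff parameter gains `k u² / 4`, which is at least `4
      -- log T` because `16 log T ≤ k u²`.
      refine ⟨u / 2, (1 - u) * k, by positivity, hsum.trans ?_, ?_⟩
      · calc c₀ * √b * (2 * (√(t + Y : ℝ) - √t)) ≤ c₀ * √b * (2 * ((1 - u) * √Y)) := by gcongr
          _ = (1 - u) * k := by rw [hk']; ring
      · have e1 := exp_sub_one_le (x := u / 2) (by positivity) (by linarith)
        have e2 : (Real.exp (u / 2) - 1) * ((1 - u) * k) ≤
            (u / 2 + (u / 2) ^ 2) * ((1 - u) * k) := by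
          have : 0 ≤ 1 - u := by linarith
          gcongr
        have e3 : (u / 2 + (u / 2) ^ 2) * ((1 - u) * k) - u / 2 * k ≤ -(k * u ^ 2 / 4) := by
          have : 0 ≤ k * u ^ 3 := by positivity
          nlinarith
        have e4 : 16 * l ≤ k * u ^ 2 := by
          have h5 := hr.long
          rw [← hl, ← hg] at h5
          have h6 : 8 * g ^ 2 * l ≤ c₀ * √(Y * b) := by
            refine (pow_le_pow_iff_left₀ (by positivity) (by positivity) two_ne_zero).1 ?_
            rw [mul_pow c₀, Real.sq_sqrt (by positivity)]
            calc (8 * g ^ 2 * l) ^ 2 = 64 * g ^ 4 * l ^ 2 := by ring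
              _ ≤ c₀ ^ 2 * l ^ 5 * l ^ 2 := by gcongr
              _ = c₀ ^ 2 * (l ^ 6 * l) := by ring
              _ ≤ _ := by gcongr
          rw [hu, div_pow, one_pow, mul_one_div, le_div_iff₀ (by positivity)]
          linarith
        linarith
    · -- short windows
      set η := Real.exp (-(1 + 1 / c₀ ^ 2)) with hη
      have hη0 : 0 < η := Real.exp_pos _
      -- Since `η = exp (-r)`, the term `exp r * m` is just `k`. The exponent is then at most `-k /
      -- c₀²`, and `k ≥ 4 c₀² log(2 T)` in this regime.
      refine ⟨1 + 1 / c₀ ^ 2, η * k, by positivity, ?_, ?_⟩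
      -- In early windows the round numbers are polynomial in `log T`, so `log(2 s)` is far below
      -- `log T`. In late windows `Y / √t` is far below `√Y`.
      · rcases le_or_gt ((t : ℝ)) (l ^ 8) with hC | hC
        · have : ∀ s ∈ Finset.Ico (t + 1) (t + Y + 1), Real.log (2 * s) ≤ η ^ 2 * l := by
            intro s hs
            have hs' := Finset.mem_Ico.1 hs
            have h0 : (0 : ℝ) < s := by exact_mod_cast (by omega : 0 < s)
            refine (Real.log_le_log (by positivity) ?_).trans hr.short_early
            have h1 : (s : ℝ) ≤ t + Y := by exact_mod_cast (by omega : s ≤ t + Y)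
            have h2 : l ^ 6 ≤ l ^ 8 := pow_le_pow_right₀ (by linarith) (by norm_num)
            linarith
          refine (sum_rate_le_sqrt hc.le t Y this).trans ?_
          rw [Real.sqrt_mul (by positivity), Real.sqrt_sq hη0.le, hk']
          calc c₀ * (η * √l) * (2 * (√(t + Y : ℝ) - √t)) ≤ c₀ * (η * √b) * (2 * √Y) := by
                have := sqrt_add_sub_le ht0.le hY0
                have : √t ≤ √(t + Y : ℝ) := Real.sqrt_le_sqrt (by linarith)
                have : 0 ≤ √(t + Y : ℝ) - √t := by linarith
                gcongr
            _ = _ := by ring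
        · refine hsum.trans ?_
          have h1 := sqrt_add_sub_le_div ht0 hY0
          have h2 : √(Y : ℝ) ≤ 2 * η * √t := by
            apply Real.sqrt_le_iff.2
            refine ⟨by positivity, hB.le.trans ?_⟩
            rw [mul_pow, Real.sq_sqrt ht0.le]
            have h3 := hr.short_late
            have h4 : 1 ≤ (2 * η * l) ^ 2 := one_le_pow₀ h3
            calc l ^ 6 = 1 * l ^ 6 := by ring
              _ ≤ (2 * η * l) ^ 2 * l ^ 6 := by gcongr
              _ = (2 * η) ^ 2 * l ^ 8 := by ring
              _ ≤ _ := by gcongr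
          have h3 : Y / √(t : ℝ) ≤ 2 * η * √Y := by
            rw [div_le_iff₀ (Real.sqrt_pos.2 ht0)]
            calc (Y : ℝ) = √Y * √Y := (Real.mul_self_sqrt hY0).symm
              _ ≤ 2 * η * √t * √Y := by gcongr
              _ = _ := by ring
          calc _ ≤ c₀ * √b * (2 * η * √Y) := by
                have := h1.trans h3
                gcongr
            _ = η * k := by rw [hk']; ring
      · have e1 : (Real.exp (1 + 1 / c₀ ^ 2) - 1) * (η * k) =
            Real.exp (1 + 1 / c₀ ^ 2) * η * k - η * k := by ring
        have e2 : Real.exp (1 + 1 / c₀ ^ 2) * η = 1 := by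
          rw [hη, ← Real.exp_add]; simp
        rw [e1, e2]
        have e3 : 4 * c₀ ^ 2 * b ≤ k := by
          have : 2 * c₀ * √b ≤ √Y := by
            apply Real.le_sqrt_of_sq_le
            rw [mul_pow, mul_pow, Real.sq_sqrt hb0.le]
            linarith
          calc 4 * c₀ ^ 2 * b = 2 * c₀ * (2 * c₀ * (√b * √b)) := by
                rw [Real.mul_self_sqrt hb0.le]; ring
            _ = 2 * c₀ * (2 * c₀ * √b * √b) := by ring
            _ ≤ 2 * c₀ * (√Y * √b) := by gcongr
            _ = k := hk'.symm
        have e4 : 4 * b ≤ 1 / c₀ ^ 2 * k := by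
          calc 4 * b = 1 / c₀ ^ 2 * (4 * c₀ ^ 2 * b) := by field_simp
            _ ≤ _ := by gcongr
        have : 0 ≤ η * k := by positivity
        linarith

end

end Exploratory

/-! ### Large horizons -/

namespace Exploratory

open Filter Topology

theorem tendsto_log_natCast : Tendsto (fun T : ℕ => Real.log T) atTop atTop :=
  Real.tendsto_log_atTop.comp tendsto_natCast_atTop_atTop

theorem eventually_log_two_mul_le {ε : ℝ} (hε : 0 < ε) {p : ℝ} (hp : 0 < p) :
    ∀ᶠ s : ℝ in atTop, Real.log (2 * s) ≤ ε * s ^ p := by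
  have h1 := (isLittleO_log_rpow_atTop hp).bound (show 0 < ε / 2 by positivity)
  have h2 : ∀ᶠ s : ℝ in atTop, 2 * Real.log 2 / ε ≤ s ^ p :=
    (tendsto_rpow_atTop hp).eventually_ge_atTop _
  filter_upwards [h1, h2, eventually_ge_atTop 1] with s h1 h2 h3
  rw [Real.norm_of_nonneg (Real.log_nonneg h3), Real.norm_of_nonneg (by positivity)] at h1
  rw [Real.log_mul (by norm_num) (by linarith)]
  rw [div_le_iff₀ hε] at h2
  linarith

theorem eventually_rareScales {c₀ : ℝ} (hc : 0 < c₀) : ∀ᶠ T : ℕ in atTop, RareScales T c₀ := by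
  have hl := tendsto_log_natCast
  obtain ⟨s₀, hs₀⟩ := eventually_atTop.1 (eventually_log_two_mul_le
    (show (0 : ℝ) < (1 / 200) ^ 2 by positivity) (show (0 : ℝ) < 1 / 3 by norm_num))
  have hη : 0 < Real.exp (-(1 + 1 / c₀ ^ 2)) := Real.exp_pos _
  set η := Real.exp (-(1 + 1 / c₀ ^ 2)) with hηd
  obtain ⟨s₁, hs₁⟩ := eventually_atTop.1 (eventually_log_two_mul_le
    (show (0 : ℝ) < η ^ 2 / 8 by positivity) (show (0 : ℝ) < 1 by norm_num))
  set g := 1 + 6 * √(testConst c₀) with hg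
  filter_upwards [hl.eventually_ge_atTop (explorationTime c₀), hl.eventually_ge_atTop 1,
    hl.eventually_ge_atTop (s₀ / (2304 * c₀ ^ 3)), hl.eventually_ge_atTop (64 * g ^ 4 / c₀ ^ 2),
    hl.eventually_ge_atTop s₁, hl.eventually_ge_atTop (1 / (2 * η))] with T h1 h2 h3 h4 h5 h6
  set l := Real.log T
  refine ⟨by linarith, fun s hs => hs₀ s (le_trans ?_ hs), ?_, ?_, ?_⟩
  · rw [div_le_iff₀ (by positivity)] at h3
    have : l ≤ l ^ 3 := le_self_pow₀ h2 (by norm_num)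
    calc s₀ ≤ l * (2304 * c₀ ^ 3) := h3
      _ ≤ l ^ 3 * (2304 * c₀ ^ 3) := by gcongr
      _ = _ := by ring
  · rw [div_le_iff₀ (by positivity)] at h4
    have h7 : 1 + 6 * √(testConst c₀) * l ≤ g * l := by
      rw [hg]; nlinarith
    calc 64 * (1 + 6 * √(testConst c₀) * l) ^ 4 ≤ 64 * (g * l) ^ 4 := by gcongr
      _ = 64 * g ^ 4 * l ^ 4 := by ring
      _ ≤ l * c₀ ^ 2 * l ^ 4 := by gcongr
      _ = _ := by ring
  · have h8 := hs₁ l h5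
    rw [Real.rpow_one] at h8
    have : Real.log (4 * l ^ 8) ≤ Real.log ((2 * l) ^ 8) := by
      apply Real.log_le_log (by positivity)
      have : 0 ≤ l ^ 8 := by positivity
      rw [mul_pow]
      linarith
    rw [Real.log_pow] at this
    push_cast at this
    linarith
  · rw [div_le_iff₀ (by positivity)] at h6
    linarith

/-- The only use of `κ`: from `κ K ≤ T` and `T ≥ 512 / κ` follows `512 K ≤ T²`, with a bound on `T`
that does not depend on `K`. -/
theorem eventually_scales {κ c₀ : ℝ} (hκ : 0 < κ) (hc : 0 < c₀) :
    ∀ᶠ T : ℕ in atTop, ∀ K : ℕ, 1 ≤ K → κ * K ≤ T → Scales K T c₀ := by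
  filter_upwards [tendsto_log_natCast.eventually_ge_atTop 4,
    (tendsto_natCast_atTop_atTop (R := ℝ)).eventually_ge_atTop (512 / κ)] with T h1 h2 K hK hKT
  refine scales hc hK h1 ?_
  rw [div_le_iff₀ hκ] at h2
  have hK1 : (1 : ℝ) ≤ K := by exact_mod_cast hK
  have hT0 : (0 : ℝ) ≤ T := by positivity
  calc 512 * (K : ℝ) ≤ T * κ * K := by gcongr
    _ = T * (κ * K) := by ring
    _ ≤ T * T := by gcongr
    _ = _ := by ring

theorem eventually_sizes {c₀ : ℝ} (hc : 0 < c₀) : ∀ᶠ T : ℕ in atTop,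
    1 ≤ c₀ * Real.log T ∧ (64 * c₀ ^ 2 + 128) * 6 ≤ c₀ ^ 3 * Real.log T ^ 2 ∧
      4 ≤ c₀ ^ 2 * Real.log T ∧ 35 * (64 * c₀ ^ 2 + 128) ≤ c₀ ^ 3 * Real.log T := by
  have hl := tendsto_log_natCast
  filter_upwards [hl.eventually_ge_atTop (1 / c₀), hl.eventually_ge_atTop (4 / c₀ ^ 2),
    hl.eventually_ge_atTop (35 * (64 * c₀ ^ 2 + 128) / c₀ ^ 3), hl.eventually_ge_atTop 1] with
    T h1 h2 h3 h4
  rw [div_le_iff₀ (by positivity)] at h1 h2 h3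
  refine ⟨by linarith, ?_, by linarith, by linarith⟩
  have h5 : Real.log T ≤ Real.log T ^ 2 := le_self_pow₀ h4 (by norm_num)
  have h6 : Real.log T * c₀ ^ 3 ≤ Real.log T ^ 2 * c₀ ^ 3 := by gcongr
  nlinarith [sq_nonneg c₀]

/-! ### The cost of a phase in terms of `log T` -/

section

variable {K T : ℕ} {c₀ : ℝ} {m : ℕ} {act : Finset (Fin K)}

namespace Scales

variable (h : Scales K T c₀) (hL : Large K T c₀ (1 / T))
  (hx : 35 * (64 * c₀ ^ 2 + 128) ≤ c₀ ^ 3 * Real.log T)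

include h in
theorem calls_mul_rounds_le : (searchCalls T (1 / T) * searchRounds T : ℝ) ≤ 35 * Real.log T ^ 2 := by
  have h1 := h.log_ge
  have h2 := h.calls_le
  have h3 := h.rounds_le
  calc (searchCalls T (1 / T) * searchRounds T : ℝ) ≤ 5 * Real.log T * (7 * Real.log T) := by gcongr
    _ = _ := by ring

include h hx in
theorem sq_log_le_first : Real.log T ^ 2 ≤ phaseLength K T c₀ (1 / T) 1 ∧
    35 * (64 * c₀ ^ 2 + 128) * Real.log T ^ 2 ≤ phaseLength K T c₀ (1 / T) 1 := by
  have hl := h.log_ge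
  have hc := h.c₀_pos
  have hK := h.K_ge
  have h1 : 35 * (64 * c₀ ^ 2 + 128) * Real.log T ^ 2 ≤ phaseLength K T c₀ (1 / T) 1 := by
    refine le_trans ?_ h.first_ge
    calc _ ≤ c₀ ^ 3 * Real.log T * Real.log T ^ 2 := by gcongr
      _ = 1 * (c₀ ^ 3 * 1 * Real.log T ^ 3) := by ring
      _ ≤ 2304 * (c₀ ^ 3 * K * Real.log T ^ 3) := by gcongr; norm_num
      _ = _ := by ring
  refine ⟨le_trans ?_ h1, h1⟩
  nlinarith [sq_nonneg (Real.log T), sq_nonneg c₀, sq_nonneg (c₀ * Real.log T)]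

include h hL hx

/-- By `hx` the rounds that are not paid for by plays, at most `searchCalls * (halfLength + 3)`,
number at most `T_m`, so the tests of an arm last `O(T_m)` rounds. Misses add `log T √T_m`. -/
theorem testCost_le (hm : 1 ≤ m) {e : ℝ} (he : 0 ≤ e) :
    testCost K T c₀ (1 / T) m e ≤ 9 * e * phaseLength K T c₀ (1 / T) m +
      (162 + 15 * c₀ ^ 2) * (Real.log T * √(phaseLength K T c₀ (1 / T) m)) +
      75 * Real.log T ^ 2 := by
  have hl := h.log_ge
  have hc := h.c₀_pos
  have hP1 := hL.one_le m
  have hP := hL.first_le hm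
  have hhalf := h.halfLength_le
  have hr := h.calls_le
  have hI0 := hL.one_le_log_iota
  have hI := h.iota_le
  have hh0 := halfLength_nonneg hL
  have hfirst := (h.sq_log_le_first hx).2
  unfold testCost
  set P := phaseLength K T c₀ (1 / T) m
  set I := Real.log (iota K T (1 / T))
  set r : ℝ := (searchCalls T (1 / T) : ℝ)
  set l := Real.log T
  have hr0 : 0 ≤ r := by positivity
  have hs : 0 < √P := Real.sqrt_pos.2 (by linarith)
  have hsq : √P * √P = P := Real.mul_self_sqrt (by linarith)
  have e1 : r * (halfLength K T c₀ (1 / T) + 3) ≤ P := by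
    calc r * (halfLength K T c₀ (1 / T) + 3) ≤ 5 * l * ((64 * c₀ ^ 2 + 128) * (6 * l) + l) := by
          gcongr
          linarith
      _ ≤ 5 * l * ((64 * c₀ ^ 2 + 128) * (6 * l) + (64 * c₀ ^ 2 + 128) * l) := by
          gcongr
          nlinarith [sq_nonneg c₀]
      _ = 35 * (64 * c₀ ^ 2 + 128) * l ^ 2 := by ring
      _ ≤ P := hfirst.trans hP
  have e2 : c₀ ^ 2 * I / (I / √P) = c₀ ^ 2 * √P := by field_simp
  have e3 : I / √P * P = I * √P := by
    rw [div_mul_eq_mul_div, div_eq_iff hs.ne', mul_assoc, hsq]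
  have e4 : √(8 * I) ≤ 4 * l := by
    apply Real.sqrt_le_iff.2
    refine ⟨by linarith, ?_⟩
    nlinarith
  simp only
  rw [e2]
  have e5 : 0 ≤ I / √P := by positivity
  calc (e + 3 * (I / √P)) * (r * (halfLength K T c₀ (1 / T) + 3) + 2 * (3 * P + 1)) +
        r * (3 * (c₀ ^ 2 * √P + √(8 * I) + 1)) ≤
        (e + 3 * (I / √P)) * (9 * P) + 5 * l * (3 * (c₀ ^ 2 * √P + 4 * l + l)) := by
        gcongr
        · linarith
        · linarith
    _ = 9 * e * P + 27 * (I / √P * P) + 15 * c₀ ^ 2 * (l * √P) + 75 * l ^ 2 := by ring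
    _ ≤ 9 * e * P + 27 * (6 * l * √P) + 15 * c₀ ^ 2 * (l * √P) + 75 * l ^ 2 := by
        rw [e3]; gcongr
    _ = _ := by ring

/-- In phase one a play may cost a constant, so the cost is of order `K T_1`, that is `K² log³ T`.
-/
theorem phaseCost_first_le : phaseCost K T c₀ (1 / T) 1 Finset.univ ≤
    ((264 + 15 * c₀ ^ 2) * (18432 * c₀ ^ 3) + 433) * (K ^ 2 * Real.log T ^ 3) := by
  have hl := h.log_ge
  have hc := h.c₀_pos
  have hK := h.K_ge
  have h1 := h.testCost_le hL hx le_rfl (show (0 : ℝ) ≤ 3 by norm_num)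
  have h2 := (h.sq_log_le_first hx).1
  have h3 := h.first_le
  have h4 := h.calls_mul_rounds_le
  have h5 := h.keep_le
  have h6 := hL.one_le_first
  rw [phaseCost, perPlay, if_pos rfl, Finset.compl_univ, Finset.card_empty, Finset.card_univ,
    Fintype.card_fin]
  set P := phaseLength K T c₀ (1 / T) 1
  set l := Real.log T
  have hs : l ≤ √P := Real.le_sqrt_of_sq_le h2
  have hsq : √P * √P = P := Real.mul_self_sqrt (by linarith)
  have e1 : l * √P ≤ P := by
    calc l * √P ≤ √P * √P := by gcongr
      _ = P := hsq
  have e2 : testCost K T c₀ (1 / T) 1 3 ≤ (264 + 15 * c₀ ^ 2) * P := by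
    have : (162 + 15 * c₀ ^ 2) * (l * √P) ≤ (162 + 15 * c₀ ^ 2) * P := by gcongr
    linarith
  have hKK : (K : ℝ) ≤ K ^ 2 := le_self_pow₀ hK (by norm_num)
  have hl23 : l ^ 2 ≤ l ^ 3 := pow_le_pow_right₀ (by linarith) (by norm_num)
  have hl13 : l ≤ l ^ 3 := le_self_pow₀ (by linarith) (by norm_num)
  calc 3 * (((0 : ℕ) : ℝ) * stabilizeRounds K T c₀ (1 / T) 1 Finset.univ) +
        2 * (K * (searchCalls T (1 / T) * searchRounds T)) +
        K * testCost K T c₀ (1 / T) 1 3 + K * ((1 + 10 * K) * keepRounds K T (1 / T)) ≤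
        3 * (((0 : ℕ) : ℝ) * stabilizeRounds K T c₀ (1 / T) 1 Finset.univ) +
        2 * (K * (35 * l ^ 2)) +
        K * ((264 + 15 * c₀ ^ 2) * (18432 * c₀ ^ 3 * K * l ^ 3)) +
        K * ((K + 10 * K) * (33 * l)) := by
        have := e2.trans (mul_le_mul_of_nonneg_left h3 (by positivity))
        gcongr
    _ = 70 * (K * l ^ 2) + (264 + 15 * c₀ ^ 2) * (18432 * c₀ ^ 3) * (K ^ 2 * l ^ 3) +
        363 * (K ^ 2 * l) := by push_cast; ring
    _ ≤ 70 * (K ^ 2 * l ^ 3) + (264 + 15 * c₀ ^ 2) * (18432 * c₀ ^ 3) * (K ^ 2 * l ^ 3) +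
        363 * (K ^ 2 * l ^ 3) := by gcongr
    _ = _ := by ring

end Scales

theorem card_compl_le (act : Finset (Fin K)) : actᶜ.card ≤ K := by
  simpa using Finset.card_le_univ actᶜ

namespace Scales

variable (h : Scales K T c₀) (hL : Large K T c₀ (1 / T))
  (hx : 35 * (64 * c₀ ^ 2 + 128) ≤ c₀ ^ 3 * Real.log T)

include h

/-- From `L ≤ 4 log T ≤ log² T` comes the power `2 / 3` of the logarithm; the `O(log T)` phases
raise it to `5 / 3`. -/
theorem conf_rpow_mul_le {x y : ℝ} (hx0 : 0 ≤ x) (hxT : x ≤ T) (hy0 : 0 ≤ y) (hyK : y ≤ K) :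
    confLog K T (1 / T) ^ (1 / 3 : ℝ) * y ^ (1 / 3 : ℝ) * x ^ (2 / 3 : ℝ) ≤
      Real.log T ^ (2 / 3 : ℝ) * (K : ℝ) ^ (1 / 3 : ℝ) * (T : ℝ) ^ (2 / 3 : ℝ) := by
  have hl := h.log_ge
  have h1 := h.conf_ge
  have h2 := h.conf_le
  have e1 : confLog K T (1 / T) ^ (1 / 3 : ℝ) ≤ Real.log T ^ (2 / 3 : ℝ) := by
    calc _ ≤ (Real.log T ^ (2 : ℝ)) ^ (1 / 3 : ℝ) := by
          refine Real.rpow_le_rpow (by linarith) ?_ (by norm_num)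
          rw [Real.rpow_two]
          nlinarith
      _ = _ := by rw [← Real.rpow_mul (by linarith)]; norm_num
  gcongr

include hL

/-- With `x = |A_m| T_{m-1}` and `y = max 1 |B_m|` the left side is `L^{1/3} y^{1/3} x^{2/3}`. -/
theorem conf_mul_ratio_le (hact : act.Nonempty)
    (hP : act.card * phaseLength K T c₀ (1 / T) (m - 1) ≤ T) :
    act.card * phaseLength K T c₀ (1 / T) (m - 1) *
      (confLog K T (1 / T) * ratio K T c₀ (1 / T) m act) ^ (1 / 3 : ℝ) ≤
      Real.log T ^ (2 / 3 : ℝ) * (K : ℝ) ^ (1 / 3 : ℝ) * (T : ℝ) ^ (2 / 3 : ℝ) := by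
  have hn : (0 : ℝ) < act.card := by exact_mod_cast hact.card_pos
  have hP1 := hL.one_le (m - 1)
  have hl := h.log_ge
  have h1 := h.conf_ge
  have hy : ((max 1 actᶜ.card : ℕ) : ℝ) ≤ K := by
    exact_mod_cast max_le h.one_le_K (card_compl_le act)
  refine le_trans (le_of_eq ?_) (h.conf_rpow_mul_le (by positivity) hP (by positivity) hy)
  rw [ratio]
  set P := phaseLength K T c₀ (1 / T) (m - 1)
  set y : ℝ := ((max 1 actᶜ.card : ℕ) : ℝ)
  have hx0 : 0 < act.card * P := by positivity
  have hy0 : 0 ≤ y := by positivity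
  have hL0 : 0 ≤ confLog K T (1 / T) := by linarith
  rw [mul_comm P, ← mul_div_assoc, Real.div_rpow (by positivity) hx0.le,
    Real.mul_rpow hL0 hy0, show (2 / 3 : ℝ) = 1 - 1 / 3 by norm_num, Real.rpow_sub hx0,
    Real.rpow_one]
  ring

/-- The product of `conf_mul_ratio_le` again: stabilization costs as much as the inaccuracy that it
leaves. Rounding up adds one round per bad arm. -/
theorem card_mul_stabilizeRounds_le (hact : act.Nonempty)
    (hP : act.card * phaseLength K T c₀ (1 / T) (m - 1) ≤ T) :
    (actᶜ.card * stabilizeRounds K T c₀ (1 / T) m act : ℝ) ≤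
      2 * (Real.log T ^ (2 / 3 : ℝ) * (K : ℝ) ^ (1 / 3 : ℝ) * (T : ℝ) ^ (2 / 3 : ℝ)) + K := by
  have hn : (0 : ℝ) < act.card := by exact_mod_cast hact.card_pos
  have hP1 := hL.one_le (m - 1)
  have hl := h.log_ge
  have h1 := h.conf_ge
  have hy : ((max 1 actᶜ.card : ℕ) : ℝ) ≤ K := by
    exact_mod_cast max_le h.one_le_K (card_compl_le act)
  have hy1 : ((1 : ℕ) : ℝ) ≤ ((max 1 actᶜ.card : ℕ) : ℝ) := by exact_mod_cast le_max_left _ _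
  have hby : ((actᶜ.card : ℕ) : ℝ) ≤ ((max 1 actᶜ.card : ℕ) : ℝ) := by
    exact_mod_cast le_max_right _ _
  have hmain := h.conf_rpow_mul_le (x := act.card * phaseLength K T c₀ (1 / T) (m - 1))
    (by positivity) hP (by positivity) hy
  rw [stabilizeRounds]
  change (actᶜ.card * (⌈2 * confLog K T (1 / T) ^ (1 / 3 : ℝ) * _⌉₊ : ℕ) : ℝ) ≤ _
  set P := phaseLength K T c₀ (1 / T) (m - 1)
  set y : ℝ := ((max 1 actᶜ.card : ℕ) : ℝ)
  set x := act.card * P with hxd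
  have hx0 : 0 < x := by positivity
  have hy0 : 0 < y := by push_cast at hy1; linarith
  have hL0 : 0 ≤ confLog K T (1 / T) := by linarith
  have e0 : act.card / y * P = x / y := by rw [hxd]; ring
  rw [e0]
  have e1 := (Nat.ceil_lt_add_one (show 0 ≤ 2 * confLog K T (1 / T) ^ (1 / 3 : ℝ) *
    (x / y) ^ (2 / 3 : ℝ) by positivity)).le
  have e2 : y * (x / y) ^ (2 / 3 : ℝ) = y ^ (1 / 3 : ℝ) * x ^ (2 / 3 : ℝ) := by
    rw [Real.div_rpow hx0.le hy0.le, show (1 / 3 : ℝ) = 1 - 2 / 3 by norm_num,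
      Real.rpow_sub hy0, Real.rpow_one]
    ring
  calc _ ≤ y * (2 * confLog K T (1 / T) ^ (1 / 3 : ℝ) * (x / y) ^ (2 / 3 : ℝ) + 1) := by gcongr
    _ = 2 * (confLog K T (1 / T) ^ (1 / 3 : ℝ) * (y * (x / y) ^ (2 / 3 : ℝ))) + y := by ring
    _ ≤ _ := by
      rw [e2, ← mul_assoc (confLog K T (1 / T) ^ (1 / 3 : ℝ))]
      linarith

/-- The power `ρ^{2/3}` is absorbed by the cube root `(L ρ)^{1/3}` because `ρ ≤ 1 ≤ L`; the former
holds since `T_{m-1} ≥ K`. -/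
theorem perPlay_le (hm : 2 ≤ m) (hact : act.Nonempty) :
    perPlay K T c₀ (1 / T) m act ≤
      16 * √(confLog K T (1 / T) / phaseLength K T c₀ (1 / T) (m - 1)) +
      9 * (confLog K T (1 / T) * ratio K T c₀ (1 / T) m act) ^ (1 / 3 : ℝ) +
      (3 / T + 4 / phaseLength K T c₀ (1 / T) (m - 1)) := by
  have hP1 := hL.one_le (m - 1)
  have hl := h.log_ge
  have hL1 := hL.one_le_confLog
  have hρ := ratio_nonneg (m := m) (act := act) hL
  have hρ1 : ratio K T c₀ (1 / T) m act ≤ 1 := by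
    have hn : (1 : ℝ) ≤ act.card := by exact_mod_cast hact.card_pos
    have hy : ((max 1 actᶜ.card : ℕ) : ℝ) ≤ K := by
      exact_mod_cast max_le h.one_le_K (card_compl_le act)
    have hK := hL.K_le.trans (hL.first_le (m := m - 1) (by omega))
    rw [ratio, div_le_one (by positivity)]
    nlinarith
  rw [perPlay, if_neg (by omega), testCap, if_neg (by omega), slack, eps]
  change 10 * √(confLog K T (1 / T) / _) + (0 + 2 * ((confLog K T (1 / T) * _) ^ (1 / 3 : ℝ) +
    √(confLog K T (1 / T) / _)) + _ + _ + (_ + _ + 4 * ((confLog K T (1 / T) * _) ^ (1 / 3 : ℝ) +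
    √(confLog K T (1 / T) / _)))) ≤ _
  set P := phaseLength K T c₀ (1 / T) (m - 1)
  set L := confLog K T (1 / T)
  set ρ := ratio K T c₀ (1 / T) m act
  have e1 : √(L / (2 * P)) ≤ √(L / P) := by
    apply Real.sqrt_le_sqrt
    gcongr
    linarith
  have e2 : ρ ^ (2 / 3 : ℝ) ≤ (L * ρ) ^ (1 / 3 : ℝ) := by
    calc ρ ^ (2 / 3 : ℝ) ≤ ρ ^ (1 / 3 : ℝ) :=
          Real.rpow_le_rpow_of_exponent_ge' hρ hρ1 (by norm_num) (by norm_num)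
      _ ≤ _ := Real.rpow_le_rpow hρ (by nlinarith) (by norm_num)
  have e3 : 3 / P + 1 / P = 4 / P := by ring
  linarith

include hx

/-- The cost per play is multiplied by about `|A_m| T_{m-1}` plays. The square root part becomes
`√(K T)` by `|A_m| √T_{m-1} ≤ √(K T)`, the cube root part is `conf_mul_ratio_le`, and the rest is
`O(K)`. -/
theorem phaseCost_le (hm : 2 ≤ m) (hact : act.Nonempty)
    (hP : act.card * phaseLength K T c₀ (1 / T) (m - 1) ≤ T) :
    phaseCost K T c₀ (1 / T) m act ≤ (900 + 30 * c₀ ^ 2) *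
      (Real.log T ^ (2 / 3 : ℝ) * (K : ℝ) ^ (1 / 3 : ℝ) * (T : ℝ) ^ (2 / 3 : ℝ) +
        Real.log T * √(K * T) + K ^ 2 * Real.log T ^ 2) := by
  have hl := h.log_ge
  have hc := h.c₀_pos
  have hK := h.K_ge
  have hT := h.T_pos
  have hn : (1 : ℝ) ≤ act.card := by exact_mod_cast hact.card_pos
  have hnK : (act.card : ℝ) ≤ K := by exact_mod_cast card_finset_fin_le act
  have hP1 := hL.one_le (m - 1)
  have h1 := h.testCost_le (m := m) hL hx (by omega) (perPlay_nonneg (act := act) (m := m) hL)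
  have h2 := h.perPlay_le hL hm hact
  have h3 := h.conf_mul_ratio_le hL hact hP
  have h4 := h.card_mul_stabilizeRounds_le hL hact hP
  have h5 := h.calls_mul_rounds_le
  have h6 := h.keep_le
  have h7 := h.conf_le
  have h8 := h.conf_ge
  have h9 : phaseLength K T c₀ (1 / T) m = 4 * phaseLength K T c₀ (1 / T) (m - 1) := by
    obtain ⟨j, rfl⟩ : ∃ j, m = j + 1 := ⟨m - 1, by omega⟩
    exact phaseLength_succ (by omega)
  rw [phaseCost]
  rw [h9] at h1
  set P := phaseLength K T c₀ (1 / T) (m - 1)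
  set L := confLog K T (1 / T)
  set l := Real.log T
  set n : ℝ := (act.card : ℝ)
  set e := perPlay K T c₀ (1 / T) m act
  set G := l ^ (2 / 3 : ℝ) * (K : ℝ) ^ (1 / 3 : ℝ) * (T : ℝ) ^ (2 / 3 : ℝ)
  set q := (L * ratio K T c₀ (1 / T) m act) ^ (1 / 3 : ℝ)
  have hG : 0 ≤ G := by positivity
  have hS : 0 ≤ l * √(K * T) := by positivity
  have hsq : √P * √P = P := Real.mul_self_sqrt (by linarith)
  have hs0 : 0 < √P := Real.sqrt_pos.2 (by linarith)
  -- `n √P ≤ √(K T)`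
  have a1 : n * √P ≤ √(K * T) := by
    apply Real.le_sqrt_of_sq_le
    calc (n * √P) ^ 2 = n * (n * (√P * √P)) := by ring
      _ = n * (n * P) := by rw [hsq]
      _ ≤ K * T := by gcongr
  have a2 : √L ≤ l := Real.sqrt_le_iff.2 ⟨by linarith, by nlinarith⟩
  have a3 : n * P * √(L / P) ≤ l * √(K * T) := by
    rw [Real.sqrt_div (by linarith)]
    calc n * P * (√L / √P) = √L * (n * (P / √P)) := by ring
      _ = √L * (n * √P) := by rw [Real.div_sqrt]
      _ ≤ _ := by gcongr
  have a4 : n * P * e ≤ 16 * (l * √(K * T)) + 9 * G + (3 + 4 * K) := by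
    calc n * P * e ≤ n * P * (16 * √(L / P) + 9 * q + (3 / T + 4 / P)) := by gcongr
      _ = 16 * (n * P * √(L / P)) + 9 * (n * P * q) + (3 * (n * P / T) + 4 * n * (P / P)) := by ring
      _ ≤ _ := by
        have b1 : n * P / T ≤ 1 := by rw [div_le_one hT]; exact hP
        have b2 : P / P = 1 := div_self (by linarith)
        rw [b2]
        linarith
  have a5 : √(4 * P) = 2 * √P := by
    rw [Real.sqrt_mul (by norm_num), show (4 : ℝ) = 2 ^ 2 by norm_num, Real.sqrt_sq (by norm_num)]
  have a6 : n * testCost K T c₀ (1 / T) m e ≤ 36 * (16 * (l * √(K * T)) + 9 * G + (3 + 4 * K)) +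
      (324 + 30 * c₀ ^ 2) * (l * √(K * T)) + 75 * (K * l ^ 2) := by
    calc n * testCost K T c₀ (1 / T) m e ≤
        n * (9 * e * (4 * P) + (162 + 15 * c₀ ^ 2) * (l * √(4 * P)) + 75 * l ^ 2) := by gcongr
      _ = 36 * (n * P * e) + (324 + 30 * c₀ ^ 2) * (l * (n * √P)) + 75 * (n * l ^ 2) := by
        rw [a5]; ring
      _ ≤ _ := by gcongr
  have a7 : n * (searchCalls T (1 / T) * searchRounds T) ≤ 35 * (K * l ^ 2) := by
    calc _ ≤ K * (35 * l ^ 2) := by gcongr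
      _ = _ := by ring
  have a8 : n * ((1 + 10 * K) * keepRounds K T (1 / T)) ≤ 363 * (K ^ 2 * l) := by
    calc _ ≤ K * ((K + 10 * K) * (33 * l)) := by gcongr
      _ = _ := by ring
  have hKK : (K : ℝ) ≤ K ^ 2 := le_self_pow₀ hK (by norm_num)
  have hl2 : 16 ≤ l ^ 2 := by
    have := pow_le_pow_left₀ (by norm_num) hl 2
    norm_num at this
    exact this
  have hl1 : l ≤ l ^ 2 / 4 := by
    have : 4 * l ≤ l * l := by gcongr
    rw [pow_two]
    linarith
  have hK2 : 1 ≤ (K : ℝ) ^ 2 := one_le_pow₀ hK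
  have c1 : (K : ℝ) * l ^ 2 ≤ K ^ 2 * l ^ 2 := by gcongr
  have c2 : (K : ℝ) ^ 2 * l ≤ K ^ 2 * (l ^ 2 / 4) := by gcongr
  have c3 : (K : ℝ) * 16 ≤ K ^ 2 * l ^ 2 := by gcongr
  have c4 : (1 : ℝ) * 16 ≤ K ^ 2 * l ^ 2 := by gcongr
  have c5 : 0 ≤ c₀ ^ 2 * G := by positivity
  have c6 : 0 ≤ c₀ ^ 2 * ((K : ℝ) ^ 2 * l ^ 2) := by positivity
  generalize G = G at *
  generalize l * √(K * T) = S at *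
  linarith

-- A phase that starts in time has `4 ^ (m - 2) ≤ T_{m-1} ≤ T`.
omit hx in
theorem phase_index_le (hm : 2 ≤ m) (hP : phaseLength K T c₀ (1 / T) (m - 1) ≤ T) :
    m ≤ ⌊2 + Real.log T⌋₊ := by
  have hT := h.T_pos
  obtain ⟨j, rfl⟩ : ∃ j, m = j + 2 := ⟨m - 2, by omega⟩
  have e1 : phaseLength K T c₀ (1 / T) (j + 2 - 1) = 4 ^ j * phaseLength K T c₀ (1 / T) 1 := by
    rw [phaseLength_of_pos (by omega), phaseLength_of_pos le_rfl,
      show j + 2 - 1 = j + 1 by omega, pow_succ]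
    ring
  have e2 : (4 : ℝ) ^ j ≤ T := by
    refine le_trans ?_ (e1 ▸ hP)
    exact le_mul_of_one_le_right (by positivity) hL.one_le_first
  have e3 := Real.log_le_log (by positivity) e2
  rw [Real.log_pow] at e3
  have e4 : 1 ≤ Real.log 4 := by
    rw [show (4 : ℝ) = 2 ^ 2 by norm_num, Real.log_pow]
    have := Real.log_two_gt_d9
    push_cast
    linarith
  have e5 : (j : ℝ) ≤ j * Real.log 4 := le_mul_of_one_le_right (by positivity) e4
  apply Nat.le_floor
  push_cast
  linarith

end Scales

end

end Exploratory

/-! ### Boundedness of the incentives -/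

namespace Principal

variable {K : ℕ} {α β : Type} {obs : ℕ → Fin K × ℝ} {π : ℕ → Fin K → ℝ} {B : ℝ}

/-- All incentives that the procedure proposes are bounded by `B`, and its result satisfies `Φ`. -/
def BoundedBy (obs : ℕ → Fin K × ℝ) (π : ℕ → Fin K → ℝ) (B : ℝ) (q : Principal K α)
    (Φ : α → Prop) : Prop :=
  ∀ t, Wp obs π q t (fun x t' => Φ x ∧ ∀ k, t ≤ k → k < t' → ∀ b, |π k b| ≤ B)

theorem BoundedBy.bind {q : Principal K α} {Φ : α → Prop} {f : α → Principal K β} {Ψ : β → Prop}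
    (h : BoundedBy obs π B q Φ) (hf : ∀ a, Φ a → BoundedBy obs π B (f a) Ψ) :
    BoundedBy obs π B (q >>= f) Ψ := by
  refine fun t => Wp_bind ((h t).mono ?_)
  rintro a t1 - ⟨h1, h2⟩
  refine (hf a h1 t1).mono ?_
  rintro b t2 - ⟨h3, h4⟩
  refine ⟨h3, fun k hk hk' => ?_⟩
  rcases lt_or_ge k t1 with h5 | h5
  · exact h2 k hk h5
  · exact h4 k h5 hk'

theorem BoundedBy.pure {a : α} {Φ : α → Prop} (h : Φ a) :
    BoundedBy obs π B (pure a : Principal K α) Φ :=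
  fun _ => Wp_pure ⟨h, fun _ _ _ => by omega⟩

theorem BoundedBy.propose {p : Fin K → ℝ} (hp : ∀ b, |p b| ≤ B) :
    BoundedBy obs π B (propose p) fun _ => True := by
  refine fun t => Wp_propose fun h => ⟨trivial, fun k hk hk' => ?_⟩
  rw [show k = t by omega, h]
  exact hp

theorem BoundedBy.times {q : Principal K α} {Φ : α → Prop} (h : BoundedBy obs π B q Φ) (n : ℕ) :
    BoundedBy obs π B (times n q) fun xs => ∀ x ∈ xs, Φ x := by
  induction n with
  | zero => exact .pure (by simp)
  | succ n ih =>
    exact h.bind fun x hx => ih.bind fun xs hxs => .pure (List.forall_mem_cons.2 ⟨hx, hxs⟩)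

theorem BoundedBy.forEach {q : β → Principal K α} {Φ : α → Prop} {bs : List β}
    (h : ∀ b ∈ bs, BoundedBy obs π B (q b) Φ) :
    BoundedBy obs π B (forEach q bs) fun xs => ∀ x ∈ xs, Φ x := by
  induction bs with
  | nil => exact .pure (by simp)
  | cons b bs ih =>
    exact (h b (by simp)).bind fun x hx => (ih fun c hc => h c (by simp [hc])).bind fun xs hxs =>
      .pure (List.forall_mem_cons.2 ⟨hx, hxs⟩)

theorem BoundedBy.get_bind {f : Tally K → Principal K α} {Φ : α → Prop}
    (h : ∀ t, BoundedBy obs π B (f (Tally.ofPath obs t)) Φ) : BoundedBy obs π B (get >>= f) Φ :=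
  fun t => Wp_bind (Wp_get (h t t))

end Principal

/-! ### Bounds for the incentives of the stages of the algorithm. -/

namespace Exploratory

open Principal

variable {K T : ℕ} {obs : ℕ → Fin K × ℝ} {π : ℕ → Fin K → ℝ} {B : ℝ}

theorem abs_oneHot_le {a : Fin K} {c : ℝ} (hc : |c| ≤ B) (b : Fin K) : |oneHot a c b| ≤ B := by
  unfold oneHot
  split_ifs
  · exact hc
  · rw [abs_zero]; exact (abs_nonneg c).trans hc

theorem boundedBy_searchLoop (hB : 1 ≤ B) (a : Fin K) (check : Bool) (up lo hi : ℝ) (C1 C2 : ℕ)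
    (hup : up ∈ Set.Icc (0 : ℝ) 1) (hlo : lo ∈ Set.Icc (0 : ℝ) 1) (hhi : hi ∈ Set.Icc (0 : ℝ) 1) :
    BoundedBy obs π B (searchLoop T a check up lo hi C1 C2) fun b => 0 ≤ b := by
  have hone {c : ℝ} (hc : c ∈ Set.Icc (0 : ℝ) 1) : ∀ b, |oneHot a c b| ≤ B :=
    abs_oneHot_le (by rw [abs_of_nonneg hc.1]; exact hc.2.trans hB)
  fun_induction searchLoop T a check up lo hi C1 C2 with
  | case1 check up lo hi C1 C2 ih1 ih2 ih3 =>
    have hmid : (hi + lo) / 2 ∈ Set.Icc (0 : ℝ) 1 :=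
      ⟨by linarith [hlo.1, hhi.1], by linarith [hlo.2, hhi.2]⟩
    refine BoundedBy.get_bind fun t => ?_
    by_cases hc : check = false
    · rw [if_pos hc]
      refine (BoundedBy.propose (hone hmid)).bind fun i _ => ?_
      by_cases hi' : i = a
      · rw [if_pos hi']
        split
        · exact .pure (add_nonneg hmid.1 (by positivity))
        · next hn => exact ih1 hc hn hmid hlo hmid
      · rw [if_neg hi']
        exact ih2 hc hup hmid hhi
    · rw [if_neg hc]
      refine (BoundedBy.propose (hone hup)).bind fun i _ => ?_
      by_cases hi' : i = a
      · rw [if_pos hi']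
        split
        · exact .pure (add_nonneg hup.1 (by positivity))
        · next hn => exact ih3 hc hn hup hlo hhi
      · rw [if_neg hi']
        exact .pure (by have := hup.1; positivity)

variable {c₀ δ : ℝ} {m : ℕ} {act : Finset (Fin K)}

theorem boundedBy_testLoop (a : Fin K) {b : ℝ} (hb : |b| ≤ B) (Y c : ℕ) :
    BoundedBy obs π B (testLoop T c₀ δ m a b Y c) fun _ => True := by
  fun_induction testLoop T c₀ δ m a b Y c with
  | case1 Y c ih =>
    refine (BoundedBy.propose (abs_oneHot_le hb)).bind fun i _ => ?_
    extract_lets c'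
    split
    · exact .pure trivial
    · next h => exact ih i h

theorem boundedBy_testAll (a : Fin K) {bs : List ℝ} (hb : ∀ b ∈ bs, |b| ≤ B) (g : ℝ) :
    BoundedBy obs π B (testAll T c₀ δ m a bs g) fun _ => True := by
  induction bs generalizing g with
  | nil => exact .pure trivial
  | cons b bs ih =>
    refine BoundedBy.bind (boundedBy_testLoop a (hb b (by simp)) 0 0) fun Yc _ => ?_
    extract_lets g'
    split_ifs
    · exact .pure trivial
    · exact ih (fun c hc => hb c (by simp [hc])) _

theorem Tally.mean_ofPath_mem (hobs : ∀ k, (obs k).2 ∈ Set.Icc (0 : ℝ) 1) (t : ℕ) (b : Fin K) :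
    (Tally.ofPath obs t).mean b ∈ Set.Icc (0 : ℝ) 1 := by
  have h : 0 ≤ (Tally.ofPath obs t).total b ∧
      (Tally.ofPath obs t).total b ≤ (Tally.ofPath obs t).count b := by
    induction t with
    | zero => simp [Tally.ofPath, Tally.empty]
    | succ t ih =>
      rw [Tally.ofPath_total_succ, Tally.ofPath_count_succ]
      have := hobs t
      split_ifs
      · push_cast
        exact ⟨by linarith [this.1], by linarith [this.2]⟩
      · simpa using ih
  refine ⟨div_nonneg h.1 (by positivity), ?_⟩
  rw [Tally.mean, div_le_one (by positivity)]
  exact h.2.trans (by exact_mod_cast le_max_right _ _)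

/-- A bound for the incentives. -/
noncomputable def incentiveBound (c₀ : ℝ) : ℝ := 2 + 5 * √(1 / (256 * c₀ ^ 3))

section Horizon

variable (hK : 1 ≤ K) (hT : 2 ≤ T)

include hK hT

theorem confLog_pos : 0 < confLog K T (1 / T) := by
  have hT' : (2 : ℝ) ≤ T := by exact_mod_cast hT
  have hK' : (1 : ℝ) ≤ K := by exact_mod_cast hK
  apply Real.log_pos
  rw [div_div_eq_mul_div, div_one]
  have : (1 : ℝ) * 2 * 2 ≤ K * T * T := by gcongr
  linarith

theorem one_le_log_iota : 1 ≤ Real.log (iota K T (1 / T)) := by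
  have hT' : (2 : ℝ) ≤ T := by exact_mod_cast hT
  have hK' : (1 : ℝ) ≤ K := by exact_mod_cast hK
  have hb : 1 ≤ Real.logb 2 T := by
    rw [← Real.logb_self_eq_one (b := 2) (by norm_num)]
    exact Real.logb_le_logb_of_le (by norm_num) (by norm_num) hT'
  have hg : 2 ≤ Real.log (4 * Real.logb 2 T / (1 / T)) := by
    have h8 : (2 : ℝ) ^ 3 ≤ 4 * Real.logb 2 T / (1 / T) := by
      rw [div_div_eq_mul_div, div_one]
      nlinarith
    refine le_trans ?_ (Real.log_le_log (by norm_num) h8)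
    rw [Real.log_pow]
    have := Real.log_two_gt_d9
    push_cast
    linarith
  have : 3 ≤ iota K T (1 / T) := by
    rw [iota]
    calc (3 : ℝ) ≤ 16 * 1 * 2 ^ 2 * 1 * 2 * 2 := by norm_num
      _ ≤ 16 * K * T ^ 2 * Real.logb 2 T * Real.log (4 * Real.logb 2 T / (1 / T)) * T := by
        gcongr
      _ = _ := by field_simp
  rw [Real.le_log_iff_exp_le (by linarith)]
  have := Real.exp_one_lt_d9
  linarith

theorem phaseLength_pos (hc : 0 < c₀) (m : ℕ) : 0 < phaseLength K T c₀ (1 / T) m := by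
  rcases Nat.eq_zero_or_pos m with rfl | hm
  · rw [phaseLength_zero]; norm_num
  · have h1 := confLog_pos hK hT
    have h2 := one_le_log_iota hK hT
    have hK' : (0 : ℝ) < K := by exact_mod_cast hK
    rw [phaseLength_of_pos hm]
    positivity

theorem abs_enlarge_le (hc : 0 < c₀) (hB : 2 ≤ B) {b : ℝ} (hb : 0 ≤ b) :
    |enlarge K T c₀ (1 / T) m act b| ≤ B := by
  have hP := phaseLength_pos hK hT hc (m - 1)
  have hL : 0 < Real.log (16 * K * T / (1 / T)) := confLog_pos hK hT
  have hρ : 0 ≤ ratio K T c₀ (1 / T) m act := by unfold ratio; positivity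
  have he : 0 ≤ eps K T c₀ (1 / T) m act := by unfold eps; positivity
  have hT' : (1 : ℝ) / T ≤ 1 := by
    rw [div_le_one (by positivity)]
    exact_mod_cast (by omega : 1 ≤ T)
  rw [abs_le, enlarge]
  have h0 : 0 ≤ min (1 + 1 / (T : ℝ)) (b + ratio K T c₀ (1 / T) m act ^ (2 / 3 : ℝ) +
      1 / phaseLength K T c₀ (1 / T) (m - 1) + 4 * eps K T c₀ (1 / T) m act) :=
    le_min (by positivity) (by positivity)
  exact ⟨by linarith, (min_le_left _ _).trans (by linarith)⟩

/-- In every phase `2 T_m ≥ 256 c₀³ L`, for small horizons too, so the bonus is bounded in terms of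
`c₀` alone. -/
theorem abs_compareIncentive_le (hc : 0 < c₀) (hm : 1 ≤ m)
    (hobs : ∀ k, (obs k).2 ∈ Set.Icc (0 : ℝ) 1) (t : ℕ) (a b : Fin K) :
    |compareIncentive T c₀ (1 / T) m act (Tally.ofPath obs t) a b| ≤ incentiveBound c₀ := by
  have h1 := confLog_pos hK hT
  have h2 := one_le_log_iota hK hT
  have hK' : (1 : ℝ) ≤ K := by exact_mod_cast hK
  have hmean := Tally.mean_ofPath_mem hobs t
  have hs0 : 0 ≤ √(1 / (256 * c₀ ^ 3)) := Real.sqrt_nonneg _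
  have hs : √(Real.log (16 * K * T / (1 / T)) / (2 * phaseLength K T c₀ (1 / T) m)) ≤
      √(1 / (256 * c₀ ^ 3)) := by
    apply Real.sqrt_le_sqrt
    change confLog K T (1 / T) / _ ≤ _
    rw [phaseLength_of_pos hm, div_le_div_iff₀ (by positivity) (by positivity), one_mul]
    have e1 : (4 : ℝ) ^ 1 ≤ 4 ^ m := pow_le_pow_right₀ (by norm_num) hm
    have e2 : (1 : ℝ) ≤ Real.log (iota K T (1 / T)) ^ 2 := one_le_pow₀ h2
    calc confLog K T (1 / T) * (256 * c₀ ^ 3) =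
        2 * (32 * c₀ ^ 3 * 4 ^ 1 * 1 * confLog K T (1 / T) * 1) := by ring
      _ ≤ _ := by gcongr
  have hs1 := Real.sqrt_nonneg
    (Real.log (16 * K * T / (1 / T)) / (2 * phaseLength K T c₀ (1 / T) m))
  unfold compareIncentive incentiveBound
  split_ifs
  · rw [abs_of_nonneg (by linarith [(hmean a).1])]
    linarith [(hmean a).2]
  · rw [abs_of_nonneg (by linarith [(hmean b).1])]
    linarith [(hmean b).2]
  · rw [abs_zero]
    linarith

theorem boundedBy_phase (hc : 0 < c₀) (hm : 1 ≤ m)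
    (hobs : ∀ k, (obs k).2 ∈ Set.Icc (0 : ℝ) 1) :
    BoundedBy obs π (incentiveBound c₀) (phase T c₀ (1 / T) m act) fun _ => True := by
  have hB : 2 ≤ incentiveBound c₀ := by
    unfold incentiveBound
    linarith [Real.sqrt_nonneg (1 / (256 * c₀ ^ 3))]
  have hT' : (1 : ℝ) / T ≤ 1 := by
    rw [div_le_one (by positivity)]
    exact_mod_cast (by omega : 1 ≤ T)
  refine (BoundedBy.forEach (Φ := fun _ => True) fun a _ => ?_).bind fun _ _ => ?_
  · refine fun t => ((BoundedBy.propose (abs_oneHot_le ?_)).times _ t).mono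
      fun _ _ _ h => ⟨trivial, h.2⟩
    rw [abs_of_nonneg (by positivity)]
    linarith
  refine (BoundedBy.forEach (Φ := fun p : Fin K × List ℝ => ∀ b ∈ p.2, |b| ≤ incentiveBound c₀)
    fun a _ => ?_).bind fun found hfound => ?_
  · refine BoundedBy.bind (BoundedBy.times (boundedBy_searchLoop (by linarith) a false 1 0 1 0 0
      (by simp) (by simp) (by simp)) _) fun bs hbs => .pure fun b hb => ?_
    obtain ⟨b', hb', rfl⟩ := List.mem_map.1 hb
    exact abs_enlarge_le hK hT hc hB (hbs b' ((List.mem_insertionSort _).1 hb'))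
  refine (BoundedBy.forEach (Φ := fun _ => True)
    fun p hp => boundedBy_testAll p.1 (hfound p hp) 0).bind fun _ _ => ?_
  refine (BoundedBy.forEach (Φ := fun _ => True) fun a _ => ?_).bind fun _ _ => .pure trivial
  refine BoundedBy.bind (Φ := fun _ => True) ?_ fun _ _ => .pure trivial
  refine BoundedBy.get_bind fun t => ?_
  exact ((BoundedBy.propose (abs_compareIncentive_le hK hT hc hm hobs t a)).bind
    (Ψ := fun _ => True) fun _ _ => .pure trivial).times _ |>.bind fun _ _ => .pure trivial

theorem boundedBy_phases (hc : 0 < c₀) (hobs : ∀ k, (obs k).2 ∈ Set.Icc (0 : ℝ) 1)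
    (n m : ℕ) (hm : 1 ≤ m) (act : Finset (Fin K)) :
    BoundedBy obs π (incentiveBound c₀) (phases T c₀ (1 / T) n m act) fun _ => True := by
  induction n generalizing m act with
  | zero => exact .pure trivial
  | succ n ih =>
    exact BoundedBy.bind (boundedBy_phase hK hT hc hm hobs) fun act' _ => ih _ (by omega) _

theorem abs_incentiveAt_le (hc : 0 < c₀) {n : ℕ} (hobs : ∀ k < n, (obs k).2 ∈ Set.Icc (0 : ℝ) 1)
    (b : Fin K) :
    |(algorithm K T c₀ (1 / T)).incentiveAt obs n b| ≤ incentiveBound c₀ := by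
  -- Only the rewards before step `n` are known to lie in `[0, 1]`. Later ones do not influence the
  -- incentive of this step and are replaced by zero.
  set obs' : ℕ → Fin K × ℝ := fun k => if k < n then obs k else ((obs k).1, 0) with hobs'
  have h1 : ∀ k, (obs' k).2 ∈ Set.Icc (0 : ℝ) 1 := fun k => by
    simp only [hobs']
    split_ifs with hk
    · exact hobs k hk
    · simp
  rw [Protocol.incentiveAt_congr (obs' := obs') _ fun s hs => by simp [hobs', hs]]
  obtain ⟨_, t', ⟨-, -, -, h2⟩, h3⟩ := Protocol.exists_of_wp
    (π := fun k => (algorithm K T c₀ (1 / T)).incentiveAt obs' k)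
    (boundedBy_phases hK hT hc h1 T 1 le_rfl Finset.univ 0) fun s => by simp only [zero_add]; rfl
  rcases lt_or_ge n t' with h4 | h4
  · exact h2 n (Nat.zero_le _) h4 b
  · have := congrFun (h3 n h4) b
    simp only [Pi.zero_apply] at this
    rw [this, abs_zero]
    unfold incentiveBound
    positivity

end Horizon

end Exploratory

/-! ### The expected regret -/

namespace Exploratory

open Filter

variable {Ω : Type*} {mΩ : MeasurableSpace Ω} {P : Measure Ω} {K : ℕ} {X R : ℕ → Fin K → Ω → ℝ}
  {A : ℕ → Ω → Fin K} {T : ℕ} {c₀ : ℝ} {D : Arms K}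

namespace Arms

theorem integral_mem_Icc {ν : Measure ℝ} [IsProbabilityMeasure ν]
    (h : ∀ᵐ x ∂ν, x ∈ Set.Icc (0 : ℝ) 1) : ∫ x, x ∂ν ∈ Set.Icc (0 : ℝ) 1 := by
  have hi : Integrable (fun x : ℝ => x) ν :=
    Integrable.of_bound measurable_id.aestronglyMeasurable 1 (h.mono fun x hx => by
      rw [Real.norm_of_nonneg hx.1]; exact hx.2)
  refine ⟨integral_nonneg_of_ae (h.mono fun x hx => hx.1), ?_⟩
  calc ∫ x, x ∂ν ≤ ∫ _, 1 ∂ν := integral_mono_ae hi (integrable_const 1) (h.mono fun x hx => hx.2)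
    _ = 1 := by simp

theorem θ_mem (D : Arms K) (a : Fin K) : D.θ a ∈ Set.Icc (0 : ℝ) 1 :=
  have := D.principal_prob a
  integral_mem_Icc (D.principal_supp a)

theorem μ_mem (D : Arms K) (a : Fin K) : D.μ a ∈ Set.Icc (0 : ℝ) 1 :=
  have := D.agent_prob a
  integral_mem_Icc (D.agent_supp a)

end Arms

theorem iSup_eq_of_forall_le {f : Fin K → ℝ} {i : Fin K} (h : ∀ j, f j ≤ f i) : ⨆ j, f j = f i :=
  have : Nonempty (Fin K) := ⟨i⟩
  le_antisymm (ciSup_le h) (le_ciSup (Set.finite_range f).bddAbove i)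

theorem regretBar_eq {alg : Protocol K (Unit × Tally K)} {s z : Fin K} (hM : ∀ b, D.μ b ≤ D.μ z)
    (hV : ∀ b, D.θ b + D.μ b ≤ D.θ s + D.μ s) (ω : Ω) :
    regretBar X A alg D T ω = ∑ k ∈ Finset.range T, (D.θ s + D.μ s - D.μ z -
      (D.θ (pathOf X A ω k).1 - ∑ a, alg.incentiveAt (pathOf X A ω) k a)) := by
  rw [regretBar, iSup_eq_of_forall_le hV, iSup_eq_of_forall_le hM,
    show Finset.Icc 1 T = Finset.Ico (0 + 1) (T + 1) by ext; simp, ← Finset.sum_Ico_add',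
    Finset.range_eq_Ico]
  rfl

/-- The right hand side of the regret bound, where `l` stands for the logarithm. -/
noncomputable def rate (K T : ℕ) (l : ℝ) : ℝ :=
  l ^ (5 / 3 : ℝ) * (K : ℝ) ^ (1 / 3 : ℝ) * (T : ℝ) ^ (2 / 3 : ℝ) + l ^ 2 * √(K * T) +
    (K : ℝ) ^ 2 * l ^ 3

theorem rate_mono {l l' : ℝ} (h0 : 0 ≤ l) (h : l ≤ l') : rate K T l ≤ rate K T l' := by
  unfold rate
  gcongr

theorem sq_mul_le_rate {l : ℝ} (h0 : 0 ≤ l) : (K : ℝ) ^ 2 * l ^ 3 ≤ rate K T l := by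
  unfold rate
  have : 0 ≤ l ^ (5 / 3 : ℝ) * (K : ℝ) ^ (1 / 3 : ℝ) * (T : ℝ) ^ (2 / 3 : ℝ) := by positivity
  have : 0 ≤ l ^ 2 * √(K * T : ℝ) := by positivity
  linarith

/-- The constant of the regret bound along good paths. -/
noncomputable def goodConst (c₀ : ℝ) : ℝ :=
  ((264 + 15 * c₀ ^ 2) * (18432 * c₀ ^ 3) + 433) + 2 * (900 + 30 * c₀ ^ 2)

theorem IsGood.regretBar_le {ω : Ω} (hg : IsGood X R A T c₀ (1 / T) D ω) (h : Scales K T c₀)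
    (hL : Large K T c₀ (1 / T)) (hx : 35 * (64 * c₀ ^ 2 + 128) ≤ c₀ ^ 3 * Real.log T) :
    regretBar X A (algorithm K T c₀ (1 / T)) D T ω ≤ goodConst c₀ * rate K T (Real.log T) := by
  have hl := h.log_ge
  have hc := h.c₀_pos
  have : Nonempty (Fin K) := ⟨⟨0, h.one_le_K⟩⟩
  obtain ⟨z, hz⟩ := Finite.exists_max D.μ
  obtain ⟨s, hs⟩ := Finite.exists_max fun b => D.θ b + D.μ b
  have hT := h.T_pos
  have hNT : ⌊2 + Real.log T⌋₊ ≤ T := by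
    have h1 := Real.quadratic_le_exp_of_nonneg (show 0 ≤ Real.log T by linarith)
    rw [Real.exp_log hT] at h1
    have h2 := Nat.floor_le (show 0 ≤ 2 + Real.log T by linarith)
    have : (⌊2 + Real.log T⌋₊ : ℝ) ≤ T := h2.trans (by nlinarith)
    exact_mod_cast this
  rw [regretBar_eq hz hs]
  refine (regret_le_of_goodPath hL hg D.θ_mem D.μ_mem hz hs (by positivity)
    (fun m act hm hact hP => h.phaseCost_le hL hx hm hact hP) (h.phaseCost_first_le hL hx)
    (fun m hm hP => h.phase_index_le hL hm hP) hNT).trans ?_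
  have hN : (⌊2 + Real.log T⌋₊ : ℝ) ≤ 2 * Real.log T :=
    (Nat.floor_le (by linarith)).trans (by linarith)
  unfold rate goodConst
  set l := Real.log T
  have e1 : l ^ (5 / 3 : ℝ) = l ^ (2 / 3 : ℝ) * l := by
    rw [show (5 / 3 : ℝ) = 2 / 3 + 1 by norm_num, Real.rpow_add_one (by linarith)]
  set G := l ^ (2 / 3 : ℝ) * (K : ℝ) ^ (1 / 3 : ℝ) * (T : ℝ) ^ (2 / 3 : ℝ) with hG
  have e2 : l ^ (5 / 3 : ℝ) * (K : ℝ) ^ (1 / 3 : ℝ) * (T : ℝ) ^ (2 / 3 : ℝ) = G * l := by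
    rw [e1, hG]; ring
  rw [e2]
  have hG0 : 0 ≤ G := by positivity
  set S := √(K * T : ℝ)
  have hS0 : 0 ≤ S := Real.sqrt_nonneg _
  set c₁ := (264 + 15 * c₀ ^ 2) * (18432 * c₀ ^ 3) + 433 with hc₁
  have hc1 : 0 ≤ c₁ := by positivity
  set c₂ := 900 + 30 * c₀ ^ 2 with hc₂
  have hc2 : 0 ≤ c₂ := by positivity
  calc c₁ * (K ^ 2 * l ^ 3) + c₂ * (G + l * S + K ^ 2 * l ^ 2) * ⌊2 + l⌋₊ ≤
        c₁ * (K ^ 2 * l ^ 3) + c₂ * (G + l * S + K ^ 2 * l ^ 2) * (2 * l) := by gcongr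
    _ = c₁ * (K ^ 2 * l ^ 3) + 2 * c₂ * (G * l + l ^ 2 * S + K ^ 2 * l ^ 3) := by ring
    _ ≤ c₁ * (G * l + l ^ 2 * S + K ^ 2 * l ^ 3) + 2 * c₂ * (G * l + l ^ 2 * S + K ^ 2 * l ^ 3) := by
        gcongr
        have : 0 ≤ G * l + l ^ 2 * S := by positivity
        linarith
    _ = _ := by ring

theorem measurable_regretBar
    (h : IsExploratoryGame X R A (algorithm K T c₀ (1 / T)) P T c₀ D) :
    Measurable (regretBar X A (algorithm K T c₀ (1 / T)) D T) := by
  unfold regretBar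
  refine Finset.measurable_fun_sum _ fun t ht => measurable_const.sub (Measurable.sub ?_ ?_)
  · exact (measurable_of_finite D.θ).comp (h.measurable_A t ht)
  · have hIco : ∀ s ∈ Finset.Ico 1 t, s ∈ Finset.Icc 1 T := fun s hs => by
      simp only [Finset.mem_Ico, Finset.mem_Icc] at hs ht ⊢
      omega
    have := measurable_incentive (X := X) (A := A) T c₀ (1 / T) (t := t)
      (fun s hs => h.measurable_A s (hIco s hs))
      (fun s hs => IsExploratoryGame.measurable_selected h.measurable_X h.measurable_A (hIco s hs))
    exact Finset.measurable_fun_sum _ fun a _ => (measurable_pi_apply a).comp this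

/-- A trivial bound for the regret of a round, per arm. -/
noncomputable def trivialConst (c₀ : ℝ) : ℝ := 4 + incentiveBound c₀

theorem trivialConst_ge : 4 ≤ trivialConst c₀ := by
  unfold trivialConst incentiveBound
  have := Real.sqrt_nonneg (1 / (256 * c₀ ^ 3))
  linarith

theorem abs_regretBar_le (hc : 0 < c₀) (hK : 1 ≤ K) (hT : 2 ≤ T) {ω : Ω}
    (hω : ∀ t ∈ Finset.Icc 1 T, ∀ b, X t b ω ∈ Set.Icc (0 : ℝ) 1) :
    |regretBar X A (algorithm K T c₀ (1 / T)) D T ω| ≤ trivialConst c₀ * K * T := by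
  have : Nonempty (Fin K) := ⟨⟨0, hK⟩⟩
  obtain ⟨z, hz⟩ := Finite.exists_max D.μ
  obtain ⟨s, hs⟩ := Finite.exists_max fun b => D.θ b + D.μ b
  have hK' : (1 : ℝ) ≤ K := by exact_mod_cast hK
  rw [regretBar_eq hz hs]
  refine (Finset.abs_sum_le_sum_abs _ _).trans ((Finset.sum_le_card_nsmul _ _
    (trivialConst c₀ * K) fun k hk => ?_).trans (le_of_eq ?_))
  · have h1 : |∑ a, (algorithm K T c₀ (1 / T)).incentiveAt (pathOf X A ω) k a| ≤
        K * incentiveBound c₀ := by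
      refine (Finset.abs_sum_le_sum_abs _ _).trans ((Finset.sum_le_card_nsmul _ _
        (incentiveBound c₀) fun b _ => abs_incentiveAt_le hK hT hc (fun j hj => ?_) b).trans
        (le_of_eq (by simp)))
      have := Finset.mem_range.1 hk
      exact hω (j + 1) (by simp; omega) _
    have h2 := D.θ_mem s
    have h3 := D.μ_mem s
    have h4 := D.μ_mem z
    have h5 := D.θ_mem (pathOf X A ω k).1
    rw [abs_le] at h1 ⊢
    unfold trivialConst
    constructor <;> nlinarith [h1.1, h1.2, h2.1, h2.2, h3.1, h3.2, h4.1, h4.2, h5.1, h5.2]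
  · rw [Finset.card_range, nsmul_eq_mul]
    ring

theorem ae_abs_regretBar_le (hc : 0 < c₀) (hK : 1 ≤ K) (hT : 2 ≤ T)
    (h : IsExploratoryGame X R A (algorithm K T c₀ (1 / T)) P T c₀ D) :
    ∀ᵐ ω ∂P, |regretBar X A (algorithm K T c₀ (1 / T)) D T ω| ≤ trivialConst c₀ * K * T := by
  have hae : ∀ᵐ ω ∂P, ∀ b, ∀ t ∈ Finset.Icc 1 T, X t b ω ∈ Set.Icc (0 : ℝ) 1 := by
    rw [ae_all_iff]
    intro b
    exact (ae_ball_iff (Finset.countable_toSet _)).2 fun t ht =>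
      (h.freshRewards_principal b).mem_Icc t ht
  filter_upwards [hae] with ω hω
  exact abs_regretBar_le hc hK hT fun t ht b => hω b t ht

variable [IsProbabilityMeasure P]

theorem integrable_regretBar (hc : 0 < c₀) (hK : 1 ≤ K) (hT : 2 ≤ T)
    (h : IsExploratoryGame X R A (algorithm K T c₀ (1 / T)) P T c₀ D) :
    Integrable (regretBar X A (algorithm K T c₀ (1 / T)) D T) P :=
  Integrable.of_bound (measurable_regretBar h).aestronglyMeasurable _
    (ae_abs_regretBar_le hc hK hT h)

theorem integral_regretBar_le_trivial (hc : 0 < c₀) (hK : 1 ≤ K) (hT : 2 ≤ T)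
    (h : IsExploratoryGame X R A (algorithm K T c₀ (1 / T)) P T c₀ D) :
    ∫ ω, regretBar X A (algorithm K T c₀ (1 / T)) D T ω ∂P ≤ trivialConst c₀ * K * T := by
  calc _ ≤ ∫ _, trivialConst c₀ * K * T ∂P :=
        integral_mono_ae (integrable_regretBar hc hK hT h) (integrable_const _)
          ((ae_abs_regretBar_le hc hK hT h).mono fun ω hω => (le_abs_self _).trans hω)
    _ = _ := by simp

/-- On the bad event the trivial bound of order `K T` meets the probability `10 / T`, so `T`
cancels. -/
theorem integral_regretBar_le (h : IsExploratoryGame X R A (algorithm K T c₀ (1 / T)) P T c₀ D)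
    (hs : Scales K T c₀) (hL : Large K T c₀ (1 / T)) (hr : RareScales T c₀)
    (hx : 35 * (64 * c₀ ^ 2 + 128) ≤ c₀ ^ 3 * Real.log T) :
    ∫ ω, regretBar X A (algorithm K T c₀ (1 / T)) D T ω ∂P ≤
      goodConst c₀ * rate K T (Real.log T) + trivialConst c₀ * K * 10 := by
  have hc := hs.c₀_pos
  have hT := hs.T_pos
  have hl := hs.log_ge
  obtain ⟨S, hS, hPS, hgood⟩ := exists_measure_bad_le h hL (hr.rareExploration hs hL)
    hs.four_mul_exp_le
  set F := goodConst c₀ * rate K T (Real.log T)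
  set M := trivialConst c₀ * K * T with hM
  have hF : 0 ≤ F := by
    have := (sq_mul_le_rate (K := K) (T := T) (l := Real.log T) (by linarith))
    have : 0 ≤ goodConst c₀ := by unfold goodConst; positivity
    have : 0 ≤ rate K T (Real.log T) := le_trans (by positivity)
      (sq_mul_le_rate (K := K) (T := T) (l := Real.log T) (by linarith))
    positivity
  have hM0 : 0 ≤ M := by
    have := trivialConst_ge (c₀ := c₀)
    positivity
  have hint : Integrable (S.indicator fun _ => M) P := (integrable_const M).indicator hS
  calc _ ≤ ∫ ω, (F + S.indicator (fun _ => M) ω) ∂P := by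
        refine integral_mono_ae (integrable_regretBar hc hs.one_le_K hL.two_le_T h)
          ((integrable_const F).add hint) ?_
        filter_upwards [hgood, ae_abs_regretBar_le hc hs.one_le_K hL.two_le_T h] with ω h1 h2
        by_cases hω : ω ∈ S
        · rw [Set.indicator_of_mem hω]
          linarith [le_abs_self (regretBar X A (algorithm K T c₀ (1 / T)) D T ω)]
        · rw [Set.indicator_of_notMem hω, add_zero]
          exact (h1 hω).regretBar_le hs hL hx
    _ = F + P.real S * M := by
        rw [integral_add (integrable_const F) hint, integral_indicator_const _ hS]
        simp
    _ ≤ F + 10 / T * M := by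
        gcongr
        exact ENNReal.toReal_le_of_le_ofReal (by positivity) hPS
    _ = _ := by
        rw [hM]
        field_simp

end Exploratory

theorem mainTheorem5 (c₀ : ℝ) (hc₀ : 0 < c₀) (κ : ℝ) (hκ : 0 < κ) :
    ∃ C : ℝ, 0 < C ∧ ∀ (K T : ℕ), 1 ≤ K → 2 ≤ T → κ * K ≤ T →
      ∀ (D : Exploratory.Arms K) (Ω : Type*) [MeasurableSpace Ω] (P : Measure Ω)
        [IsProbabilityMeasure P] (X R : ℕ → Fin K → Ω → ℝ) (A : ℕ → Ω → Fin K),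
        Exploratory.IsExploratoryGame X R A (Exploratory.algorithm K T c₀ (1 / T)) P T c₀ D →
          Integrable (Exploratory.regretBar X A (Exploratory.algorithm K T c₀ (1 / T)) D T) P ∧
          ∫ ω, Exploratory.regretBar X A (Exploratory.algorithm K T c₀ (1 / T)) D T ω ∂P ≤
            C * (Real.log (K * T) ^ (5 / 3 : ℝ) * (K : ℝ) ^ (1 / 3 : ℝ) * (T : ℝ) ^ (2 / 3 : ℝ) +
              Real.log (K * T) ^ 2 * √(K * T) + (K : ℝ) ^ 2 * Real.log (K * T) ^ 3) := by
  obtain ⟨T₀, hT₀⟩ := Filter.eventually_atTop.1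
    (((Exploratory.eventually_scales hκ hc₀).and (Exploratory.eventually_sizes hc₀)).and
      (Exploratory.eventually_rareScales hc₀))
  set G := Exploratory.goodConst c₀ with hG
  set V := Exploratory.trivialConst c₀ with hV
  have hG0 : 0 < G := by rw [hG, Exploratory.goodConst]; positivity
  have hV4 : 4 ≤ V := Exploratory.trivialConst_ge
  -- The summand `40 * V` pays for the bad event through `K ≤ 4 * Q`, and `4 * V * T₀` pays for the
  -- horizons below `T₀`.
  refine ⟨G + 40 * V + 4 * V * T₀, by positivity, ?_⟩
  intro K T hK hT hKT D Ω _ P _ X R A h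
  refine ⟨Exploratory.integrable_regretBar hc₀ hK hT h, ?_⟩
  change _ ≤ _ * Exploratory.rate K T (Real.log (K * T))
  have hK1 : (1 : ℝ) ≤ K := by exact_mod_cast hK
  have hT2 : (2 : ℝ) ≤ T := by exact_mod_cast hT
  have hlT : 0 ≤ Real.log T := Real.log_nonneg (by linarith)
  have hlog : Real.log T ≤ Real.log (K * T) := Real.log_le_log (by linarith) (by nlinarith)
  have hlog2 : 69 / 100 ≤ Real.log (K * T) := by
    have h1 : Real.log 2 ≤ Real.log T := Real.log_le_log (by norm_num) hT2
    linarith [Real.log_two_gt_d9]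
  have hmono := Exploratory.rate_mono (K := K) (T := T) hlT hlog
  -- The summand `K² log³(K T)` suffices, because `log(K T) ≥ log 2 > 0.69` and `4 * 0.69³ > 1`.
  have hKrate : (K : ℝ) ≤ 4 * Exploratory.rate K T (Real.log (K * T)) := by
    have h1 := Exploratory.sq_mul_le_rate (K := K) (T := T)
      (show 0 ≤ Real.log (K * T) by linarith)
    have h2 : (69 / 100 : ℝ) ^ 3 ≤ Real.log (K * T) ^ 3 := by gcongr
    have h3 : (K : ℝ) * (69 / 100 : ℝ) ^ 3 ≤ K ^ 2 * Real.log (K * T) ^ 3 := by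
      gcongr
      exact le_self_pow₀ hK1 (by norm_num)
    norm_num at h3
    linarith
  set Q := Exploratory.rate K T (Real.log (K * T))
  have hQ0 : 0 ≤ Q := by linarith
  rcases lt_or_ge T T₀ with hlt | hge
  · have hlt' : (T : ℝ) ≤ T₀ := by exact_mod_cast hlt.le
    calc _ ≤ V * K * T := Exploratory.integral_regretBar_le_trivial hc₀ hK hT h
      _ ≤ V * (4 * Q) * T₀ := by gcongr
      _ = 4 * V * T₀ * Q := by ring
      _ ≤ _ := by
        gcongr
        linarith
  · obtain ⟨⟨h1, h2, h3, h4, h5⟩, h6⟩ := hT₀ T hge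
    have hs := h1 K hK hKT
    calc _ ≤ G * Exploratory.rate K T (Real.log T) + V * K * 10 :=
          Exploratory.integral_regretBar_le h hs (hs.large h2 h3 h4) h6 h5
      _ ≤ G * Q + V * (4 * Q) * 10 := by gcongr
      _ = (G + 40 * V) * Q := by ring
      _ ≤ _ := by
        refine mul_le_mul_of_nonneg_right ?_ hQ0
        have : 0 ≤ 4 * V * (T₀ : ℝ) := by positivity
        linarith
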